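/- Let $f(x)=a-x^2$ with $a\in(1,2)$ be such that $0$ is strictly pre-periodic under $f$ (not periodic, but some iterate of it is periodic), let $d\ge 2$ be an integer, let $\mathbb T=\mathbb R/\mathbb Z$, and let $\phi:\mathbb T\to\mathbb R$ be a non-constant real-analytic function with $|\phi|\le 1$. For $\alpha>0$ let $F(\theta,x)=(d\theta,\,f(x)+\alpha\phi(\theta))$ on $\mathbb T\times\mathbb R$ and write $F^n(\theta,x)=(d^n\theta,f_n(\theta,x))$. Fix the following auxiliary data. * A number $\beta$ with $1<\beta<|p_1|$, where $p_1=\frac{-1-\sqrt{1+4a}}{2}$, such that $B=[-\beta,\beta]$ satisfies $f(B)\subset \operatorname{int}B$. * A number $\xi_0>0$ such that $f^i(0)\notin(-2\xi_0,2\xi_0)$ for all $i\ge1$. * An integer $n_0\ge 0$. Let $I_1=[f(0)-2\alpha,f(0)+2\alpha]$, and for $n\ge1$ let $I_{n+1}$ be the closed interval obtained from the interval $f(I_n)$ by enlarging it by $\alpha$ at each end. Let $N(\alpha)$ be the maximal integer $N\ge 0$ such that $|I_n|<\xi_0$ for $n=1,\dots,N$ and $\sum_{n=1}^{N}|I_n|\le\xi_0$.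 Let $B_\alpha=[-2\alpha^{0.6},2\alpha^{0.6}]$. Identify $\mathbb T$ with $[0,1)$ and put $g(\theta)=d\theta \bmod 1$. A curve $X:[0,1)\to B$ is called admissible if there are $n\ge n_0+1$, an interval $\omega=[j/d^n,(j+1)/d^n)$ with $0\le j<d^n$, and $x_0\in B$ such that $X(g^n(\theta))=f_n(\theta,x_0)$ for all $\theta\in\omega$. For $n\ge1$ define the truncated vertical derivative $$\frac{\hat\partial f_n(\theta,x)}{\partial x}=\prod_{i=0}^{n-1}\max\bigl(2|f_i(\theta,x)|,\,2\alpha\bigr).$$ Then there exists $\lambda_1>1$ such that for each positive integer $M$ there is $\alpha_0>0$ such that the following holds for all $0<\alpha<\alpha_0$. If $X$ is an admissible curve with values in $B_\alpha$, then for Lebesgue-a.e. $\theta\in[0,1)$, $$\left|\frac{\hat\partial f_n(\theta,X(\theta))}{\partial x}\right|\ge\lambda_1^{\,nM/N(\alpha)}\qquad\text{for all sufficiently large } n.$$ -/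

import Mathlib

open Set Filter MeasureTheory

noncomputable section

namespace VianaMap

/-- The quadratic map `f(x) = a - x²`. -/
def quad (a : ℝ) (x : ℝ) : ℝ := a - x ^ 2

/-- `x` is strictly pre-periodic under `f`: it is not periodic, but some iterate of it is. -/
def IsStrictlyPreperiodic (f : ℝ → ℝ) (x : ℝ) : Prop :=
  x ∉ Function.periodicPts f ∧ ∃ m : ℕ, f^[m] x ∈ Function.periodicPts f

/-- A function on the circle `ℝ/ℤ` is real-analytic if its lift to `ℝ` is. -/
def IsRealAnalytic (φ : UnitAddCircle → ℝ) : Prop :=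
  AnalyticOnNhd ℝ (fun t : ℝ => φ (t : UnitAddCircle)) univ

/-- The skew product `F(θ, x) = (dθ, f(x) + αφ(θ))` on `ℝ/ℤ × ℝ`. -/
def skew (a : ℝ) (d : ℕ) (φ : UnitAddCircle → ℝ) (α : ℝ) (z : UnitAddCircle × ℝ) :
    UnitAddCircle × ℝ :=
  (d • z.1, quad a z.2 + α * φ z.1)

/-- The fibre component `fₙ`, so that `Fⁿ(θ, x) = (dⁿθ, fₙ(θ, x))`. -/
def fib (a : ℝ) (d : ℕ) (φ : UnitAddCircle → ℝ) (α : ℝ) (n : ℕ) (θ : UnitAddCircle) (x : ℝ) : ℝ :=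
  ((skew a d φ α)^[n] (θ, x)).2

/-- The interval `B_α = [-2α^0.6, 2α^0.6]`. -/
def critNhd (α : ℝ) : Set ℝ := Icc (-(2 * α ^ (0.6 : ℝ))) (2 * α ^ (0.6 : ℝ))

/-- The element `[j/dⁿ, (j+1)/dⁿ)` of the partition `𝒫ₙ` of `[0,1)` (for `j < dⁿ`). -/
def cell (d n j : ℕ) : Set ℝ := Ico ((j : ℝ) / (d : ℝ) ^ n) (((j : ℝ) + 1) / (d : ℝ) ^ n)

/-- The curve `X : [0,1) → B`, with `B = [-β, β]`, is admissible: it is the image of a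
horizontal curve under `Fⁿ` for some `n ≥ n₀ + 1`, i.e. there are `ω ∈ 𝒫ₙ` and `x₀ ∈ B` with
`X(gⁿ θ) = fₙ(θ, x₀)` for all `θ ∈ ω`, where `g(θ) = dθ mod 1`.
Only the values of `X` on `[0,1)` matter. -/
def IsAdmissible (a : ℝ) (d : ℕ) (φ : UnitAddCircle → ℝ) (α β : ℝ) (n₀ : ℕ) (X : ℝ → ℝ) : Prop :=
  MapsTo X (Ico 0 1) (Icc (-β) β) ∧
    ∃ n : ℕ, n₀ + 1 ≤ n ∧ ∃ j : ℕ, j < d ^ n ∧ ∃ x₀ ∈ Icc (-β) β,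
      ∀ θ ∈ cell d n j, X (Int.fract ((d : ℝ) ^ n * θ)) = fib a d φ α n (θ : UnitAddCircle) x₀

/-- The intervals `I₁, I₂, …` (`shadow a α n` is `I_{n+1}`): `I₁ = [c₁ - 2α, c₁ + 2α]` with
`c₁ = f(0) = a`, and `I_{n+1}` is the interval `f(Iₙ)` enlarged by `α` on both sides. -/
def shadow (a α : ℝ) : ℕ → Set ℝ
  | 0 => Icc (quad a 0 - 2 * α) (quad a 0 + 2 * α)
  | n + 1 => Icc (sInf (quad a '' shadow a α n) - α) (sSup (quad a '' shadow a α n) + α)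

/-- The integers `N ≥ 0` with `|Iₙ| < ξ₀` for `n = 1, …, N` and `|I₁| + ⋯ + |I_N| ≤ ξ₀`.
The length `|I|` of an interval is its diameter. -/
def bindingSet (a ξ₀ α : ℝ) : Set ℕ :=
  {N | (∀ n < N, Metric.diam (shadow a α n) < ξ₀) ∧
    ∑ n ∈ Finset.range N, Metric.diam (shadow a α n) ≤ ξ₀}

/-- `N(α)`, the greatest element of `bindingSet`. -/
def bindingTime (a ξ₀ α : ℝ) : ℕ := sSup (bindingSet a ξ₀ α)

theorem shadow_nonempty_compact (a : ℝ) {α : ℝ} (hα : 0 < α) (n : ℕ) :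
    (shadow a α n).Nonempty ∧ IsCompact (shadow a α n) ∧ 2 * α ≤ Metric.diam (shadow a α n) := by
  have hc : Continuous (quad a) := by unfold quad; fun_prop
  induction n with
  | zero =>
    have h : quad a 0 - 2 * α ≤ quad a 0 + 2 * α := by linarith
    refine ⟨nonempty_Icc.2 h, isCompact_Icc, ?_⟩
    rw [shadow, Real.diam_Icc h]
    linarith
  | succ n ih =>
    obtain ⟨hne, hk, -⟩ := ih
    have hk' := hk.image hc
    have h1 : sInf (quad a '' shadow a α n) ≤ sSup (quad a '' shadow a α n) :=
      Real.sInf_le_sSup _ hk'.bddBelow hk'.bddAbove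
    have h : sInf (quad a '' shadow a α n) - α ≤ sSup (quad a '' shadow a α n) + α := by linarith
    refine ⟨nonempty_Icc.2 h, isCompact_Icc, ?_⟩
    rw [shadow, Real.diam_Icc h]
    linarith

/-- `N(α)` is well defined: the maximum exists. -/
theorem isGreatest_bindingTime (a : ℝ) {ξ₀ α : ℝ} (hξ : 0 < ξ₀) (hα : 0 < α) :
    IsGreatest (bindingSet a ξ₀ α) (bindingTime a ξ₀ α) := by
  have hne : (bindingSet a ξ₀ α).Nonempty := ⟨0, by simp, by simpa using hξ.le⟩
  have hb : BddAbove (bindingSet a ξ₀ α) := by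
    obtain ⟨K, hK⟩ := exists_nat_gt (ξ₀ / (2 * α))
    refine ⟨K, fun N hN => ?_⟩
    have h1 : ∑ _n ∈ Finset.range N, 2 * α ≤ ξ₀ :=
      (Finset.sum_le_sum fun n _ => (shadow_nonempty_compact a hα n).2.2).trans hN.2
    rw [Finset.sum_const, Finset.card_range, nsmul_eq_mul] at h1
    have h2 : (N : ℝ) ≤ ξ₀ / (2 * α) := by rw [le_div_iff₀ (by linarith)]; exact h1
    exact_mod_cast (h2.trans hK.le)
  exact ⟨Nat.sSup_mem hne hb, fun N hN => le_csSup hb hN⟩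

/-- The truncated vertical derivative `∏_{i<n} max(2|fᵢ(θ, x)|, 2α)`. -/
def truncDeriv (a : ℝ) (d : ℕ) (φ : UnitAddCircle → ℝ) (α : ℝ) (n : ℕ)
    (θ : UnitAddCircle) (x : ℝ) : ℝ :=
  ∏ i ∈ Finset.range n, max (2 * |fib a d φ α i θ x|) (2 * α)

end VianaMap

end

/-!
The fibre map is `f(x) = a - x²` perturbed by `αφ`, and almost every fibre orbit that starts on an
image of a horizontal curve has to be shown to expand at the rate `λ^{M/N(α)}` per step for every
`M`, once `α` is small.

*Expansion away from the critical point.* Since `0` is strictly pre-periodic, its forward orbit is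
finite. In the Hilbert metric `hilb` of the gaps between the points of this orbit and the boundary
points `±p`, the map `f` does not contract (`Setting.hilb_core`), and this gives uniform expansion
of perturbed orbits between visits to a neighbourhood of `0` (`Setting.free_growth`). After a visit
the orbit follows the critical orbit for a time in which the small derivative at the visit is more
than compensated (`Setting.exists_binding_gain`). Only the deep visits, to `|x| ≤ α^{0.6}`, called
returns, are not controlled in this way, and each costs at most a factor of the order of `λ^{N(α)}`
(`Setting.tprod_growth`). A return is followed by at least `N(α)` steps without returns, and it
remains to show that returns are rarer than this trivial bound by a fixed number `T` of steps: for
almost every point there is on average at most about one in `N(α) + 1 + T` steps.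

*No concentration.* Images of cells `[j/dⁿ, (j+1)/dⁿ)` are nearly horizontal curves, because the
vertical expansion of `f` is weaker than `2 ≤ d` in the coordinate `arcsin(x/p)`
(`Setting.fibOrb_lipschitz`). Consider such a curve near `0`, over a variable `t` in `[0, 1)`. Points
of the curve that are at nearly the same height at the end of the binding period have nearly the
same value of the linear response `∑ φ(dⁱt)/(fⁱ)'(f(0))` of the critical orbit
(`Setting.osum_sub_le`). The distribution of this series has no atoms: if a level set had positive
measure, then, by Lebesgue density and self-similarity, a tail of the series would be Lipschitz
and, satisfying an equation `Ψ(t) = P(t) + Λ⁻¹Ψ(bt)` with `1 < |Λ| < b`, it would be analytic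
(`analytic_of_cohomological`); so the series would be constant on the whole line and `φ` would be
constant (`Setting.volume_osum_level`). Hence the proportion of the points of the curve that return
within `2T` steps after the binding period tends to zero with `α` (`Setting.volume_return_le`).

*Counting.* The exponential moment `∫ 2^{(N+1+T)·#returns}` over each cell is bounded by
`C·2^m` for the returns before time `m`, by induction on `m` (`lintegral_hits_le`). The Chebyshev
inequality and the Borel–Cantelli lemma then bound the frequency of returns almost surely
(`ae_hits_le`), and taking `T` large compared with `M` gives the claim.
-/


noncomputable section

namespace VianaMap

/-! ### The quadratic map and its postcritical set -/

/-- The modulus `p` of the boundary fixed point `-p` of `f(x) = a - x²`. -/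
def fixPt (a : ℝ) : ℝ := (1 + Real.sqrt (1 + 4 * a)) / 2

/-- The orbit `c_k = f^k(0)` of the critical point. -/
def crit (a : ℝ) (k : ℕ) : ℝ := (quad a)^[k] 0

/-- The standing assumptions on the parameter `a`, the invariant interval `[-β, β]` and the
radius `ξ₀` around the critical point that its forward orbit avoids. -/
structure Setting (a β ξ₀ : ℝ) : Prop where
  one_lt : 1 < a
  lt_two : a < 2
  pre : IsStrictlyPreperiodic (quad a) 0
  one_lt_beta : 1 < β
  beta_lt : β < fixPt a
  maps : quad a '' Icc (-β) β ⊆ interior (Icc (-β) β)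
  xi_pos : 0 < ξ₀
  away : ∀ i : ℕ, 1 ≤ i → crit a i ∉ Ioo (-(2 * ξ₀)) (2 * ξ₀)

/-- `∏_{i<n} 2|x_i|`, the modulus of the derivative of `f^n` along the sequence `x`. -/
def vprod (x : ℕ → ℝ) (n : ℕ) : ℝ := ∏ i ∈ Finset.range n, 2 * |x i|

/-- The orbit of `x` under the unperturbed map. -/
def orb (a x : ℝ) (i : ℕ) : ℝ := (quad a)^[i] x

theorem vprod_nonneg (x : ℕ → ℝ) (n : ℕ) : 0 ≤ vprod x n :=
  Finset.prod_nonneg fun _ _ => by positivity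

theorem vprod_zero (x : ℕ → ℝ) : vprod x 0 = 1 := by simp [vprod]

theorem vprod_succ (x : ℕ → ℝ) (n : ℕ) : vprod x (n + 1) = vprod x n * (2 * |x n|) := by
  simp [vprod, Finset.prod_range_succ]

theorem vprod_add (x : ℕ → ℝ) (m n : ℕ) :
    vprod x (m + n) = vprod x m * vprod (fun i => x (m + i)) n := by
  simp [vprod, Finset.prod_range_add]

theorem orb_zero (a x : ℝ) : orb a x 0 = x := rfl

theorem orb_succ (a x : ℝ) (n : ℕ) : orb a x (n + 1) = quad a (orb a x n) :=
  Function.iterate_succ_apply' _ _ _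

theorem orb_add (a x : ℝ) (m n : ℕ) : orb a x (m + n) = orb a (orb a x m) n := by
  unfold orb; rw [add_comm, Function.iterate_add_apply]

theorem crit_succ (a : ℝ) (n : ℕ) : crit a (n + 1) = quad a (crit a n) :=
  Function.iterate_succ_apply' _ _ _

theorem crit_one (a : ℝ) : crit a 1 = a := by simp [crit, quad]

theorem crit_add (a : ℝ) (m n : ℕ) : crit a (m + n) = orb a (crit a m) n := orb_add a 0 m n

theorem continuous_quad (a : ℝ) : Continuous (quad a) := by unfold quad; fun_prop

theorem continuous_orb (a : ℝ) (n : ℕ) : Continuous fun x => orb a x n :=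
  (continuous_quad a).iterate n

theorem continuous_vprod_orb (a : ℝ) (n : ℕ) : Continuous fun x => vprod (orb a x) n := by
  unfold vprod
  exact continuous_finsetProd _ fun i _ => continuous_const.mul (continuous_orb a i).abs

namespace Setting

variable {a β ξ₀ : ℝ}

theorem fix_sq (h : Setting a β ξ₀) : fixPt a ^ 2 = fixPt a + a := by
  have := h.one_lt
  have h1 : Real.sqrt (1 + 4 * a) ^ 2 = 1 + 4 * a := Real.sq_sqrt (by linarith)
  unfold fixPt; nlinarith

theorem one_lt_fix (h : Setting a β ξ₀) : 1 < fixPt a := h.one_lt_beta.trans h.beta_lt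

theorem lt_fix (h : Setting a β ξ₀) : a < fixPt a := by
  have h1 := h.fix_sq; have h2 := h.one_lt_fix; have h3 := h.lt_two; have h4 := h.one_lt
  by_contra hc
  push Not at hc
  nlinarith

theorem fix_lt_two (h : Setting a β ξ₀) : fixPt a < 2 := by
  have h1 := h.fix_sq; have h3 := h.lt_two; have h4 := h.one_lt_fix
  nlinarith

theorem beta_pos (h : Setting a β ξ₀) : 0 < β := by linarith [h.one_lt_beta]

theorem beta_lt_two (h : Setting a β ξ₀) : β < 2 := h.beta_lt.trans h.fix_lt_two

/-- A compactness margin: `f` maps `[-β, β]` well inside itself. -/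
theorem exists_margin (h : Setting a β ξ₀) :
    ∃ η > 0, ∀ x, |x| ≤ β → |quad a x| + η ≤ β := by
  have hc : IsCompact (Icc (-β) β) := isCompact_Icc
  obtain ⟨z, hz, hmax⟩ := hc.exists_isMaxOn (f := fun x => |quad a x|)
    ⟨0, by have := h.beta_pos; constructor <;> linarith⟩ (continuous_quad a).abs.continuousOn
  have h1 := h.maps ⟨z, hz, rfl⟩
  rw [interior_Icc] at h1
  refine ⟨β - |quad a z|, by linarith [abs_lt.2 ⟨h1.1, h1.2⟩], fun x hx => ?_⟩
  have := hmax (show x ∈ Icc (-β) β from abs_le.1 hx)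
  simp only [mem_ofPred_eq] at this
  linarith

theorem quad_le (h : Setting a β ξ₀) {x : ℝ} (hx : |x| ≤ β) : |quad a x| ≤ β := by
  obtain ⟨η, hη, h1⟩ := h.exists_margin
  linarith [h1 x hx]

theorem orb_le (h : Setting a β ξ₀) {x : ℝ} (hx : |x| ≤ β) (n : ℕ) : |orb a x n| ≤ β := by
  induction n with
  | zero => exact hx
  | succ n ih => rw [orb_succ]; exact h.quad_le ih

theorem crit_le (h : Setting a β ξ₀) (n : ℕ) : |crit a n| ≤ β :=
  h.orb_le (x := 0) (by simpa using h.beta_pos.le) n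

theorem le_abs_crit (h : Setting a β ξ₀) (n : ℕ) : 2 * ξ₀ ≤ |crit a (n + 1)| := by
  by_contra hc
  push Not at hc
  exact h.away (n + 1) (by omega) ⟨(abs_lt.1 hc).1, (abs_lt.1 hc).2⟩

theorem crit_ne_zero (h : Setting a β ξ₀) (n : ℕ) : crit a (n + 1) ≠ 0 := by
  intro h0
  have := h.le_abs_crit n
  rw [h0, abs_zero] at this
  linarith [h.xi_pos]

theorem xi_lt_one (h : Setting a β ξ₀) : ξ₀ < 1 := by
  have := h.le_abs_crit 0
  rw [zero_add, crit_one, abs_of_pos (by linarith [h.one_lt])] at this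
  linarith [h.lt_two]

theorem exists_period (h : Setting a β ξ₀) :
    ∃ m q : ℕ, 0 < q ∧ ∀ k, m ≤ k → crit a (k + q) = crit a k := by
  obtain ⟨-, m, hm⟩ := h.pre
  obtain ⟨q, hq, hper⟩ := hm
  refine ⟨m, q, hq, fun k hk => ?_⟩
  obtain ⟨j, rfl⟩ := Nat.exists_eq_add_of_le hk
  have : crit a (m + q) = crit a m := by
    rw [crit_add]; exact hper
  rw [show m + j + q = m + q + j by omega, crit_add, this, ← crit_add]

theorem finite_range_crit (h : Setting a β ξ₀) : (range fun k => crit a (k + 1)).Finite := by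
  obtain ⟨m, q, hq, hper⟩ := h.exists_period
  refine ((Finset.range (m + q + 1)).image (fun k => crit a k)).finite_toSet.subset ?_
  have key : ∀ k, ∃ j < m + q + 1, crit a k = crit a j := by
    intro k
    induction k using Nat.strong_induction_on with
    | _ k ih =>
      by_cases hk : k < m + q + 1
      · exact ⟨k, hk, rfl⟩
      · obtain ⟨j, hj, he⟩ := ih (k - q) (by omega)
        refine ⟨j, hj, ?_⟩
        rw [← he, ← hper (k - q) (by omega), Nat.sub_add_cancel (by omega)]
  rintro _ ⟨k, rfl⟩
  obtain ⟨j, hj, he⟩ := key (k + 1)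
  simp only [Finset.coe_image, Finset.coe_range, mem_image, mem_Iio]
  exact ⟨j, hj, he.symm⟩

end Setting

/-! ### An expanding metric -/

/-- The forward invariant finite set `{±p} ∪ {c_k : k ≥ 1}`. -/
def markSet (a : ℝ) : Set ℝ := {fixPt a, -fixPt a} ∪ range fun k => crit a (k + 1)

/-- The nearest point of `Q` strictly below `x`. -/
def lo (Q : Set ℝ) (x : ℝ) : ℝ := sSup {q ∈ Q | q < x}

/-- The nearest point of `Q` strictly above `x`. -/
def hi (Q : Set ℝ) (x : ℝ) : ℝ := sInf {q ∈ Q | x < q}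

/-- The density at `x` of the Hilbert metric of the interval between the neighbours of `x` in the
marked set. At a marked point `x` itself the two adjacent gaps are joined, so that the density is
finite (and discontinuous) there. -/
def hilb (a x : ℝ) : ℝ := 1 / (x - lo (markSet a) x) + 1 / (hi (markSet a) x - x)

theorem lo_spec {Q : Set ℝ} (hQ : Q.Finite) {x q₀ : ℝ} (h0 : q₀ ∈ Q) (h1 : q₀ < x) :
    lo Q x ∈ Q ∧ lo Q x < x ∧ ∀ q ∈ Q, q < x → q ≤ lo Q x := by
  have hf : {q ∈ Q | q < x}.Finite := hQ.subset fun q hq => hq.1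
  have hm : lo Q x ∈ {q ∈ Q | q < x} := Set.Nonempty.csSup_mem ⟨q₀, h0, h1⟩ hf
  exact ⟨hm.1, hm.2, fun q hq hqx => le_csSup hf.bddAbove ⟨hq, hqx⟩⟩

theorem hi_spec {Q : Set ℝ} (hQ : Q.Finite) {x q₀ : ℝ} (h0 : q₀ ∈ Q) (h1 : x < q₀) :
    hi Q x ∈ Q ∧ x < hi Q x ∧ ∀ q ∈ Q, x < q → hi Q x ≤ q := by
  have hf : {q ∈ Q | x < q}.Finite := hQ.subset fun q hq => hq.1
  have hm : hi Q x ∈ {q ∈ Q | x < q} := Set.Nonempty.csInf_mem ⟨q₀, h0, h1⟩ hf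
  exact ⟨hm.1, hm.2, fun q hq hqx => csInf_le hf.bddBelow ⟨hq, hqx⟩⟩

namespace Setting

variable {a β ξ₀ : ℝ}

theorem finite_markSet (h : Setting a β ξ₀) : (markSet a).Finite :=
  (by simp : ({fixPt a, -fixPt a} : Set ℝ).Finite).union h.finite_range_crit

theorem fix_mem : fixPt a ∈ markSet a := by simp [markSet]

theorem neg_fix_mem : -fixPt a ∈ markSet a := by simp [markSet]

theorem crit_mem (k : ℕ) : crit a (k + 1) ∈ markSet a := Or.inr ⟨k, rfl⟩

theorem quad_fix (h : Setting a β ξ₀) : quad a (fixPt a) = -fixPt a := by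
  have := h.fix_sq; unfold quad; linarith

theorem quad_neg_fix (h : Setting a β ξ₀) : quad a (-fixPt a) = -fixPt a := by
  have := h.fix_sq; unfold quad; nlinarith

theorem quad_mem_markSet (h : Setting a β ξ₀) {q : ℝ} (hq : q ∈ markSet a) :
    quad a q ∈ markSet a := by
  rcases hq with hq | ⟨k, rfl⟩
  · rcases hq with rfl | hq
    · rw [h.quad_fix]; exact neg_fix_mem
    · rw [mem_singleton_iff.1 hq, h.quad_neg_fix]; exact neg_fix_mem
  · rw [← crit_succ]; exact crit_mem _

theorem lo_spec' (h : Setting a β ξ₀) {x : ℝ} (hx : |x| < fixPt a) :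
    lo (markSet a) x ∈ markSet a ∧ lo (markSet a) x < x ∧
      ∀ q ∈ markSet a, q < x → q ≤ lo (markSet a) x :=
  lo_spec h.finite_markSet neg_fix_mem (abs_lt.1 hx).1

theorem hi_spec' (h : Setting a β ξ₀) {x : ℝ} (hx : |x| < fixPt a) :
    hi (markSet a) x ∈ markSet a ∧ x < hi (markSet a) x ∧
      ∀ q ∈ markSet a, x < q → hi (markSet a) x ≤ q :=
  hi_spec h.finite_markSet fix_mem (abs_lt.1 hx).2

theorem quad_abs_lt (h : Setting a β ξ₀) {x : ℝ} (hx : |x| < fixPt a) : |quad a x| < fixPt a := by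
  have h1 := h.fix_sq
  have h2 : x ^ 2 < fixPt a ^ 2 := by rw [← sq_abs]; gcongr
  rw [abs_lt]; unfold quad
  constructor
  · linarith
  · nlinarith [h.lt_fix, sq_nonneg x]

/-- Each step of `f` pulls the Hilbert metric of a gap of the marked set back to that of the
interval `±(w₁, w₂)`, which lies in a gap of the marked set; the factor `1 + ⋯` is the gain that
comes from the negative Schwarzian derivative of `f`. -/
theorem hilb_core (h : Setting a β ξ₀) {x : ℝ} (hx : |x| < fixPt a) (hx0 : x ≠ 0) :
    ∃ w₁ w₂ : ℝ, 0 ≤ w₁ ∧ w₁ < |x| ∧ |x| < w₂ ∧ w₂ ≤ fixPt a ∧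
      hilb a (quad a x) * (2 * |x|) =
        (1 + (|x| - w₁) * (w₂ - |x|) / ((|x| + w₁) * (w₂ + |x|))) *
          (1 / (|x| - w₁) + 1 / (w₂ - |x|)) ∧
      hilb a x ≤ 1 / (|x| - w₁) + 1 / (w₂ - |x|) := by
  obtain ⟨hu, hux, hu'⟩ := h.lo_spec' hx
  obtain ⟨hv, hvx, hv'⟩ := h.hi_spec' hx
  obtain ⟨hU, hUx, hU'⟩ := h.lo_spec' (h.quad_abs_lt hx)
  obtain ⟨hV, hVx, hV'⟩ := h.hi_spec' (h.quad_abs_lt hx)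
  unfold hilb
  set u := lo (markSet a) x
  set v := hi (markSet a) x
  set U := lo (markSet a) (quad a x)
  set V := hi (markSet a) (quad a x)
  have hy0 : 0 < |x| := abs_pos.2 hx0
  have hsq : |x| ^ 2 = x ^ 2 := sq_abs x
  have hfa : quad a x < a := by unfold quad; have := pow_pos hy0 2; linarith
  have hVa : V ≤ a := hV' a (by simpa [crit_one] using crit_mem (a := a) 0) hfa
  have hw1 : Real.sqrt (a - V) ^ 2 = a - V := Real.sq_sqrt (by linarith)
  have hw2 : Real.sqrt (a - U) ^ 2 = a - U := Real.sq_sqrt (by linarith)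
  set w₁ := Real.sqrt (a - V)
  set w₂ := Real.sqrt (a - U)
  have hw10 : 0 ≤ w₁ := Real.sqrt_nonneg _
  have hw20 : 0 ≤ w₂ := Real.sqrt_nonneg _
  have hfx : quad a x = a - |x| ^ 2 := by rw [hsq]; rfl
  have h1 : w₁ < |x| := by
    apply lt_of_pow_lt_pow_left₀ 2 hy0.le; rw [hw1]; linarith
  have h2 : |x| < w₂ := by
    apply lt_of_pow_lt_pow_left₀ 2 hw20; rw [hw2]; linarith
  have hUp : -fixPt a ≤ U := hU' _ neg_fix_mem (abs_lt.1 (h.quad_abs_lt hx)).1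
  have h3 : w₂ ≤ fixPt a := by
    have := h.one_lt_fix
    apply le_of_sq_le_sq _ (by linarith)
    rw [hw2, h.fix_sq]; linarith
  -- no marked point lies strictly between `w₁` and `w₂` in modulus, except possibly `±x`
  have gap : ∀ q ∈ markSet a, w₁ < |q| → |q| < w₂ → |q| = |x| := by
    intro q hq hq1 hq2
    have hfq := h.quad_mem_markSet hq
    have e : quad a q = a - |q| ^ 2 := by rw [sq_abs]; rfl
    have l1 : quad a q < V := by rw [e]; nlinarith
    have l2 : U < quad a q := by rw [e]; nlinarith
    rcases lt_trichotomy (quad a q) (quad a x) with hl | hl | hl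
    · exact absurd (hU' _ hfq hl) (by linarith)
    · rw [e, hfx] at hl
      exact (pow_left_inj₀ (abs_nonneg q) (abs_nonneg x) two_ne_zero).1 (by linarith)
    · exact absurd (hV' _ hfq hl) (by linarith)
  refine ⟨w₁, w₂, hw10, h1, h2, h3, ?_, ?_⟩
  · have e1 : quad a x - U = (w₂ - |x|) * (w₂ + |x|) := by rw [hfx]; nlinarith
    have e2 : V - quad a x = (|x| - w₁) * (|x| + w₁) := by rw [hfx]; nlinarith
    rw [e1, e2]
    have p1 : |x| - w₁ ≠ 0 := by linarith
    have p2 : w₂ - |x| ≠ 0 := by linarith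
    have p3 : |x| + w₁ ≠ 0 := by positivity
    have p4 : w₂ + |x| ≠ 0 := by positivity
    field_simp
    ring
  · rcases lt_or_gt_of_ne hx0 with hneg | hpos
    · have hax : |x| = -x := abs_of_neg hneg
      have l1 : u ≤ -w₂ := by
        by_contra hc
        push Not at hc
        have hun : |u| = -u := abs_of_neg (by linarith)
        have := gap u hu (by rw [hun]; linarith) (by rw [hun]; linarith)
        rw [hun, hax] at this; linarith
      have l2 : -w₁ ≤ v := by
        by_contra hc
        push Not at hc
        have hun : |v| = -v := abs_of_neg (by linarith)
        have := gap v hv (by rw [hun]; linarith) (by rw [hun]; linarith)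
        rw [hun, hax] at this; linarith
      rw [add_comm]
      have i1 : 1 / (v - x) ≤ 1 / (|x| - w₁) :=
        one_div_le_one_div_of_le (by linarith) (by linarith)
      have i2 : 1 / (x - u) ≤ 1 / (w₂ - |x|) :=
        one_div_le_one_div_of_le (by linarith) (by linarith)
      linarith
    · have hax : |x| = x := abs_of_pos hpos
      have l1 : u ≤ w₁ := by
        by_contra hc
        push Not at hc
        have hun : |u| = u := abs_of_pos (by linarith)
        have := gap u hu (by rw [hun]; linarith) (by rw [hun]; linarith)
        rw [hun, hax] at this; linarith
      have l2 : w₂ ≤ v := by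
        by_contra hc
        push Not at hc
        have hun : |v| = v := abs_of_pos (by linarith)
        have := gap v hv (by rw [hun]; linarith) (by rw [hun]; linarith)
        rw [hun, hax] at this; linarith
      have i1 : 1 / (x - u) ≤ 1 / (|x| - w₁) :=
        one_div_le_one_div_of_le (by linarith) (by linarith)
      have i2 : 1 / (v - x) ≤ 1 / (w₂ - |x|) :=
        one_div_le_one_div_of_le (by linarith) (by linarith)
      linarith

theorem hilb_pos (h : Setting a β ξ₀) {x : ℝ} (hx : |x| < fixPt a) : 1 / fixPt a ≤ hilb a x := by
  obtain ⟨hu, hux, hu'⟩ := h.lo_spec' hx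
  obtain ⟨hv, hvx, hv'⟩ := h.hi_spec' hx
  have h1 := hu' _ neg_fix_mem (abs_lt.1 hx).1
  have h2 := hv' _ fix_mem (abs_lt.1 hx).2
  have hp := h.one_lt_fix
  unfold hilb
  set u := lo (markSet a) x
  set v := hi (markSet a) x
  have i1 : 1 / (2 * fixPt a) ≤ 1 / (x - u) :=
    one_div_le_one_div_of_le (by linarith) (by linarith [(abs_lt.1 hx).2])
  have i2 : 1 / (2 * fixPt a) ≤ 1 / (v - x) :=
    one_div_le_one_div_of_le (by linarith) (by linarith [(abs_lt.1 hx).1])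
  have : 1 / fixPt a = 1 / (2 * fixPt a) + 1 / (2 * fixPt a) := by field_simp; norm_num
  linarith

theorem hilb_pos' (h : Setting a β ξ₀) {x : ℝ} (hx : |x| < fixPt a) : 0 < hilb a x :=
  lt_of_lt_of_le (by have := h.one_lt_fix; positivity) (h.hilb_pos hx)

/-- Away from the marked set the density is bounded. -/
theorem hilb_le (h : Setting a β ξ₀) {x η : ℝ} (hx : |x| < fixPt a) (hη : 0 < η)
    (hfar : ∀ q ∈ markSet a, η ≤ |x - q|) : hilb a x ≤ 2 / η := by
  obtain ⟨hu, hux, -⟩ := h.lo_spec' hx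
  obtain ⟨hv, hvx, -⟩ := h.hi_spec' hx
  have h1 := hfar _ hu
  have h2 := hfar _ hv
  unfold hilb
  set u := lo (markSet a) x
  set v := hi (markSet a) x
  rw [abs_of_pos (by linarith)] at h1
  rw [abs_of_neg (by linarith)] at h2
  have i1 : 1 / (x - u) ≤ 1 / η := one_div_le_one_div_of_le hη h1
  have i2 : 1 / (v - x) ≤ 1 / η := one_div_le_one_div_of_le hη (by linarith)
  have : 2 / η = 1 / η + 1 / η := by ring
  linarith

theorem hilb_lt (h : Setting a β ξ₀) {x : ℝ} (hx : |x| < fixPt a) (hx0 : x ≠ 0) :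
    hilb a x < hilb a (quad a x) * (2 * |x|) := by
  obtain ⟨w₁, w₂, h0, h1, h2, h3, e, hle⟩ := h.hilb_core hx hx0
  have hy0 : 0 < |x| := abs_pos.2 hx0
  have p1 : 0 < |x| - w₁ := by linarith
  have p2 : 0 < w₂ - |x| := by linarith
  have p4 : 0 < w₂ + |x| := by linarith
  rw [e]
  refine hle.trans_lt ?_
  have hs : 0 < 1 / (|x| - w₁) + 1 / (w₂ - |x|) := by positivity
  have hr : 0 < (|x| - w₁) * (w₂ - |x|) / ((|x| + w₁) * (w₂ + |x|)) := by positivity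
  nlinarith [mul_pos hs hr]

/-- Away from the marked set the expansion of the metric is uniform. -/
theorem hilb_far (h : Setting a β ξ₀) {η : ℝ} (hη : 0 < η) :
    ∃ ε > 0, ∀ x, |x| < fixPt a → x ≠ 0 → (∀ q ∈ markSet a, η ≤ |x - q|) →
      (1 + ε) * hilb a x ≤ hilb a (quad a x) * (2 * |x|) := by
  have hp := h.one_lt_fix
  refine ⟨min 1 (η ^ 2 / (64 * fixPt a ^ 2)), by positivity, fun x hx hx0 hfar => ?_⟩
  obtain ⟨w₁, w₂, h0, h1, h2, h3, e, hle⟩ := h.hilb_core hx hx0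
  have hy0 : 0 < |x| := abs_pos.2 hx0
  have p1 : 0 < |x| - w₁ := by linarith
  have p2 : 0 < w₂ - |x| := by linarith
  have p4 : 0 < w₂ + |x| := by linarith
  have hs : 0 < 1 / (|x| - w₁) + 1 / (w₂ - |x|) := by positivity
  have hr : 0 < (|x| - w₁) * (w₂ - |x|) / ((|x| + w₁) * (w₂ + |x|)) := by positivity
  rw [e]
  have hρ := h.hilb_le hx hη hfar
  have hρ0 := h.hilb_pos' hx
  by_cases hc : |x| - w₁ < η / 4 ∨ w₂ - |x| < η / 4
  · have hbig : 4 / η ≤ 1 / (|x| - w₁) + 1 / (w₂ - |x|) := by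
      have e4 : 4 / η = 1 / (η / 4) := by field_simp
      rw [e4]
      rcases hc with hc | hc
      · have := one_div_le_one_div_of_le p1 hc.le
        have : 0 < 1 / (w₂ - |x|) := by positivity
        linarith
      · have := one_div_le_one_div_of_le p2 hc.le
        have : 0 < 1 / (|x| - w₁) := by positivity
        linarith
    calc (1 + min 1 (η ^ 2 / (64 * fixPt a ^ 2))) * hilb a x ≤ (1 + 1) * hilb a x := by
          gcongr; exact min_le_left _ _
      _ ≤ 2 * (2 / η) := by linarith
      _ = 4 / η := by ring
      _ ≤ 1 * (1 / (|x| - w₁) + 1 / (w₂ - |x|)) := by linarith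
      _ ≤ _ := by gcongr; linarith
  · push Not at hc
    obtain ⟨c1, c2⟩ := hc
    have hR : η ^ 2 / (64 * fixPt a ^ 2) ≤
        (|x| - w₁) * (w₂ - |x|) / ((|x| + w₁) * (w₂ + |x|)) := by
      have : η ^ 2 / (64 * fixPt a ^ 2) = (η / 4 * (η / 4)) / ((2 * fixPt a) * (2 * fixPt a)) := by
        field_simp; norm_num
      rw [this]
      gcongr <;> linarith
    calc (1 + min 1 (η ^ 2 / (64 * fixPt a ^ 2))) * hilb a x
        ≤ (1 + (|x| - w₁) * (w₂ - |x|) / ((|x| + w₁) * (w₂ + |x|))) * hilb a x := by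
          gcongr; exact (min_le_right _ _).trans hR
      _ ≤ _ := by gcongr

theorem hilb_near_crit (h : Setting a β ξ₀) {x : ℝ} (hx : |x| < ξ₀) : hilb a x ≤ 2 / ξ₀ := by
  have hxi := h.xi_pos
  have h1 := h.xi_lt_one
  have hp := h.one_lt_fix
  refine h.hilb_le (by linarith) hxi fun q hq => ?_
  have hq2 : 2 * ξ₀ ≤ |q| := by
    have h0 := h.le_abs_crit 0
    rw [zero_add, crit_one, abs_of_pos (by linarith [h.one_lt])] at h0
    rcases hq with hq | ⟨k, rfl⟩
    · rcases hq with rfl | hq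
      · rw [abs_of_pos (by linarith)]; linarith [h.lt_fix]
      · rw [mem_singleton_iff.1 hq, abs_neg, abs_of_pos (by linarith)]; linarith [h.lt_fix]
    · exact h.le_abs_crit k
  have := abs_sub_abs_le_abs_sub q x
  rw [abs_sub_comm] at this
  linarith

theorem abs_lt_fix (h : Setting a β ξ₀) {x : ℝ} (hx : |x| ≤ β) : |x| < fixPt a :=
  hx.trans_lt h.beta_lt

theorem hilb_le_vprod (h : Setting a β ξ₀) {x : ℝ} (hx : |x| < fixPt a) (n : ℕ)
    (hne : ∀ i < n, orb a x i ≠ 0) :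
    |orb a x n| < fixPt a ∧ hilb a x ≤ hilb a (orb a x n) * vprod (orb a x) n := by
  induction n with
  | zero => simpa [vprod_zero, orb_zero] using hx
  | succ n ih =>
    obtain ⟨h1, h2⟩ := ih fun i hi => hne i (by omega)
    rw [orb_succ, vprod_succ]
    refine ⟨h.quad_abs_lt h1, h2.trans ?_⟩
    have := (h.hilb_lt h1 (hne n (by omega))).le
    have hv := vprod_nonneg (orb a x) n
    nlinarith

/-- No derivative is lost along an orbit segment that ends near the critical point. -/
theorem vprod_ge_of_end_near (h : Setting a β ξ₀) {x : ℝ} (hx : |x| ≤ β) (n : ℕ)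
    (hne : ∀ i < n, orb a x i ≠ 0) (hend : |orb a x n| < ξ₀) :
    ξ₀ / 4 ≤ vprod (orb a x) n := by
  have hx' := h.abs_lt_fix hx
  obtain ⟨-, h2⟩ := h.hilb_le_vprod hx' n hne
  have h3 := h.hilb_near_crit hend
  have h4 := h.hilb_pos hx'
  have hv := vprod_nonneg (orb a x) n
  have hxi := h.xi_pos
  have hp := h.one_lt_fix
  have h5 : 1 / fixPt a ≤ 2 / ξ₀ * vprod (orb a x) n := by
    refine h4.trans (h2.trans ?_); gcongr
  have h6 : 1 / 2 ≤ 1 / fixPt a := one_div_le_one_div_of_le (by linarith) h.fix_lt_two.le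
  have h7 : 1 / 2 ≤ 2 / ξ₀ * vprod (orb a x) n := h6.trans h5
  rw [div_mul_eq_mul_div, le_div_iff₀ hxi] at h7
  linarith

end Setting

/-! ### Expansion along the critical orbit and away from the critical point -/

/-- `D_n = (f^n)'(c_1) = ∏_{i=1}^n (-2 c_i)`. -/
def critD (a : ℝ) (n : ℕ) : ℝ := ∏ i ∈ Finset.range n, (-2 * crit a (i + 1))

theorem critD_zero (a : ℝ) : critD a 0 = 1 := by simp [critD]

theorem critD_succ (a : ℝ) (n : ℕ) : critD a (n + 1) = critD a n * (-2 * crit a (n + 1)) := by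
  simp [critD, Finset.prod_range_succ]

theorem abs_critD_add (a : ℝ) (j n : ℕ) :
    |critD a (j + n)| = |critD a j| * vprod (orb a (crit a (j + 1))) n := by
  induction n with
  | zero => simp [vprod_zero]
  | succ n ih =>
    rw [← add_assoc, critD_succ, abs_mul, ih, vprod_succ, ← crit_add, abs_mul,
      show j + n + 1 = j + 1 + n by omega]
    simp [mul_assoc]

namespace Setting

variable {a β ξ₀ : ℝ}

theorem critD_ne_zero (h : Setting a β ξ₀) (n : ℕ) : critD a n ≠ 0 :=
  Finset.prod_ne_zero_iff.2 fun i _ => mul_ne_zero (by norm_num) (h.crit_ne_zero i)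

theorem abs_critD_pos (h : Setting a β ξ₀) (n : ℕ) : 0 < |critD a n| :=
  abs_pos.2 (h.critD_ne_zero n)

theorem abs_critD_succ_le (h : Setting a β ξ₀) (n : ℕ) : |critD a (n + 1)| ≤ 4 * |critD a n| := by
  rw [critD_succ, abs_mul, abs_mul, mul_comm]
  have h1 := h.crit_le (n + 1)
  have h2 := h.beta_lt_two
  gcongr
  rw [abs_neg, abs_two]; linarith

theorem abs_critD_le (h : Setting a β ξ₀) (n : ℕ) : |critD a n| ≤ 4 ^ n := by
  induction n with
  | zero => simp [critD_zero]
  | succ n ih => have := h.abs_critD_succ_le n; rw [pow_succ]; linarith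

/-- The postcritical orbit is uniformly expanding: every step of `f` at one of its finitely many
points strictly expands the metric `hilb`. -/
theorem critD_growth (h : Setting a β ξ₀) :
    ∃ r > 1, ∃ c > 0, ∀ j n : ℕ, c * r ^ n * |critD a j| ≤ |critD a (j + n)| := by
  have hS := h.finite_range_crit
  have hne : (range fun k => crit a (k + 1)).Nonempty := ⟨_, 0, rfl⟩
  have hlt : ∀ k, |crit a k| < fixPt a := fun k => h.abs_lt_fix (h.crit_le k)
  obtain ⟨_, ⟨k₀, rfl⟩, hmin⟩ := exists_min_image _
    (fun q => hilb a (quad a q) * (2 * |q|) / hilb a q) hS hne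
  obtain ⟨_, ⟨k₁, rfl⟩, hmax⟩ := exists_max_image _ (fun q => hilb a q) hS hne
  set r := hilb a (quad a (crit a (k₀ + 1))) * (2 * |crit a (k₀ + 1)|) / hilb a (crit a (k₀ + 1))
    with hr
  have hr1 : 1 < r := by
    rw [hr, one_lt_div (h.hilb_pos' (hlt _))]
    exact h.hilb_lt (hlt _) (h.crit_ne_zero _)
  set C := hilb a (crit a (k₁ + 1))
  have hC : 0 < C := h.hilb_pos' (hlt _)
  have hp : 0 < fixPt a := by linarith [h.one_lt_fix]
  refine ⟨r, hr1, (1 / fixPt a) / C, by positivity, fun j n => ?_⟩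
  have key : r ^ n * hilb a (crit a (j + 1)) * |critD a j| ≤
      hilb a (crit a (j + n + 1)) * |critD a (j + n)| := by
    induction n with
    | zero => simp
    | succ n ih =>
      have h1 := hmin _ ⟨j + n, rfl⟩
      simp only at h1
      rw [le_div_iff₀ (h.hilb_pos' (hlt _)), ← crit_succ] at h1
      rw [← add_assoc, critD_succ, abs_mul, abs_mul, abs_neg, abs_two, pow_succ]
      calc r ^ n * r * hilb a (crit a (j + 1)) * |critD a j|
          = r * (r ^ n * hilb a (crit a (j + 1)) * |critD a j|) := by ring
        _ ≤ r * (hilb a (crit a (j + n + 1)) * |critD a (j + n)|) := by gcongr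
        _ = r * hilb a (crit a (j + n + 1)) * |critD a (j + n)| := by ring
        _ ≤ hilb a (crit a (j + n + 1 + 1)) * (2 * |crit a (j + n + 1)|) * |critD a (j + n)| := by
            gcongr
        _ = _ := by ring
  have h2 : hilb a (crit a (j + n + 1)) ≤ C := hmax _ ⟨j + n, rfl⟩
  have h3 : 1 / fixPt a ≤ hilb a (crit a (j + 1)) := h.hilb_pos (hlt _)
  have h4 : 1 / fixPt a / C * r ^ n * |critD a j| = (r ^ n * (1 / fixPt a) * |critD a j|) / C := by
    ring
  rw [h4, div_le_iff₀ hC]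
  have hr0 : 0 < r := by linarith
  calc r ^ n * (1 / fixPt a) * |critD a j| ≤ r ^ n * hilb a (crit a (j + 1)) * |critD a j| := by
        gcongr
    _ ≤ hilb a (crit a (j + n + 1)) * |critD a (j + n)| := key
    _ ≤ C * |critD a (j + n)| := by gcongr
    _ = _ := mul_comm _ _

theorem abs_orb_fix (h : Setting a β ξ₀) {q : ℝ} (hq : q = fixPt a ∨ q = -fixPt a) (i : ℕ) :
    |orb a q i| = fixPt a := by
  have hp : |fixPt a| = fixPt a := abs_of_pos (by linarith [h.one_lt_fix])
  have : orb a q i = fixPt a ∨ orb a q i = -fixPt a := by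
    induction i with
    | zero => exact hq
    | succ i ih =>
      rw [orb_succ]
      rcases ih with e | e
      · rw [e, h.quad_fix]; exact Or.inr rfl
      · rw [e, h.quad_neg_fix]; exact Or.inr rfl
  rcases this with e | e <;> simp [e, hp]

theorem exists_expand_mark (h : Setting a β ξ₀) :
    ∃ L : ℕ, ∀ q ∈ markSet a, 4 ≤ vprod (orb a q) L := by
  obtain ⟨r, hr, c, hc, hgrow⟩ := h.critD_growth
  obtain ⟨L, hL⟩ := ((tendsto_pow_atTop_atTop_of_one_lt hr).eventually_ge_atTop (4 / c)).and
    (eventually_ge_atTop 2) |>.exists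
  refine ⟨L, ?_⟩
  have fixc : ∀ q, q = fixPt a ∨ q = -fixPt a → 4 ≤ vprod (orb a q) L := by
    intro q hq
    unfold vprod
    simp only [h.abs_orb_fix hq, Finset.prod_const, Finset.card_range]
    have h1 := h.one_lt_fix
    calc (4 : ℝ) = 2 ^ 2 := by norm_num
      _ ≤ 2 ^ L := pow_le_pow_right₀ (by norm_num) hL.2
      _ ≤ _ := by gcongr; linarith
  intro q hq
  rcases hq with hq | ⟨k, rfl⟩
  · exact fixc q (by simpa using hq)
  · have h1 := hgrow k L
    rw [abs_critD_add, mul_comm] at h1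
    have h2 := le_of_mul_le_mul_left h1 (h.abs_critD_pos k)
    rw [div_le_iff₀ hc] at hL
    simp only
    linarith [hL.1]

/-- An orbit that never meets the critical point expands: either it is far from the marked set
infinitely often, and then the metric is expanded by a definite factor infinitely often, or it
stays near the repelling cycles in the marked set. -/
theorem exists_expand (h : Setting a β ξ₀) {x : ℝ} (hx : |x| ≤ β) (hne : ∀ i, orb a x i ≠ 0) :
    ∃ n, 1 ≤ n ∧ 2 < vprod (orb a x) n := by
  obtain ⟨L, hL⟩ := h.exists_expand_mark
  obtain ⟨η, hη, hsub⟩ := h.finite_markSet.isCompact.exists_thickening_subset_open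
    (isOpen_lt continuous_const (continuous_vprod_orb a L))
    (fun q hq => show (2 : ℝ) < _ by linarith [hL q hq])
  have near : ∀ y, (∃ q ∈ markSet a, |y - q| < η) → 2 < vprod (orb a y) L := by
    rintro y ⟨q, hq, hyq⟩
    exact hsub (Metric.mem_thickening_iff.2 ⟨q, hq, by rwa [Real.dist_eq]⟩)
  by_contra hcon
  push Not at hcon
  have hpos : ∀ n, 0 < vprod (orb a x) n := fun n =>
    Finset.prod_pos fun i _ => mul_pos two_pos (abs_pos.2 (hne i))
  have hP : ∀ n, vprod (orb a x) n ≤ 2 := fun n => by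
    rcases Nat.eq_zero_or_pos n with rfl | hn
    · rw [vprod_zero]; norm_num
    · exact hcon n hn
  have hlt : ∀ n, |orb a x n| < fixPt a := fun n => h.abs_lt_fix (h.orb_le hx n)
  by_cases hfreq : ∃ n₁, ∀ n ≥ n₁, ∃ q ∈ markSet a, |orb a x n - q| < η
  · obtain ⟨n₁, hn₁⟩ := hfreq
    have grow : ∀ k : ℕ, vprod (orb a x) n₁ * 2 ^ k ≤ vprod (orb a x) (n₁ + k * L) := by
      intro k
      induction k with
      | zero => simp
      | succ k ih =>
        rw [show n₁ + (k + 1) * L = n₁ + k * L + L by ring, vprod_add]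
        have h1 := (near _ (hn₁ (n₁ + k * L) (by omega))).le
        have h2 : (fun i => orb a x (n₁ + k * L + i)) = orb a (orb a x (n₁ + k * L)) := by
          funext i; exact orb_add _ _ _ _
        rw [h2, pow_succ, ← mul_assoc]
        have := hpos (n₁ + k * L)
        gcongr
    obtain ⟨k, hk⟩ := ((tendsto_pow_atTop_atTop_of_one_lt (one_lt_two (α := ℝ))).eventually_gt_atTop
      (2 / vprod (orb a x) n₁)).exists
    rw [div_lt_iff₀ (hpos n₁)] at hk
    have := grow k
    have := hP (n₁ + k * L)
    linarith
  · push Not at hfreq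
    obtain ⟨ε, hε, hfar⟩ := h.hilb_far hη
    set ψ : ℕ → ℝ := fun n => hilb a (orb a x n) * vprod (orb a x) n with hψ
    have hstep : ∀ n, ψ n ≤ ψ (n + 1) := by
      intro n
      have h1 := (h.hilb_lt (hlt n) (hne n)).le
      have h2 := (hpos n).le
      simp only [hψ, orb_succ, vprod_succ]
      nlinarith
    have hmono : Monotone ψ := monotone_nat_of_le_succ hstep
    have hψ0 : 0 < ψ 0 := mul_pos (h.hilb_pos' (hlt 0)) (hpos 0)
    have hbd : ∀ n, ψ n ≤ 2 / η * 2 := by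
      intro n
      obtain ⟨m, hm, hmf⟩ := hfreq n
      refine (hmono hm).trans ?_
      have h1 := h.hilb_le (hlt m) hη hmf
      have h2 := hP m
      have h3 := (hpos m).le
      simp only [hψ]
      gcongr
    have hgrow : ∀ k : ℕ, ∃ n, (1 + ε) ^ k * ψ 0 ≤ ψ n := by
      intro k
      induction k with
      | zero => exact ⟨0, by simp⟩
      | succ k ih =>
        obtain ⟨n, hn⟩ := ih
        obtain ⟨m, hm, hmf⟩ := hfreq n
        refine ⟨m + 1, ?_⟩
        have h1 := hfar _ (hlt m) (hne m) hmf
        have h2 := (hpos m).le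
        calc (1 + ε) ^ (k + 1) * ψ 0 = (1 + ε) * ((1 + ε) ^ k * ψ 0) := by ring
          _ ≤ (1 + ε) * ψ m := by gcongr; exact hn.trans (hmono hm)
          _ = (1 + ε) * hilb a (orb a x m) * vprod (orb a x) m := by simp only [hψ]; ring
          _ ≤ hilb a (quad a (orb a x m)) * (2 * |orb a x m|) * vprod (orb a x) m := by gcongr
          _ = ψ (m + 1) := by simp only [hψ, orb_succ, vprod_succ]; ring
    obtain ⟨k, hk⟩ := ((tendsto_pow_atTop_atTop_of_one_lt
      (show (1 : ℝ) < 1 + ε by linarith)).eventually_gt_atTop (2 / η * 2 / ψ 0)).exists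
    rw [div_lt_iff₀ hψ0] at hk
    obtain ⟨n, hn⟩ := hgrow k
    linarith [hbd n]

theorem exists_uniform_expand (h : Setting a β ξ₀) {δ : ℝ} (hδ : 0 < δ) :
    ∃ k : ℕ, ∀ x, |x| ≤ β →
      (∃ j, 1 ≤ j ∧ j ≤ k ∧ 2 < vprod (orb a x) j) ∨ ∃ j ≤ k, |orb a x j| < δ := by
  set U : ℕ → Set ℝ := fun k => {x | (∃ j, 1 ≤ j ∧ j ≤ k ∧ 2 < vprod (orb a x) j) ∨
    ∃ j ≤ k, |orb a x j| < δ} with hU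
  have hopen : ∀ k, IsOpen (U k) := by
    intro k
    have e : U k = (⋃ j, ⋃ (_ : 1 ≤ j ∧ j ≤ k), {x | 2 < vprod (orb a x) j}) ∪
        ⋃ j, ⋃ (_ : j ≤ k), {x | |orb a x j| < δ} := by
      ext x; simp [hU, and_assoc]
    rw [e]
    refine IsOpen.union (isOpen_iUnion fun j => isOpen_iUnion fun _ => ?_)
      (isOpen_iUnion fun j => isOpen_iUnion fun _ => ?_)
    · exact isOpen_lt continuous_const (continuous_vprod_orb a j)
    · exact isOpen_lt (continuous_orb a j).abs continuous_const
  have hcov : Icc (-β) β ⊆ ⋃ k, U k := by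
    intro x hx
    have hx' : |x| ≤ β := abs_le.2 hx
    by_cases hz : ∃ i, orb a x i = 0
    · obtain ⟨i, hi⟩ := hz
      exact mem_iUnion.2 ⟨i, Or.inr ⟨i, le_rfl, by rw [hi, abs_zero]; exact hδ⟩⟩
    · push Not at hz
      obtain ⟨n, hn, hn2⟩ := h.exists_expand hx' hz
      exact mem_iUnion.2 ⟨n, Or.inl ⟨n, hn, le_rfl, hn2⟩⟩
  have hdir : Directed (· ⊆ ·) U := by
    refine Monotone.directed_le (f := U) fun k l hkl x hx => ?_
    rcases hx with ⟨j, h1, h2, h3⟩ | ⟨j, h1, h2⟩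
    · exact Or.inl ⟨j, h1, h2.trans hkl, h3⟩
    · exact Or.inr ⟨j, h1.trans hkl, h2⟩
  obtain ⟨k, hk⟩ := isCompact_Icc.elim_directed_cover U hopen hcov hdir
  exact ⟨k, fun x hx => hk (abs_le.1 hx)⟩

end Setting

/-! ### Perturbed orbits -/

/-- An orbit of `f` in `[-β, β]` with an additive error of at most `α` at each step. -/
def IsPseudo (a β α : ℝ) (x : ℕ → ℝ) : Prop :=
  ∀ i, |x i| ≤ β ∧ |x (i + 1) - quad a (x i)| ≤ α

theorem IsPseudo.shift {a β α : ℝ} {x : ℕ → ℝ} (hx : IsPseudo a β α x) (m : ℕ) :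
    IsPseudo a β α fun i => x (m + i) := fun i => hx (m + i)

theorem IsPseudo.mono {a β α α' : ℝ} {x : ℕ → ℝ} (hx : IsPseudo a β α x) (hα : α ≤ α') :
    IsPseudo a β α' x := fun i => ⟨(hx i).1, (hx i).2.trans hα⟩

namespace Setting

variable {a β ξ₀ : ℝ}

theorem pseudo_close (h : Setting a β ξ₀) (n : ℕ) :
    ∃ K : ℝ, 0 < K ∧ ∀ α x, 0 ≤ α → IsPseudo a β α x →
      |x n - orb a (x 0) n| ≤ K * α ∧ |vprod x n - vprod (orb a (x 0)) n| ≤ K * α := by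
  induction n with
  | zero =>
    refine ⟨1, one_pos, fun α x hα _ => ?_⟩
    simp [orb_zero, vprod_zero, hα]
  | succ n ih =>
    obtain ⟨K, hK, hKx⟩ := ih
    refine ⟨4 * K + 1 + 4 ^ n * (2 * K), by positivity, fun α x hα hx => ?_⟩
    obtain ⟨h1, h2⟩ := hKx α x hα hx
    have hb := h.beta_lt_two
    have b1 := (hx n).1
    have b2 := h.orb_le (hx 0).1 n
    have hs : |x n + orb a (x 0) n| ≤ 4 := by
      have := abs_add_le (x n) (orb a (x 0) n); linarith
    constructor
    · have e : x (n + 1) - orb a (x 0) (n + 1) =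
          (x (n + 1) - quad a (x n)) - (x n + orb a (x 0) n) * (x n - orb a (x 0) n) := by
        rw [orb_succ]; unfold quad; ring
      rw [e]
      refine (abs_sub _ _).trans ?_
      rw [abs_mul]
      have : |x n + orb a (x 0) n| * |x n - orb a (x 0) n| ≤ 4 * (K * α) := by gcongr
      have := (hx n).2
      have : 0 ≤ 4 ^ n * (2 * K) * α := by positivity
      nlinarith
    · have hv : vprod (orb a (x 0)) n ≤ 4 ^ n := by
        unfold vprod
        calc _ ≤ ∏ _i ∈ Finset.range n, (4 : ℝ) :=
              Finset.prod_le_prod (fun _ _ => by positivity) fun i _ => by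
                linarith [h.orb_le (hx 0).1 i]
          _ = 4 ^ n := by simp
      have hv0 := vprod_nonneg (orb a (x 0)) n
      have e : vprod x (n + 1) - vprod (orb a (x 0)) (n + 1) =
          (vprod x n - vprod (orb a (x 0)) n) * (2 * |x n|) +
            vprod (orb a (x 0)) n * (2 * (|x n| - |orb a (x 0) n|)) := by
        rw [vprod_succ, vprod_succ]; ring
      rw [e]
      refine (abs_add_le _ _).trans ?_
      rw [abs_mul, abs_mul (vprod _ _) (2 * _), abs_of_nonneg hv0, abs_mul 2 (|x n| - _), abs_two,
        abs_of_nonneg (show 0 ≤ 2 * |x n| by positivity)]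
      have t1 : |vprod x n - vprod (orb a (x 0)) n| * (2 * |x n|) ≤ K * α * 4 := by
        gcongr; linarith
      have t2 : vprod (orb a (x 0)) n * (2 * |(|x n| - |orb a (x 0) n|)|) ≤
          4 ^ n * (2 * (K * α)) := by
        gcongr
        exact (abs_abs_sub_abs_le_abs_sub _ _).trans h1
      nlinarith

theorem pseudo_close_uniform (h : Setting a β ξ₀) (k : ℕ) {ε : ℝ} (hε : 0 < ε) :
    ∃ α₀ > 0, ∀ α x, 0 ≤ α → α < α₀ → IsPseudo a β α x → ∀ n ≤ k,
      |x n - orb a (x 0) n| ≤ ε ∧ |vprod x n - vprod (orb a (x 0)) n| ≤ ε := by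
  choose K hK hKx using fun n => h.pseudo_close n
  have hS : 0 < ∑ n ∈ Finset.range (k + 1), K n :=
    Finset.sum_pos (fun n _ => hK n) ⟨0, by simp⟩
  refine ⟨ε / ∑ n ∈ Finset.range (k + 1), K n, by positivity, fun α x hα hα' hx n hn => ?_⟩
  rw [lt_div_iff₀ hS] at hα'
  have h1 : K n ≤ ∑ n ∈ Finset.range (k + 1), K n :=
    Finset.single_le_sum (fun i _ => (hK i).le) (Finset.mem_range.2 (by omega))
  have h2 : K n * α ≤ ε := by nlinarith
  exact ⟨(hKx n α x hα hx).1.trans h2, (hKx n α x hα hx).2.trans h2⟩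

/-- Expansion of perturbed orbits outside `(-δ, δ)`. The constant `ξ₀/16` for segments that end in
`(-δ, δ)` does not depend on `δ`. -/
theorem free_growth (h : Setting a β ξ₀) {δ r : ℝ} (hδ : 0 < δ) (hδξ : δ ≤ ξ₀ / 2) (hr : 1 < r) :
    ∃ lam > 1, lam ≤ r ∧ lam ≤ 2 ∧ ∃ c > 0, ∃ α₀ > 0, ∀ α x, 0 ≤ α → α < α₀ → IsPseudo a β α x →
      ∀ n, (∀ i < n, δ ≤ |x i|) →
        c * lam ^ n ≤ vprod x n ∧ (|x n| < δ → ξ₀ / 16 * lam ^ n ≤ vprod x n) := by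
  obtain ⟨k, hk⟩ := h.exists_uniform_expand (δ := δ / 2) (by positivity)
  have hxi := h.xi_pos
  have hxi1 := h.xi_lt_one
  obtain ⟨α₀, hα₀, hclose⟩ := h.pseudo_close_uniform k (ε := min (δ / 2) (ξ₀ / 8)) (by positivity)
  -- `lam` is a `k`-th root of a number slightly larger than `1`
  obtain ⟨lam, hlam1, hlamr, hlam2, hlamk⟩ :
      ∃ lam : ℝ, 1 < lam ∧ lam ≤ r ∧ lam ≤ 2 ∧ lam ^ k ≤ 3 / 2 := by
    have hc : ContinuousAt (fun t : ℝ => t ^ k) 1 := by fun_prop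
    have h1 : ∀ᶠ t in nhds (1 : ℝ), t ^ k < 3 / 2 :=
      hc.eventually (Iio_mem_nhds (by norm_num))
    have h2 : ∀ᶠ t in nhds (1 : ℝ), t < r := Iio_mem_nhds hr
    have h3 : ∀ᶠ t in nhds (1 : ℝ), t < 2 := Iio_mem_nhds (by norm_num)
    have h4 := ((h1.and (h2.and h3)).filter_mono (nhdsWithin_le_nhds (s := Ioi 1))).and
      self_mem_nhdsWithin
    obtain ⟨t, ⟨ht1, ht2, ht3⟩, ht4⟩ := h4.exists
    exact ⟨t, ht4, ht2.le, ht3.le, ht1.le⟩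
  have hlam0 : 0 < lam := by linarith
  have hmin : 0 < min (2 * δ) 1 := by positivity
  have hm1 : min (2 * δ) 1 ≤ 1 := min_le_right _ _
  refine ⟨lam, hlam1, hlamr, hlam2, (min (2 * δ) 1) ^ k / (3 / 2), by positivity, α₀, hα₀,
    fun α x hα hα' hx n => ?_⟩
  induction n using Nat.strong_induction_on generalizing x with
  | _ n ih =>
    intro hfree
    by_cases hnk : n ≤ k
    · have hln : lam ^ n ≤ 3 / 2 := (pow_le_pow_right₀ hlam1.le hnk).trans hlamk
      constructor
      · have h1 : (min (2 * δ) 1) ^ n ≤ vprod x n := by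
          unfold vprod
          rw [← Finset.card_range n, ← Finset.prod_const, Finset.card_range]
          refine Finset.prod_le_prod (fun _ _ => hmin.le) fun i hi => ?_
          have := hfree i (Finset.mem_range.1 hi)
          exact (min_le_left _ _).trans (by linarith)
        have h2 : (min (2 * δ) 1) ^ k ≤ (min (2 * δ) 1) ^ n :=
          pow_le_pow_of_le_one hmin.le hm1 hnk
        rw [div_mul_eq_mul_div, div_le_iff₀ (by norm_num)]
        have h3 := pow_pos hmin k
        have h4 := vprod_nonneg x n
        calc _ ≤ (min (2 * δ) 1) ^ k * (3 / 2) := by gcongr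
          _ ≤ _ := by gcongr; linarith
      · intro hend
        have hc := hclose α x hα hα' hx
        have h1 : ξ₀ / 4 ≤ vprod (orb a (x 0)) n := by
          refine h.vprod_ge_of_end_near (hx 0).1 n (fun i hi h0 => ?_) ?_
          · have c1 := (hc i (by omega)).1
            rw [h0, sub_zero] at c1
            have := hfree i hi
            have := min_le_left (δ / 2) (ξ₀ / 8)
            linarith
          · have c1 := (hc n hnk).1
            have := min_le_left (δ / 2) (ξ₀ / 8)
            have := abs_sub_abs_le_abs_sub (orb a (x 0) n) (x n)
            rw [abs_sub_comm] at this
            linarith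
        have c2 := (hc n hnk).2
        have := min_le_right (δ / 2) (ξ₀ / 8)
        have := (abs_le.1 c2).1
        calc ξ₀ / 16 * lam ^ n ≤ ξ₀ / 16 * (3 / 2) := by gcongr
          _ ≤ _ := by linarith
    · push Not at hnk
      have hc := hclose α x hα hα' hx
      rcases hk (x 0) (hx 0).1 with ⟨j, hj1, hjk, hj⟩ | ⟨j, hjk, hj⟩
      · have c2 := (abs_le.1 (hc j hjk).2).1
        have := min_le_right (δ / 2) (ξ₀ / 8)
        have hvj : lam ^ j ≤ vprod x j :=
          ((pow_le_pow_right₀ hlam1.le hjk).trans hlamk).trans (by linarith)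
        obtain ⟨i1, i2⟩ := ih (n - j) (by omega) (fun i => x (j + i)) (hx.shift j)
          fun i hi => hfree _ (by omega)
        have e : vprod x n = vprod x j * vprod (fun i => x (j + i)) (n - j) := by
          rw [← vprod_add, Nat.add_sub_cancel' (by omega)]
        have el : lam ^ n = lam ^ j * lam ^ (n - j) := by
          rw [← pow_add, Nat.add_sub_cancel' (by omega)]
        rw [e, el]
        have hv := vprod_nonneg x j
        constructor
        · rw [mul_left_comm]; gcongr
        · intro hend
          have := i2 (by simpa [Nat.add_sub_cancel' (show j ≤ n by omega)] using hend)
          rw [mul_left_comm]; gcongr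
      · exfalso
        have c1 := (hc j hjk).1
        have := min_le_left (δ / 2) (ξ₀ / 8)
        have := hfree j (by omega)
        have := abs_sub_abs_le_abs_sub (x j) (orb a (x 0) j)
        linarith

end Setting

/-! ### Binding to the critical orbit -/

/-- The length of the interval `I_{n+1}`. -/
def blen (a α : ℝ) (n : ℕ) : ℝ := Metric.diam (shadow a α n)

theorem blen_nonneg (a α : ℝ) (n : ℕ) : 0 ≤ blen a α n := Metric.diam_nonneg

theorem blen_zero (a : ℝ) {α : ℝ} (hα : 0 < α) : blen a α 0 = 4 * α := by
  rw [blen, shadow, Real.diam_Icc (by linarith)]; ring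

theorem exists_shadow_eq_Icc (a : ℝ) {α : ℝ} (hα : 0 < α) (n : ℕ) :
    ∃ l r, l ≤ r ∧ shadow a α n = Icc l r := by
  obtain ⟨hne, -, -⟩ := shadow_nonempty_compact a hα n
  cases n with
  | zero => exact ⟨_, _, nonempty_Icc.1 hne, rfl⟩
  | succ n => exact ⟨_, _, nonempty_Icc.1 hne, rfl⟩

theorem abs_sub_le_blen (a : ℝ) {α : ℝ} (hα : 0 < α) {n : ℕ} {u v : ℝ}
    (hu : u ∈ shadow a α n) (hv : v ∈ shadow a α n) : |u - v| ≤ blen a α n := by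
  rw [← Real.dist_eq]
  exact Metric.dist_le_diam_of_mem (shadow_nonempty_compact a hα n).2.1.isBounded hu hv

theorem midpoint_mem_shadow (a : ℝ) {α : ℝ} (hα : 0 < α) {n : ℕ} {u v : ℝ}
    (hu : u ∈ shadow a α n) (hv : v ∈ shadow a α n) : (u + v) / 2 ∈ shadow a α n := by
  obtain ⟨l, r, -, e⟩ := exists_shadow_eq_Icc a hα n
  rw [e] at hu hv ⊢
  exact ⟨by linarith [hu.1, hv.1], by linarith [hu.2, hv.2]⟩

theorem mem_shadow_succ (a : ℝ) {α : ℝ} (hα : 0 < α) {n : ℕ} {y y' : ℝ} (hy : y ∈ shadow a α n)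
    (h : |y' - quad a y| ≤ α) : y' ∈ shadow a α (n + 1) := by
  have hk := (shadow_nonempty_compact a hα n).2.1.image (continuous_quad a)
  have h1 := csInf_le hk.bddBelow (mem_image_of_mem _ hy)
  have h2 := le_csSup hk.bddAbove (mem_image_of_mem _ hy)
  have h3 := abs_le.1 h
  exact ⟨by linarith [h3.1], by linarith [h3.2]⟩

theorem mem_shadow {a β α : ℝ} (hα : 0 < α) {y : ℕ → ℝ} (hy : IsPseudo a β α y)
    (h0 : y 0 ∈ shadow a α 0) (n : ℕ) : y n ∈ shadow a α n := by
  induction n with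
  | zero => exact h0
  | succ n ih => exact mem_shadow_succ a hα ih (hy n).2

theorem crit_mem_shadow (a : ℝ) {α : ℝ} (hα : 0 < α) (n : ℕ) : crit a (n + 1) ∈ shadow a α n := by
  induction n with
  | zero =>
    rw [zero_add, crit_one]
    simp only [shadow, quad, mem_Icc]
    constructor <;> nlinarith
  | succ n ih =>
    refine mem_shadow_succ a hα ih ?_
    rw [← crit_succ, sub_self, abs_zero]; exact hα.le

namespace Setting

variable {a β ξ₀ : ℝ}

theorem blen_lt (h : Setting a β ξ₀) {α : ℝ} (hα : 0 < α) {n : ℕ} (hn : n < bindingTime a ξ₀ α) :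
    blen a α n < ξ₀ :=
  (isGreatest_bindingTime a h.xi_pos hα).1.1 n hn

theorem sum_blen_le (h : Setting a β ξ₀) {α : ℝ} (hα : 0 < α) {n : ℕ}
    (hn : n ≤ bindingTime a ξ₀ α) : ∑ i ∈ Finset.range n, blen a α i ≤ ξ₀ :=
  (Finset.sum_le_sum_of_subset_of_nonneg (Finset.range_mono hn)
    fun i _ _ => blen_nonneg a α i).trans (isGreatest_bindingTime a h.xi_pos hα).1.2

theorem le_abs_of_mem_shadow (h : Setting a β ξ₀) {α : ℝ} (hα : 0 < α) {n : ℕ}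
    (hn : n < bindingTime a ξ₀ α) {z : ℝ} (hz : z ∈ shadow a α n) : ξ₀ ≤ |z| := by
  have h1 := abs_sub_le_blen a hα (crit_mem_shadow a hα n) hz
  have h2 := h.blen_lt hα hn
  have h3 := h.le_abs_crit n
  have := abs_sub_abs_le_abs_sub (crit a (n + 1)) z
  linarith

theorem abs_le_of_mem_shadow (h : Setting a β ξ₀) {α : ℝ} (hα : 0 < α) {n : ℕ}
    {z : ℝ} (hz : z ∈ shadow a α n) :
    |z| ≤ |crit a (n + 1)| * Real.exp (blen a α n / ξ₀) := by
  have h1 := abs_sub_le_blen a hα hz (crit_mem_shadow a hα n)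
  have h3 := h.le_abs_crit n
  have h4 := abs_sub_abs_le_abs_sub z (crit a (n + 1))
  have hxi := h.xi_pos
  have hb := blen_nonneg a α n
  have h5 := Real.add_one_le_exp (blen a α n / ξ₀)
  calc |z| ≤ |crit a (n + 1)| + blen a α n := by linarith
    _ ≤ |crit a (n + 1)| * (blen a α n / ξ₀ + 1) := by
        rw [mul_add, mul_one, add_comm]
        gcongr
        rw [mul_div_assoc', le_div_iff₀ hxi]
        nlinarith
    _ ≤ _ := by gcongr

theorem abs_ge_of_mem_shadow (h : Setting a β ξ₀) {α : ℝ} (hα : 0 < α) {n : ℕ}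
    (hn : n < bindingTime a ξ₀ α) {z : ℝ} (hz : z ∈ shadow a α n) :
    |crit a (n + 1)| * Real.exp (-(blen a α n / ξ₀)) ≤ |z| := by
  have h1 := abs_sub_le_blen a hα (crit_mem_shadow a hα n) hz
  have h2 := h.blen_lt hα hn
  have h3 := h.le_abs_crit n
  have h4 := abs_sub_abs_le_abs_sub (crit a (n + 1)) z
  have hxi := h.xi_pos
  have hb := blen_nonneg a α n
  have h5 := Real.add_one_le_exp (blen a α n / ξ₀)
  have h6 : |crit a (n + 1)| ≤ |z| * (blen a α n / ξ₀ + 1) := by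
    have hz := h.le_abs_of_mem_shadow hα hn hz
    have : blen a α n ≤ |z| * (blen a α n / ξ₀) := by
      rw [mul_div_assoc', le_div_iff₀ hxi]; nlinarith
    nlinarith
  rw [Real.exp_neg, ← div_eq_mul_inv, div_le_iff₀ (Real.exp_pos _)]
  exact h6.trans (by gcongr)

theorem vprod_shadow (h : Setting a β ξ₀) {α : ℝ} (hα : 0 < α) {z : ℕ → ℝ}
    (hz : ∀ i, z i ∈ shadow a α i) {k : ℕ} (hk : k ≤ bindingTime a ξ₀ α) :
    Real.exp (-1) * |critD a k| ≤ vprod z k := by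
  have key : ∀ j ≤ k, Real.exp (-(∑ i ∈ Finset.range j, blen a α i / ξ₀)) * |critD a j| ≤
      vprod z j := by
    intro j
    induction j with
    | zero => intro _; simp [critD_zero, vprod_zero]
    | succ j ih =>
      intro hj
      have h1 := ih (by omega)
      have h2 := h.abs_ge_of_mem_shadow hα (by omega) (hz j)
      rw [vprod_succ, critD_succ, abs_mul, abs_mul, abs_neg, abs_two, Finset.sum_range_succ,
        neg_add, Real.exp_add]
      have hv := vprod_nonneg z j
      calc _ = (Real.exp (-(∑ i ∈ Finset.range j, blen a α i / ξ₀)) * |critD a j|) *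
            (2 * (|crit a (j + 1)| * Real.exp (-(blen a α j / ξ₀)))) := by ring
        _ ≤ vprod z j * (2 * |z j|) := by gcongr
  refine le_trans ?_ (key k le_rfl)
  gcongr
  rw [← Finset.sum_div]
  exact div_le_one_of_le₀ (h.sum_blen_le hα hk) h.xi_pos.le

theorem exists_critD_sums (h : Setting a β ξ₀) : ∃ S > 0, ∀ n : ℕ,
    ∑ i ∈ Finset.range n, |critD a i|⁻¹ ≤ S ∧
      ∑ i ∈ Finset.range (n + 1), |critD a i| ≤ S * |critD a n| := by
  obtain ⟨r, hr, c, hc, hgrow⟩ := h.critD_growth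
  have hr0 : 0 < r := by linarith
  have hri : r⁻¹ < 1 := inv_lt_one_of_one_lt₀ hr
  have geo : ∀ n, ∑ i ∈ Finset.range n, (r⁻¹) ^ i ≤ (1 - r⁻¹)⁻¹ := fun n => by
    rw [← tsum_geometric_of_lt_one (by positivity) hri]
    exact (summable_geometric_of_lt_one (by positivity) hri).sum_le_tsum _
      fun i _ => by positivity
  have hpos : 0 < 1 - r⁻¹ := by linarith
  refine ⟨c⁻¹ * (1 - r⁻¹)⁻¹, by positivity, fun n => ⟨?_, ?_⟩⟩
  · calc ∑ i ∈ Finset.range n, |critD a i|⁻¹ ≤ ∑ i ∈ Finset.range n, c⁻¹ * (r⁻¹) ^ i := by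
          refine Finset.sum_le_sum fun i _ => ?_
          have := hgrow 0 i
          rw [critD_zero, abs_one, mul_one, zero_add] at this
          rw [inv_pow, ← mul_inv]
          exact inv_anti₀ (by positivity) this
      _ ≤ _ := by rw [← Finset.mul_sum]; gcongr; exact geo n
  · calc ∑ i ∈ Finset.range (n + 1), |critD a i|
        ≤ ∑ i ∈ Finset.range (n + 1), c⁻¹ * (r⁻¹) ^ (n + 1 - 1 - i) * |critD a n| := by
          refine Finset.sum_le_sum fun i hi => ?_
          have hi' : i ≤ n := by have := Finset.mem_range.1 hi; omega
          have := hgrow i (n - i)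
          rw [Nat.add_sub_cancel' hi'] at this
          rw [inv_pow, ← mul_inv, mul_comm, ← div_eq_mul_inv, le_div_iff₀ (by positivity)]
          simpa [mul_comm] using this
      _ = c⁻¹ * (∑ i ∈ Finset.range (n + 1), (r⁻¹) ^ i) * |critD a n| := by
          rw [← Finset.sum_range_reflect (fun i => (r⁻¹) ^ i), Finset.mul_sum, Finset.sum_mul]
      _ ≤ _ := by gcongr; exact geo _

theorem blen_succ_le (h : Setting a β ξ₀) {α : ℝ} (hα : 0 < α) (n : ℕ) :
    blen a α (n + 1) ≤
      Real.exp (blen a α n / ξ₀) * (2 * |crit a (n + 1)|) * blen a α n + 2 * α := by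
  obtain ⟨hne, hk, -⟩ := shadow_nonempty_compact a hα n
  have hki := hk.image (continuous_quad a)
  have hnei := hne.image (quad a)
  obtain ⟨u, hu, eu⟩ := hki.sInf_mem hnei
  obtain ⟨v, hv, ev⟩ := hki.sSup_mem hnei
  have hle : sInf (quad a '' shadow a α n) ≤ sSup (quad a '' shadow a α n) :=
    Real.sInf_le_sSup _ hki.bddBelow hki.bddAbove
  rw [blen, shadow, Real.diam_Icc (by linarith), ← eu, ← ev]
  have hm := h.abs_le_of_mem_shadow hα (midpoint_mem_shadow a hα hu hv)
  have hd := abs_sub_le_blen a hα hu hv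
  rw [abs_div, abs_two, div_le_iff₀ two_pos] at hm
  have e : quad a v - quad a u = (u + v) * (u - v) := by unfold quad; ring
  have h1 : quad a v - quad a u ≤ |u + v| * |u - v| := by
    rw [e, ← abs_mul]; exact le_abs_self _
  have h2 : |u + v| * |u - v| ≤
      (|crit a (n + 1)| * Real.exp (blen a α n / ξ₀) * 2) * blen a α n := by gcongr
  linarith

theorem le_blen_succ (h : Setting a β ξ₀) {α : ℝ} (hα : 0 < α) {n : ℕ}
    (hn : n < bindingTime a ξ₀ α) :
    Real.exp (-(blen a α n / ξ₀)) * (2 * |crit a (n + 1)|) * blen a α n ≤ blen a α (n + 1) := by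
  obtain ⟨l, r, hlr, e⟩ := exists_shadow_eq_Icc a hα n
  have hl : l ∈ shadow a α n := by rw [e]; exact left_mem_Icc.2 hlr
  have hr : r ∈ shadow a α n := by rw [e]; exact right_mem_Icc.2 hlr
  have hb : blen a α n = r - l := by rw [blen, e, Real.diam_Icc hlr]
  have hm := h.abs_ge_of_mem_shadow hα hn (midpoint_mem_shadow a hα hl hr)
  rw [abs_div, abs_two, le_div_iff₀ two_pos] at hm
  have hd := abs_sub_le_blen a hα (n := n + 1)
    (mem_shadow_succ a hα hl (by rw [sub_self, abs_zero]; exact hα.le))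
    (mem_shadow_succ a hα hr (by rw [sub_self, abs_zero]; exact hα.le))
  have e2 : quad a l - quad a r = (l + r) * (r - l) := by unfold quad; ring
  rw [e2, abs_mul, abs_of_nonneg (show 0 ≤ r - l by linarith), ← hb] at hd
  refine le_trans ?_ hd
  have := blen_nonneg a α n
  gcongr
  linarith

/-- Up to the binding time, the intervals grow like the derivative along the critical orbit. -/
theorem blen_comparable (h : Setting a β ξ₀) : ∃ C > 0, ∀ α, 0 < α → ∀ n ≤ bindingTime a ξ₀ α,
    blen a α n ≤ C * (α * |critD a n|) ∧ α * |critD a n| ≤ Real.exp 1 * blen a α n := by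
  obtain ⟨S, hS, hsum⟩ := h.exists_critD_sums
  refine ⟨Real.exp 1 * (4 + 2 * S), by positivity, fun α hα n hn => ?_⟩
  set E : ℕ → ℝ := fun n => ∑ i ∈ Finset.range n, blen a α i / ξ₀ with hE
  have hE1 : E n ≤ 1 := by
    simp only [hE]
    rw [← Finset.sum_div]
    exact div_le_one_of_le₀ (h.sum_blen_le hα hn) h.xi_pos.le
  have hE0 : ∀ j, 0 ≤ E j := fun j =>
    Finset.sum_nonneg fun i _ => div_nonneg (blen_nonneg a α i) h.xi_pos.le
  constructor
  · have key : ∀ j ≤ n, blen a α j ≤ Real.exp (E j) * |critD a j| *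
        (4 * α + 2 * α * ∑ i ∈ Finset.range j, |critD a (i + 1)|⁻¹) := by
      intro j
      induction j with
      | zero => intro _; simp [hE, critD_zero, blen_zero a hα]
      | succ j ih =>
        intro hj
        have h1 := ih (by omega)
        have h2 := h.blen_succ_le hα j
        have hDj := h.abs_critD_pos (j + 1)
        have eE : E (j + 1) = E j + blen a α j / ξ₀ := Finset.sum_range_succ _ _
        have eD : |critD a (j + 1)| = |critD a j| * (2 * |crit a (j + 1)|) := by
          rw [critD_succ, abs_mul, abs_mul, abs_neg, abs_two]
        have h3 : Real.exp (blen a α j / ξ₀) * (2 * |crit a (j + 1)|) * blen a α j ≤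
            Real.exp (E (j + 1)) * |critD a (j + 1)| *
              (4 * α + 2 * α * ∑ i ∈ Finset.range j, |critD a (i + 1)|⁻¹) := by
          rw [eE, eD, Real.exp_add]
          calc _ ≤ Real.exp (blen a α j / ξ₀) * (2 * |crit a (j + 1)|) *
                (Real.exp (E j) * |critD a j| *
                  (4 * α + 2 * α * ∑ i ∈ Finset.range j, |critD a (i + 1)|⁻¹)) := by gcongr
            _ = _ := by ring
        have h4 : 2 * α ≤ Real.exp (E (j + 1)) * |critD a (j + 1)| *
            (2 * α * |critD a (j + 1)|⁻¹) := by
          have : Real.exp (E (j + 1)) * |critD a (j + 1)| * (2 * α * |critD a (j + 1)|⁻¹) =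
              Real.exp (E (j + 1)) * (2 * α) := by field_simp
          rw [this]
          have := Real.one_le_exp (hE0 (j + 1))
          nlinarith
        rw [Finset.sum_range_succ]
        calc _ ≤ _ := h2
          _ ≤ _ := add_le_add h3 h4
          _ = _ := by ring
    have h5 : ∑ i ∈ Finset.range n, |critD a (i + 1)|⁻¹ ≤ S := by
      refine le_trans ?_ (hsum (n + 1)).1
      rw [Finset.sum_range_succ']
      have : 0 ≤ |critD a 0|⁻¹ := by positivity
      linarith
    calc blen a α n ≤ _ := key n le_rfl
      _ ≤ Real.exp 1 * |critD a n| * (4 * α + 2 * α * S) := by gcongr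
      _ = _ := by ring
  · have key : ∀ j ≤ n, Real.exp (-(E j)) * |critD a j| * α ≤ blen a α j := by
      intro j
      induction j with
      | zero => intro _; simp [hE, critD_zero, blen_zero a hα]; linarith
      | succ j ih =>
        intro hj
        have h1 := ih (by omega)
        have h2 := h.le_blen_succ hα (show j < bindingTime a ξ₀ α by omega)
        have eE : E (j + 1) = E j + blen a α j / ξ₀ := Finset.sum_range_succ _ _
        have eD : |critD a (j + 1)| = |critD a j| * (2 * |crit a (j + 1)|) := by
          rw [critD_succ, abs_mul, abs_mul, abs_neg, abs_two]
        refine le_trans ?_ h2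
        rw [eE, eD, neg_add, Real.exp_add]
        calc _ = Real.exp (-(blen a α j / ξ₀)) * (2 * |crit a (j + 1)|) *
              (Real.exp (-(E j)) * |critD a j| * α) := by ring
          _ ≤ _ := by gcongr
    have h1 := key n le_rfl
    have h2 : Real.exp (-1) * |critD a n| * α ≤ blen a α n := by
      refine le_trans ?_ h1; gcongr
    rw [Real.exp_neg, mul_assoc, inv_mul_le_iff₀ (Real.exp_pos 1)] at h2
    linarith

/-- At the binding time the accumulated derivative is of order `1/α`. -/
theorem binding_bounds (h : Setting a β ξ₀) : ∃ r > 1, ∃ c > 0, ∃ C > 0, ∀ α, 0 < α → α ≤ 1 →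
    c ≤ α * |critD a (bindingTime a ξ₀ α)| ∧ α * r ^ bindingTime a ξ₀ α ≤ C ∧
    (∀ n, c * r ^ n ≤ |critD a n|) ∧
    ∀ n ≤ bindingTime a ξ₀ α, ∑ i ∈ Finset.range n, blen a α i ≤ C * (α * |critD a n|) := by
  obtain ⟨r, hr, c, hc, hgrow⟩ := h.critD_growth
  obtain ⟨S, hS, hsum⟩ := h.exists_critD_sums
  obtain ⟨C, hC, hcomp⟩ := h.blen_comparable
  have hxi := h.xi_pos
  have hr0 : 0 < r := by linarith
  have hD : ∀ n, c * r ^ n ≤ |critD a n| := fun n => by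
    simpa [critD_zero] using hgrow 0 n
  have hsumb : ∀ α, 0 < α → ∀ n ≤ bindingTime a ξ₀ α,
      ∑ i ∈ Finset.range (n + 1), blen a α i ≤ C * S * (α * |critD a n|) := by
    intro α hα n hn
    calc ∑ i ∈ Finset.range (n + 1), blen a α i
        ≤ ∑ i ∈ Finset.range (n + 1), C * (α * |critD a i|) := by
          refine Finset.sum_le_sum fun i hi => (hcomp α hα i ?_).1
          have := Finset.mem_range.1 hi; omega
      _ = C * α * ∑ i ∈ Finset.range (n + 1), |critD a i| := by
          rw [Finset.mul_sum]; refine Finset.sum_congr rfl fun i _ => by ring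
      _ ≤ C * α * (S * |critD a n|) := by gcongr; exact (hsum n).2
      _ = _ := by ring
  refine ⟨r, hr, min c (ξ₀ / (C * S)), by positivity,
    max (C * S) (max 1 (4 * (Real.exp 1 * ξ₀) / c)), by positivity, fun α hα hα1 => ⟨?_, ?_, ?_, ?_⟩⟩
  · refine (min_le_right _ _).trans ?_
    rw [div_le_iff₀ (by positivity), mul_comm]
    refine le_trans ?_ (hsumb α hα _ le_rfl)
    by_contra hcon
    push Not at hcon
    have : bindingTime a ξ₀ α + 1 ∈ bindingSet a ξ₀ α := by
      refine ⟨fun n hn => ?_, hcon.le⟩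
      refine lt_of_le_of_lt ?_ hcon
      exact Finset.single_le_sum (f := fun i => blen a α i) (fun i _ => blen_nonneg a α i)
        (Finset.mem_range.2 hn)
    have := (isGreatest_bindingTime a hxi hα).2 this
    omega
  · refine le_trans ?_ (le_max_right _ _)
    rcases Nat.eq_zero_or_pos (bindingTime a ξ₀ α) with hN | hN
    · rw [hN, pow_zero, mul_one]; exact hα1.trans (le_max_left _ _)
    · refine le_trans ?_ (le_max_right _ _)
      rw [le_div_iff₀ hc]
      obtain ⟨m, hm⟩ : ∃ m, bindingTime a ξ₀ α = m + 1 := ⟨_, (Nat.succ_pred_eq_of_pos hN).symm⟩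
      have h1 := (hcomp α hα m (by omega)).2
      have h2 := h.blen_lt hα (show m < bindingTime a ξ₀ α by omega)
      have h3 := hD (m + 1)
      have h4 := h.abs_critD_succ_le m
      rw [hm]
      calc α * r ^ (m + 1) * c = α * (c * r ^ (m + 1)) := by ring
        _ ≤ α * (4 * |critD a m|) := mul_le_mul_of_nonneg_left (h3.trans h4) hα.le
        _ = 4 * (α * |critD a m|) := by ring
        _ ≤ 4 * (Real.exp 1 * ξ₀) := by
            have := Real.exp_pos 1
            have : Real.exp 1 * blen a α m ≤ Real.exp 1 * ξ₀ := by gcongr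
            linarith
  · intro n
    refine le_trans ?_ (hD n)
    gcongr
    exact min_le_left _ _
  · intro n hn
    refine le_trans ?_ ((hsumb α hα n hn).trans ?_)
    · rw [Finset.sum_range_succ]; linarith [blen_nonneg a α n]
    · gcongr; exact le_max_left _ _

/-- A perturbed orbit that starts close to the critical point follows the critical orbit. -/
theorem _root_.VianaMap.pseudo_mem_shadow {a β α α' : ℝ} {x : ℕ → ℝ} (hα : 0 < α')
    (hx : IsPseudo a β α x) (hαα : α ≤ α') (hx0 : x 0 ^ 2 + α ≤ 2 * α') (i : ℕ) :
    x (1 + i) ∈ shadow a α' i := by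
  refine mem_shadow (β := β) hα ((hx.mono hαα).shift 1) ?_ i
  have h1 := abs_le.1 (hx 0).2
  simp only [shadow, quad, mem_Icc, add_zero] at h1 ⊢
  constructor <;> nlinarith [h1.1, h1.2, sq_nonneg (x 0)]

end Setting

/-! ### Growth of the truncated derivative between returns -/

/-- The threshold `α^0.6` for a return to the critical point. -/
def thr (α : ℝ) : ℝ := α ^ (0.6 : ℝ)

/-- The number of returns to `[-α^0.6, α^0.6]` before time `n`. -/
def returns (α : ℝ) (x : ℕ → ℝ) (n : ℕ) : ℕ :=
  ∑ i ∈ Finset.range n, if |x i| ≤ thr α then 1 else 0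

/-- The truncated product `∏_{i<n} max(2|x_i|, 2α)`. -/
def tprod (α : ℝ) (x : ℕ → ℝ) (n : ℕ) : ℝ := ∏ i ∈ Finset.range n, max (2 * |x i|) (2 * α)

theorem thr_pos {α : ℝ} (hα : 0 < α) : 0 < thr α := Real.rpow_pos_of_pos hα _

theorem thr_le_one {α : ℝ} (hα : 0 < α) (hα1 : α ≤ 1) : thr α ≤ 1 :=
  Real.rpow_le_one hα.le hα1 (by norm_num)

theorem le_thr {α : ℝ} (hα : 0 < α) (hα1 : α ≤ 1) : α ≤ thr α := by
  conv_lhs => rw [← Real.rpow_one α]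
  exact Real.rpow_le_rpow_of_exponent_ge hα hα1 (by norm_num)

theorem thr_sq {α : ℝ} (hα : 0 < α) : thr α ^ 2 = α * α ^ (0.2 : ℝ) := by
  rw [thr, ← Real.rpow_natCast, ← Real.rpow_mul hα.le]
  nth_rewrite 2 [← Real.rpow_one α]
  rw [← Real.rpow_add hα]; norm_num

theorem tprod_add (α : ℝ) (x : ℕ → ℝ) (m n : ℕ) :
    tprod α x (m + n) = tprod α x m * tprod α (fun i => x (m + i)) n := by
  simp [tprod, Finset.prod_range_add]

theorem vprod_le_tprod (α : ℝ) (x : ℕ → ℝ) (n : ℕ) : vprod x n ≤ tprod α x n :=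
  Finset.prod_le_prod (fun _ _ => by positivity) fun _ _ => le_max_left _ _

theorem tprod_pos {α : ℝ} (hα : 0 < α) (x : ℕ → ℝ) (n : ℕ) : 0 < tprod α x n :=
  Finset.prod_pos fun _ _ => lt_max_of_lt_right (by linarith)

theorem returns_add (α : ℝ) (x : ℕ → ℝ) (m n : ℕ) :
    returns α x (m + n) = returns α x m + returns α (fun i => x (m + i)) n := by
  unfold returns; rw [Finset.sum_range_add]

theorem returns_one_of_le {α : ℝ} {x : ℕ → ℝ} (h : |x 0| ≤ thr α) : returns α x 1 = 1 := by
  rw [returns, Finset.sum_range_one, if_pos h]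

namespace Setting

variable {a β ξ₀ : ℝ}

/-- Binding at distance `ρ ≥ α^0.6` from the critical point yields a net gain. -/
theorem exists_binding_gain (h : Setting a β ξ₀) {r c C : ℝ} (hr : 1 < r) (hc : 0 < c)
    (hC : 0 < C)
    (hb : ∀ α, 0 < α → α ≤ 1 →
      c ≤ α * |critD a (bindingTime a ξ₀ α)| ∧ α * r ^ bindingTime a ξ₀ α ≤ C) :
    ∃ α₀ > 0, α₀ ≤ 1 ∧ ∀ α lam ρ, 0 < α → α ≤ α₀ → 1 < lam → lam ≤ r ^ (0.1 : ℝ) → lam ≤ 2 →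
      thr α ≤ ρ → lam ^ (bindingTime a ξ₀ α + 1) ≤
        ξ₀ / 16 * (2 * ρ * (Real.exp (-1) * |critD a (bindingTime a ξ₀ α)|)) := by
  have hxi := h.xi_pos
  set K : ℝ := ξ₀ / 16 * (2 * (Real.exp (-1) * c)) / (2 * C ^ (0.1 : ℝ)) with hK
  have hK0 : 0 < K := by positivity
  refine ⟨min 1 (K ^ ((0.3 : ℝ)⁻¹)), by positivity, min_le_left _ _,
    fun α lam ρ hα hα' hlam hlamr hlam2 hρ => ?_⟩
  have hα1 : α ≤ 1 := hα'.trans (min_le_left _ _)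
  obtain ⟨h1, h2⟩ := hb α hα hα1
  set N := bindingTime a ξ₀ α
  have hαK : α ^ (0.3 : ℝ) ≤ K := by
    calc α ^ (0.3 : ℝ) ≤ (K ^ ((0.3 : ℝ)⁻¹)) ^ (0.3 : ℝ) :=
          Real.rpow_le_rpow hα.le (hα'.trans (min_le_right _ _)) (by norm_num)
      _ = K := Real.rpow_inv_rpow hK0.le (by norm_num)
  have hr0 : 0 < r := by linarith
  have hlamN : lam ^ N ≤ C ^ (0.1 : ℝ) / α ^ (0.1 : ℝ) := by
    rw [← Real.div_rpow hC.le hα.le]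
    calc lam ^ N ≤ (r ^ (0.1 : ℝ)) ^ N := by gcongr
      _ = (r ^ N) ^ (0.1 : ℝ) := by
          rw [← Real.rpow_natCast, ← Real.rpow_mul hr0.le, mul_comm, Real.rpow_mul hr0.le,
            Real.rpow_natCast]
      _ ≤ _ := by
          gcongr
          rw [le_div_iff₀ hα, mul_comm]; exact h2
  have e1 : α ^ (0.6 : ℝ) = α ^ (0.3 : ℝ) * α ^ (0.3 : ℝ) := by
    rw [← Real.rpow_add hα]; norm_num
  have e2 : α = α ^ (0.6 : ℝ) * α ^ (0.3 : ℝ) * α ^ (0.1 : ℝ) := by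
    rw [← Real.rpow_add hα, ← Real.rpow_add hα]; norm_num
  have hDc : c / α ≤ |critD a N| := by rw [div_le_iff₀ hα, mul_comm]; exact h1
  have ht := thr_pos hα
  have p1 : 0 < α ^ (0.1 : ℝ) := by positivity
  have p3 : 0 < α ^ (0.3 : ℝ) := by positivity
  have p6 : 0 < α ^ (0.6 : ℝ) := by positivity
  have pC : 0 < C ^ (0.1 : ℝ) := by positivity
  calc lam ^ (N + 1) = lam ^ N * lam := pow_succ _ _
    _ ≤ C ^ (0.1 : ℝ) / α ^ (0.1 : ℝ) * 2 := by gcongr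
    _ = α ^ (0.3 : ℝ) * (2 * C ^ (0.1 : ℝ)) / (α ^ (0.3 : ℝ) * α ^ (0.1 : ℝ)) := by
        field_simp
    _ ≤ K * (2 * C ^ (0.1 : ℝ)) / (α ^ (0.3 : ℝ) * α ^ (0.1 : ℝ)) := by gcongr
    _ = ξ₀ / 16 * (2 * (Real.exp (-1) * c)) / (α ^ (0.3 : ℝ) * α ^ (0.1 : ℝ)) := by
        rw [hK]; field_simp
    _ = ξ₀ / 16 * (2 * thr α * (Real.exp (-1) * (c / α))) := by
        nth_rewrite 4 [e2]
        rw [thr]; field_simp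
    _ ≤ _ := by
        have : 0 ≤ ρ := ht.le.trans hρ
        gcongr

/-- The growth of the derivative up to the first return. -/
theorem growth_until_return (h : Setting a β ξ₀) :
    ∃ lam > 1, lam ≤ 2 ∧ ∃ δ > 0, ∃ c > 0, ∃ α₀ > 0, ∀ α x, 0 < α → α < α₀ → IsPseudo a β α x →
      ∀ n, (∀ i < n, thr α < |x i|) →
        c * thr α * lam ^ n ≤ vprod x n ∧ (|x n| < δ → ξ₀ / 16 * lam ^ n ≤ vprod x n) := by
  obtain ⟨r, hr, c, hc, C, hC, hb⟩ := h.binding_bounds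
  have hxi := h.xi_pos
  have hr0 : 0 < r := by linarith
  obtain ⟨α₁, hα₁, hα₁1, hgain⟩ := h.exists_binding_gain hr hc hC
    fun α hα hα1 => ⟨(hb α hα hα1).1, (hb α hα hα1).2.1⟩
  have hD : ∀ n, c * r ^ n ≤ |critD a n| := (hb 1 one_pos le_rfl).2.2.1
  set δ := min (ξ₀ / 2) (Real.sqrt α₁) with hδdef
  have hδ : 0 < δ := by positivity
  obtain ⟨lam, hlam, hlamr, hlam2, cf, hcf, α₂, hα₂, hfree⟩ :=
    h.free_growth hδ (min_le_left _ _) (Real.one_lt_rpow hr (show (0 : ℝ) < 0.1 by norm_num))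
  have hlam0 : 0 < lam := by linarith
  have hlamr' : lam ≤ r := hlamr.trans
    ((Real.rpow_le_rpow_of_exponent_le hr.le (by norm_num)).trans (Real.rpow_one r).le)
  refine ⟨lam, hlam, hlam2, δ, hδ, min cf (ξ₀ / 16 * (Real.exp (-1) * c)), by positivity,
    min α₁ α₂, by positivity, fun α x hα hα' hx n => ?_⟩
  have hαα₁ : α ≤ α₁ := hα'.le.trans (min_le_left _ _)
  have hα1 : α ≤ 1 := hαα₁.trans hα₁1
  have ht := thr_pos hα
  have ht1 := thr_le_one hα hα1
  have hc'0 : 0 < min cf (ξ₀ / 16 * (Real.exp (-1) * c)) := by positivity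
  induction n using Nat.strong_induction_on generalizing x with
  | _ n ih =>
    intro hret
    have hfr := hfree α x hα.le (hα'.trans_le (min_le_right _ _)) hx
    by_cases hall : ∀ i < n, δ ≤ |x i|
    · refine ⟨?_, (hfr n hall).2⟩
      refine le_trans ?_ (hfr n hall).1
      have : min cf (ξ₀ / 16 * (Real.exp (-1) * c)) * thr α ≤ cf * 1 := by
        gcongr; exact min_le_left _ _
      gcongr; linarith
    · push Not at hall
      classical
      obtain ⟨hsn, hsδ⟩ := Nat.find_spec hall
      have hmin : ∀ i < Nat.find hall, δ ≤ |x i| := fun i hi => by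
        have := Nat.find_min hall hi
        push Not at this
        exact this (hi.trans hsn)
      generalize Nat.find hall = s at hsn hsδ hmin
      have hv1 := (hfr s hmin).2 hsδ
      -- bind as if the noise level were `max(α, |x_s|²)`
      set α' := max α (x s ^ 2) with hα'def
      have hα'0 : 0 < α' := lt_max_of_lt_left hα
      have hα'1 : α' ≤ α₁ := by
        refine max_le hαα₁ ?_
        rw [← sq_abs]
        calc |x s| ^ 2 ≤ Real.sqrt α₁ ^ 2 := by gcongr; exact hsδ.le.trans (min_le_right _ _)
          _ = α₁ := Real.sq_sqrt hα₁.le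
      have hα'le1 : α' ≤ 1 := hα'1.trans hα₁1
      have hthr : thr α' ≤ |x s| := by
        rcases le_total α (x s ^ 2) with hle | hle
        · have e : α' = x s ^ 2 := max_eq_right hle
          have e2 : |x s| = α' ^ (0.5 : ℝ) := by
            rw [e, ← sq_abs, ← Real.rpow_natCast, ← Real.rpow_mul (abs_nonneg _)]
            norm_num
          rw [e2]
          exact Real.rpow_le_rpow_of_exponent_ge hα'0 hα'le1 (by norm_num)
        · rw [hα'def, max_eq_left hle]; exact (hret s hsn).le
      have hmem : ∀ i, x (s + (1 + i)) ∈ shadow a α' i :=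
        pseudo_mem_shadow hα'0 (hx.shift s) (le_max_left _ _) (by
          have := le_max_left α (x s ^ 2); have := le_max_right α (x s ^ 2)
          simp only [add_zero]; linarith)
      have hvz : ∀ k ≤ bindingTime a ξ₀ α',
          Real.exp (-1) * |critD a k| ≤ vprod (fun i => x (s + (1 + i))) k :=
        fun k hk => h.vprod_shadow hα'0 hmem hk
      set N := bindingTime a ξ₀ α'
      have split : ∀ k, vprod x (s + (1 + k)) =
          vprod x s * (2 * |x s| * vprod (fun i => x (s + (1 + i))) k) := by
        intro k
        rw [vprod_add, vprod_add _ 1 k]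
        simp [vprod]
      have hxs : 0 < |x s| := ht.trans (hret s hsn)
      by_cases hcase : s + (1 + N) ≤ n
      · obtain ⟨m, rfl⟩ := Nat.exists_eq_add_of_le hcase
        have hg : lam ^ (N + 1) ≤ ξ₀ / 16 * (2 * |x s| * (Real.exp (-1) * |critD a N|)) :=
          hgain α' lam |x s| hα'0 hα'1 hlam hlamr hlam2 hthr
        have hv2 : lam ^ (s + (1 + N)) ≤ vprod x (s + (1 + N)) := by
          rw [split, pow_add, add_comm 1 N]
          calc lam ^ s * lam ^ (N + 1)
              ≤ lam ^ s * (ξ₀ / 16 * (2 * |x s| * (Real.exp (-1) * |critD a N|))) := by gcongr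
            _ = (ξ₀ / 16 * lam ^ s) * (2 * |x s| * (Real.exp (-1) * |critD a N|)) := by ring
            _ ≤ _ := by
                have := vprod_nonneg x s
                gcongr
                exact hvz N le_rfl
        obtain ⟨i1, i2⟩ := ih m (by omega) (fun i => x (s + (1 + N) + i)) (hx.shift _)
          fun i hi => hret _ (by omega)
        rw [vprod_add, pow_add]
        have hv0 := vprod_nonneg x (s + (1 + N))
        constructor
        · calc _ = lam ^ (s + (1 + N)) *
              (min cf (ξ₀ / 16 * (Real.exp (-1) * c)) * thr α * lam ^ m) := by ring
            _ ≤ _ := by gcongr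
        · intro hend
          calc _ = lam ^ (s + (1 + N)) * (ξ₀ / 16 * lam ^ m) := by ring
            _ ≤ _ := by gcongr; exact i2 hend
      · obtain ⟨k, rfl⟩ : ∃ k, n = s + (1 + k) := ⟨n - s - 1, by omega⟩
        have hkN : k < N := by omega
        constructor
        · rw [split]
          have e1 : lam ^ (s + (1 + k)) = lam ^ s * (lam * lam ^ k) := by
            rw [pow_add, pow_add, pow_one]
          rw [e1]
          calc _ ≤ (ξ₀ / 16 * (Real.exp (-1) * c)) * thr α * (lam ^ s * (2 * r ^ k)) := by
                gcongr; exact min_le_right _ _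
            _ = (ξ₀ / 16 * lam ^ s) * (2 * thr α * (Real.exp (-1) * (c * r ^ k))) := by ring
            _ ≤ (ξ₀ / 16 * lam ^ s) * (2 * |x s| * (Real.exp (-1) * |critD a k|)) := by
                gcongr
                · exact (hret s hsn).le
                · exact hD k
            _ ≤ _ := by
                have := vprod_nonneg x s
                gcongr
                exact hvz k hkN.le
        · intro hend
          have := h.le_abs_of_mem_shadow hα'0 hkN (hmem k)
          have : δ ≤ ξ₀ / 2 := min_le_left _ _
          linarith

/-- The growth of the truncated derivative, in terms of the number of returns: each return costs
at most the `N(α) + 1` steps of the binding period and a factor `C`. -/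
theorem tprod_growth (h : Setting a β ξ₀) :
    ∃ lam > 1, ∃ C ≥ 1, ∃ c > 0, ∃ α₀ > 0, ∀ α x, 0 < α → α < α₀ → IsPseudo a β α x → ∀ n,
      c * α * lam ^ n ≤ tprod α x n * (C * lam ^ (bindingTime a ξ₀ α + 1)) ^ returns α x n := by
  obtain ⟨lam, hlam, hlam2, δ, hδ, c₀, hc₀, α₀, hα₀, hG⟩ := h.growth_until_return
  obtain ⟨r, hr, c, hc, Cb, hCb, hb⟩ := h.binding_bounds
  have hxi := h.xi_pos
  have hlam0 : 0 < lam := by linarith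
  have hthr0 : Tendsto thr (nhdsWithin 0 (Ioi 0)) (nhds 0) := by
    have : Tendsto (fun x : ℝ => x ^ (0.6 : ℝ)) (nhds 0) (nhds 0) := by
      have := (Real.continuousAt_rpow_const 0 (0.6 : ℝ) (Or.inr (by norm_num))).tendsto
      rwa [Real.zero_rpow (by norm_num)] at this
    exact this.mono_left nhdsWithin_le_nhds
  obtain ⟨α₁, hα₁, hthrδ⟩ : ∃ α₁ > 0, ∀ α, 0 < α → α < α₁ → thr α < δ := by
    have := hthr0.eventually (Iio_mem_nhds hδ)
    rw [eventually_nhdsWithin_iff, Metric.eventually_nhds_iff] at this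
    obtain ⟨ε, hε, h1⟩ := this
    exact ⟨ε, hε, fun α hα hα' => h1 (by rwa [Real.dist_eq, sub_zero, abs_of_pos hα]) hα⟩
  set w : ℝ := ξ₀ / 16 * (2 * (Real.exp (-1) * c)) with hw
  have hw0 : 0 < w := by positivity
  -- the bound on the last, incomplete binding period needs the rate `lam ≤ r`
  obtain ⟨lam', hlam', hlam'l, hlam'r⟩ : ∃ lam' : ℝ, 1 < lam' ∧ lam' ≤ lam ∧ lam' ≤ r :=
    ⟨min lam r, lt_min hlam hr, min_le_left _ _, min_le_right _ _⟩
  have hlam'0 : 0 < lam' := by linarith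
  refine ⟨lam', hlam', max 1 w⁻¹, le_max_left _ _, min c₀ (ξ₀ / 16 * (Real.exp (-1) * c)),
    by positivity, min (min α₀ α₁) 1, by positivity, fun α x hα hα' hx n => ?_⟩
  have hα1 : α ≤ 1 := hα'.le.trans (min_le_right _ _)
  have hαα₀ : α < α₀ := hα'.trans_le ((min_le_left _ _).trans (min_le_left _ _))
  have htδ : thr α < δ := hthrδ α hα (hα'.trans_le ((min_le_left _ _).trans (min_le_right _ _)))
  have ht := thr_pos hα
  have hαt := le_thr hα hα1
  have hD := (hb α hα hα1).2.2.1
  have hDN := (hb α hα hα1).1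
  set N := bindingTime a ξ₀ α with hN
  set A : ℝ := max 1 w⁻¹ * lam' ^ (N + 1) with hA
  have hA1 : 1 ≤ A := one_le_mul_of_one_le_of_one_le (le_max_left _ _) (one_le_pow₀ hlam'.le)
  induction n using Nat.strong_induction_on generalizing x with
  | _ n ih =>
    by_cases hall : ∀ i < n, thr α < |x i|
    · have h1 := (hG α x hα hαα₀ hx n hall).1
      have h2 := vprod_le_tprod α x n
      calc min c₀ (ξ₀ / 16 * (Real.exp (-1) * c)) * α * lam' ^ n
          ≤ c₀ * thr α * lam ^ n := by gcongr; exact min_le_left _ _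
        _ ≤ tprod α x n := h1.trans h2
        _ ≤ _ := le_mul_of_one_le_right (tprod_pos hα x n).le (one_le_pow₀ hA1)
    · push Not at hall
      classical
      obtain ⟨hsn, hst⟩ := Nat.find_spec hall
      have hmin : ∀ i < Nat.find hall, thr α < |x i| := fun i hi => by
        have := Nat.find_min hall hi
        push Not at this
        exact this (hi.trans hsn)
      generalize Nat.find hall = s at hsn hst hmin
      have hv1 : ξ₀ / 16 * lam' ^ s ≤ tprod α x s :=
        le_trans (by gcongr) (((hG α x hα hαα₀ hx s hmin).2 (hst.trans_lt htδ)).trans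
          (vprod_le_tprod α x s))
      have hmem : ∀ i, x (s + (1 + i)) ∈ shadow a α i :=
        pseudo_mem_shadow hα (hx.shift s) le_rfl (by
          have h1 : x s ^ 2 ≤ thr α ^ 2 := by rw [← sq_abs]; gcongr
          have h2 : α ^ (0.2 : ℝ) ≤ 1 := Real.rpow_le_one hα.le hα1 (by norm_num)
          rw [thr_sq hα] at h1
          simp only [add_zero]
          nlinarith)
      have hvz : ∀ k ≤ N, Real.exp (-1) * |critD a k| ≤ tprod α (fun i => x (s + (1 + i))) k :=
        fun k hk => (h.vprod_shadow hα hmem hk).trans (vprod_le_tprod _ _ _)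
      have hone : tprod α (fun i => x (s + i)) 1 = max (2 * |x s|) (2 * α) := by simp [tprod]
      have hone' : 2 * α ≤ tprod α (fun i => x (s + i)) 1 := by
        rw [hone]; exact le_max_right _ _
      have split : ∀ k, tprod α x (s + (1 + k)) = tprod α x s *
          (tprod α (fun i => x (s + i)) 1 * tprod α (fun i => x (s + (1 + i))) k) := by
        intro k
        rw [tprod_add, tprod_add _ _ 1 k]
      by_cases hcase : s + (1 + N) ≤ n
      · obtain ⟨m, rfl⟩ := Nat.exists_eq_add_of_le hcase
        have hi := ih m (by omega) (fun i => x (s + (1 + N) + i)) (hx.shift _)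
        have hcount : returns α (fun i => x (s + (1 + N) + i)) m + 1 ≤
            returns α x (s + (1 + N) + m) := by
          rw [returns_add, returns_add _ _ s, returns_add _ _ 1,
            returns_one_of_le (x := fun i => x (s + i)) hst]
          omega
        have hT : w * lam' ^ s ≤ tprod α x (s + (1 + N)) := by
          rw [split]
          calc w * lam' ^ s = (ξ₀ / 16 * lam' ^ s) * (2 * (Real.exp (-1) * c)) := by
                rw [hw]; ring
            _ ≤ (ξ₀ / 16 * lam' ^ s) * (2 * (Real.exp (-1) * (α * |critD a N|))) := by gcongr
            _ = (ξ₀ / 16 * lam' ^ s) * (2 * α * (Real.exp (-1) * |critD a N|)) := by ring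
            _ ≤ _ := by
                have := tprod_pos hα x s
                have := tprod_pos hα (fun i => x (s + i)) 1
                gcongr
                exact hvz N le_rfl
        have hTA : lam' ^ (s + (1 + N)) ≤ tprod α x (s + (1 + N)) * A := by
          have : 1 ≤ w * max 1 w⁻¹ := by
            calc 1 = w * w⁻¹ := (mul_inv_cancel₀ hw0.ne').symm
              _ ≤ _ := by gcongr; exact le_max_right _ _
          calc lam' ^ (s + (1 + N)) = 1 * (lam' ^ s * lam' ^ (N + 1)) := by
                rw [pow_add, add_comm 1 N, one_mul]
            _ ≤ (w * max 1 w⁻¹) * (lam' ^ s * lam' ^ (N + 1)) := by gcongr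
            _ = (w * lam' ^ s) * A := by rw [hA]; ring
            _ ≤ _ := by gcongr
        calc _ = lam' ^ (s + (1 + N)) *
              (min c₀ (ξ₀ / 16 * (Real.exp (-1) * c)) * α * lam' ^ m) := by rw [pow_add]; ring
          _ ≤ (tprod α x (s + (1 + N)) * A) * (tprod α (fun i => x (s + (1 + N) + i)) m *
                A ^ returns α (fun i => x (s + (1 + N) + i)) m) := by
              have := tprod_pos hα x (s + (1 + N))
              gcongr
          _ = tprod α x (s + (1 + N) + m) *
                A ^ (returns α (fun i => x (s + (1 + N) + i)) m + 1) := by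
              rw [tprod_add α x (s + (1 + N)) m, pow_succ]; ring
          _ ≤ _ := by
              have := tprod_pos hα x (s + (1 + N) + m)
              gcongr
      · obtain ⟨k, rfl⟩ : ∃ k, n = s + (1 + k) := ⟨n - s - 1, by omega⟩
        have hkN : k < N := by omega
        have hT := tprod_pos hα x (s + (1 + k))
        refine le_trans ?_ (le_mul_of_one_le_right hT.le (one_le_pow₀ hA1))
        rw [split]
        have e1 : lam' ^ (s + (1 + k)) = lam' ^ s * (lam' * lam' ^ k) := by
          rw [pow_add, pow_add, pow_one]
        rw [e1]
        calc _ ≤ (ξ₀ / 16 * (Real.exp (-1) * c)) * α * (lam' ^ s * (2 * r ^ k)) := by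
              gcongr
              · exact min_le_right _ _
              · linarith
          _ = (ξ₀ / 16 * lam' ^ s) * (2 * α * (Real.exp (-1) * (c * r ^ k))) := by ring
          _ ≤ (ξ₀ / 16 * lam' ^ s) * (2 * α * (Real.exp (-1) * |critD a k|)) := by
              gcongr; exact hD k
          _ ≤ _ := by
              have := tprod_pos hα x s
              have := tprod_pos hα (fun i => x (s + i)) 1
              gcongr
              exact hvz k hkN.le

end Setting

/-! ### The vertical expansion is weaker than the horizontal one -/

/-- The coordinate `arcsin(x/p)` in which `f` has derivative of modulus less than `2`. -/
def asn (a x : ℝ) : ℝ := Real.arcsin (x / fixPt a)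

namespace Setting

variable {a β ξ₀ : ℝ}

theorem gap_pos (h : Setting a β ξ₀) {x : ℝ} (hx : |x| ≤ β) :
    0 < fixPt a ^ 2 - β ^ 2 ∧ fixPt a ^ 2 - β ^ 2 ≤ fixPt a ^ 2 - x ^ 2 := by
  have h1 := h.beta_lt
  have h2 := h.beta_pos
  have h3 : x ^ 2 ≤ β ^ 2 := by rw [← sq_abs]; gcongr
  constructor
  · nlinarith
  · linarith

/-- In the coordinate `asn` the derivative of `f` on `[-β, β]` is bounded by some `κ < 2`; this is
where `β < p` and `a < 2` enter. The bound persists under small translations of `f`. -/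
theorem exists_kappa (h : Setting a β ξ₀) : ∃ κ : ℝ, 0 < κ ∧ κ < 2 ∧ ∃ α₀ > 0, ∀ s x, |s| ≤ α₀ →
    |x| ≤ β → |quad a x + s| ≤ β ∧
      2 * |x| * Real.sqrt (fixPt a ^ 2 - x ^ 2) ≤
        κ * Real.sqrt (fixPt a ^ 2 - (quad a x + s) ^ 2) := by
  obtain ⟨η, hη, hmar⟩ := h.exists_margin
  have hβ := h.beta_pos
  have hβ2 := h.beta_lt_two
  have hp := h.lt_fix
  have hp2 := h.fix_lt_two
  have hpa : 0 < fixPt a - a := by linarith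
  have hg := (h.gap_pos (x := 0) (by simpa using hβ.le)).1
  set m := fixPt a ^ 2 - β ^ 2
  -- `κ₀²` is the bound at translation `0`; any larger `κ² < 4` leaves room for the translation
  set κs : ℝ := 4 * β ^ 2 / (fixPt a - a + β ^ 2) with hκs
  have hκs0 : 0 < κs := by positivity
  have hκs4 : κs < 4 := by rw [hκs, div_lt_iff₀ (by positivity)]; nlinarith
  set κ : ℝ := Real.sqrt ((κs + 4) / 2) with hκ
  have hκsq : κ ^ 2 = (κs + 4) / 2 := Real.sq_sqrt (by linarith)
  have hκ0 : 0 < κ := Real.sqrt_pos.2 (by linarith)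
  refine ⟨κ, hκ0, ?_, min (min η 1) ((1 - κs / κ ^ 2) * m / 5), ?_, fun s x hs hx => ?_⟩
  · rw [hκ, Real.sqrt_lt' two_pos]; linarith
  · have : κs / κ ^ 2 < 1 := by rw [div_lt_one (by positivity), hκsq]; linarith
    have : 0 < 1 - κs / κ ^ 2 := by linarith
    positivity
  · have hs1 : |s| ≤ η := hs.trans ((min_le_left _ _).trans (min_le_left _ _))
    have hs2 : |s| ≤ 1 := hs.trans ((min_le_left _ _).trans (min_le_right _ _))
    have hs3 : |s| ≤ (1 - κs / κ ^ 2) * m / 5 := hs.trans (min_le_right _ _)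
    have hf := h.quad_le hx
    have hfs : |quad a x + s| ≤ β := by
      have := abs_add_le (quad a x) s
      have := hmar x hx
      linarith
    refine ⟨hfs, ?_⟩
    obtain ⟨g1, g2⟩ := h.gap_pos hx
    obtain ⟨-, g3⟩ := h.gap_pos hf
    have hx2 : x ^ 2 ≤ β ^ 2 := by linarith
    have e : fixPt a ^ 2 - quad a x ^ 2 = (fixPt a - a + x ^ 2) * (fixPt a ^ 2 - x ^ 2) := by
      have := h.fix_sq
      have e1 : fixPt a + quad a x = fixPt a ^ 2 - x ^ 2 := by unfold quad; linarith
      have e2 : fixPt a - quad a x = fixPt a - a + x ^ 2 := by unfold quad; ring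
      rw [← e1, ← e2]; ring
    have i1 : 4 * x ^ 2 ≤ κs * (fixPt a - a + x ^ 2) := by
      rw [hκs, div_mul_eq_mul_div, le_div_iff₀ (by positivity)]
      nlinarith
    have i2 : 4 * x ^ 2 * (fixPt a ^ 2 - x ^ 2) ≤ κs * (fixPt a ^ 2 - quad a x ^ 2) := by
      rw [e, ← mul_assoc]
      gcongr
      linarith
    have i3 : κs / κ ^ 2 * (fixPt a ^ 2 - quad a x ^ 2) ≤
        fixPt a ^ 2 - (quad a x + s) ^ 2 := by
      have t1 : 2 * quad a x * s + s ^ 2 ≤ 5 * |s| := by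
        have : quad a x * s ≤ 2 * |s| := by
          calc quad a x * s ≤ |quad a x * s| := le_abs_self _
            _ = |quad a x| * |s| := abs_mul _ _
            _ ≤ _ := by gcongr; linarith
        have : s ^ 2 ≤ |s| := by rw [← sq_abs]; nlinarith [abs_nonneg s]
        linarith
      have t2 : (1 - κs / κ ^ 2) * m ≤ (1 - κs / κ ^ 2) * (fixPt a ^ 2 - quad a x ^ 2) := by
        have : κs / κ ^ 2 < 1 := by rw [div_lt_one (by positivity), hκsq]; linarith
        gcongr
      nlinarith
    have i4 : 4 * x ^ 2 * (fixPt a ^ 2 - x ^ 2) ≤ κ ^ 2 * (fixPt a ^ 2 - (quad a x + s) ^ 2) := by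
      refine i2.trans ?_
      have : κ ^ 2 * (κs / κ ^ 2 * (fixPt a ^ 2 - quad a x ^ 2)) =
          κs * (fixPt a ^ 2 - quad a x ^ 2) := by field_simp
      rw [← this]; gcongr
    have i5 := Real.sqrt_le_sqrt i4
    rw [Real.sqrt_mul (show 0 ≤ 4 * x ^ 2 by positivity), Real.sqrt_mul (sq_nonneg κ),
      Real.sqrt_sq hκ0.le] at i5
    have : Real.sqrt (4 * x ^ 2) = 2 * |x| := by
      rw [show 4 * x ^ 2 = (2 * |x|) ^ 2 by rw [mul_pow, sq_abs]; norm_num]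
      exact Real.sqrt_sq (by positivity)
    rwa [this] at i5

theorem hasDerivAt_asn (h : Setting a β ξ₀) {x : ℝ} (hx : |x| ≤ β) :
    HasDerivAt (asn a) (1 / Real.sqrt (fixPt a ^ 2 - x ^ 2)) x := by
  have hp : 0 < fixPt a := by linarith [h.one_lt_fix]
  have hlt := abs_lt.1 (h.abs_lt_fix hx)
  have h1 : x / fixPt a ≠ -1 := by
    intro e; rw [div_eq_iff hp.ne'] at e; linarith [hlt.1]
  have h2 : x / fixPt a ≠ 1 := by
    intro e; rw [div_eq_iff hp.ne'] at e; linarith [hlt.2]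
  have h3 := (Real.hasDerivAt_arcsin h1 h2).comp x ((hasDerivAt_id x).div_const (fixPt a))
  have h4 : HasDerivAt (asn a) (1 / Real.sqrt (1 - (x / fixPt a) ^ 2) * (1 / fixPt a)) x := h3
  refine h4.congr_deriv ?_
  have e : 1 - (x / fixPt a) ^ 2 = (fixPt a ^ 2 - x ^ 2) / fixPt a ^ 2 := by
    field_simp
  rw [e, Real.sqrt_div' _ (by positivity), Real.sqrt_sq hp.le]
  field_simp

/-- `asn` is bi-Lipschitz on `[-β, β]`. -/
theorem asn_bilipschitz (h : Setting a β ξ₀) : ∃ L > 0, ∀ x y, |x| ≤ β → |y| ≤ β →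
    |asn a x - asn a y| ≤ L * |x - y| ∧ |x - y| ≤ 2 * |asn a x - asn a y| := by
  have hp : 0 < fixPt a := by linarith [h.one_lt_fix]
  have hg := (h.gap_pos (x := 0) (by simpa using h.beta_pos.le)).1
  refine ⟨1 / Real.sqrt (fixPt a ^ 2 - β ^ 2), by positivity, fun x y hx hy => ⟨?_, ?_⟩⟩
  · refine (convex_Icc (-β) β).norm_image_sub_le_of_norm_hasDerivWithin_le (f := asn a)
      (f' := fun x => 1 / Real.sqrt (fixPt a ^ 2 - x ^ 2))
      (fun z hz => (h.hasDerivAt_asn (abs_le.2 hz)).hasDerivWithinAt) (fun z hz => ?_)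
      (abs_le.1 hy) (abs_le.1 hx)
    rw [Real.norm_of_nonneg (by positivity)]
    obtain ⟨-, g2⟩ := h.gap_pos (abs_le.2 hz)
    exact one_div_le_one_div_of_le (Real.sqrt_pos.2 hg) (Real.sqrt_le_sqrt g2)
  · have key : ∀ z, |z| ≤ β → fixPt a * Real.sin (asn a z) = z := by
      intro z hz
      have hlt := abs_lt.1 (h.abs_lt_fix hz)
      rw [asn, Real.sin_arcsin, mul_div_cancel₀ _ hp.ne']
      · rw [le_div_iff₀ hp]; linarith [hlt.1]
      · rw [div_le_iff₀ hp]; linarith [hlt.2]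
    have hs : |Real.sin (asn a x) - Real.sin (asn a y)| ≤ |asn a x - asn a y| := by
      have := Real.lipschitzWith_sin.dist_le_mul (asn a x) (asn a y)
      simpa [Real.dist_eq] using this
    calc |x - y| = fixPt a * |Real.sin (asn a x) - Real.sin (asn a y)| := by
          nth_rewrite 1 [← key x hx, ← key y hy]
          rw [← mul_sub, abs_mul, abs_of_pos hp]
      _ ≤ 2 * |asn a x - asn a y| := by
          gcongr; exact h.fix_lt_two.le

theorem asn_quad_le (h : Setting a β ξ₀) : ∃ κ : ℝ, 0 < κ ∧ κ < 2 ∧ ∃ α₀ > 0, ∀ s, |s| ≤ α₀ →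
    (∀ x, |x| ≤ β → |quad a x + s| ≤ β) ∧
      ∀ x y, |x| ≤ β → |y| ≤ β →
        |asn a (quad a x + s) - asn a (quad a y + s)| ≤ κ * |asn a x - asn a y| := by
  obtain ⟨κ, hκ, hκ2, α₀, hα₀, hk⟩ := h.exists_kappa
  refine ⟨κ, hκ, hκ2, α₀, hα₀, fun s hs => ⟨fun x hx => (hk s x hs hx).1, ?_⟩⟩
  have hd : ∀ x, |x| ≤ β → HasDerivAt (fun x => asn a (quad a x + s))
      (1 / Real.sqrt (fixPt a ^ 2 - (quad a x + s) ^ 2) * (-2 * x)) x := by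
    intro x hx
    have h1 := h.hasDerivAt_asn (hk s x hs hx).1
    have h2 : HasDerivAt (fun x => quad a x + s) (-2 * x) x := by
      refine (((hasDerivAt_pow 2 x).const_sub a).add_const s).congr_deriv ?_
      simp
    exact HasDerivAt.comp (h₂ := asn a) x h1 h2
  have hbd : ∀ x, |x| ≤ β → |1 / Real.sqrt (fixPt a ^ 2 - (quad a x + s) ^ 2) * (-2 * x)| ≤
      κ * (1 / Real.sqrt (fixPt a ^ 2 - x ^ 2)) := by
    intro x hx
    obtain ⟨h1, h2⟩ := hk s x hs hx
    obtain ⟨g1, g2⟩ := h.gap_pos hx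
    obtain ⟨-, g3⟩ := h.gap_pos h1
    have p1 : 0 < Real.sqrt (fixPt a ^ 2 - x ^ 2) := Real.sqrt_pos.2 (by linarith)
    have p2 : 0 < Real.sqrt (fixPt a ^ 2 - (quad a x + s) ^ 2) := Real.sqrt_pos.2 (by linarith)
    rw [abs_mul, abs_of_pos (by positivity), abs_mul, abs_neg, abs_two, mul_one_div,
      one_div_mul_eq_div, div_le_div_iff₀ p2 p1]
    exact h2
  have hmono : ∀ σ : ℝ, |σ| = 1 →
      MonotoneOn (fun x => κ * asn a x + σ * asn a (quad a x + s)) (Icc (-β) β) := by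
    intro σ hσ
    have hD : ∀ x ∈ Icc (-β) β, HasDerivAt
        (fun x => κ * asn a x + σ * asn a (quad a x + s))
        (κ * (1 / Real.sqrt (fixPt a ^ 2 - x ^ 2)) +
          σ * (1 / Real.sqrt (fixPt a ^ 2 - (quad a x + s) ^ 2) * (-2 * x))) x := fun x hx =>
      ((h.hasDerivAt_asn (abs_le.2 hx)).const_mul κ).add ((hd x (abs_le.2 hx)).const_mul σ)
    refine monotoneOn_of_deriv_nonneg (convex_Icc _ _)
      (fun x hx => (hD x hx).continuousAt.continuousWithinAt)
      (fun x hx => (hD x (interior_subset hx)).differentiableAt.differentiableWithinAt)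
      fun x hx => ?_
    have hx' := interior_subset hx
    rw [(hD x hx').deriv]
    have h1 := hbd x (abs_le.2 hx')
    have h2 := neg_abs_le (σ * (1 / Real.sqrt (fixPt a ^ 2 - (quad a x + s) ^ 2) * (-2 * x)))
    rw [abs_mul, hσ, one_mul] at h2
    linarith
  intro x y hx hy
  wlog hxy : y ≤ x generalizing x y
  · rw [abs_sub_comm, abs_sub_comm (asn a x)]
    exact this y x hy hx (le_of_not_ge hxy)
  have m1 := hmono 1 (by simp) (abs_le.1 hy) (abs_le.1 hx) hxy
  have m2 := hmono (-1) (by simp) (abs_le.1 hy) (abs_le.1 hx) hxy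
  simp only at m1 m2
  have m3 := le_abs_self (asn a x - asn a y)
  rw [abs_le]
  constructor <;> nlinarith

/-- Along orbits of `f` in `[-β, β]` the derivative grows at a rate less than `2`. -/
theorem vprod_orb_le (h : Setting a β ξ₀) : ∃ κ : ℝ, 0 < κ ∧ κ < 2 ∧ ∃ C > 0, ∀ x, |x| ≤ β →
    ∀ n, vprod (orb a x) n ≤ C * κ ^ n := by
  obtain ⟨κ, hκ, hκ2, α₀, hα₀, hk⟩ := h.exists_kappa
  have hg := (h.gap_pos (x := 0) (by simpa using h.beta_pos.le)).1
  have hp : 0 < fixPt a := by linarith [h.one_lt_fix]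
  refine ⟨κ, hκ, hκ2, fixPt a / Real.sqrt (fixPt a ^ 2 - β ^ 2), by positivity, fun x hx n => ?_⟩
  have key : vprod (orb a x) n * Real.sqrt (fixPt a ^ 2 - x ^ 2) ≤
      κ ^ n * Real.sqrt (fixPt a ^ 2 - orb a x n ^ 2) := by
    induction n with
    | zero => simp [vprod_zero, orb_zero]
    | succ n ih =>
      have h1 := (hk 0 (orb a x n) (by simpa using hα₀.le) (h.orb_le hx n)).2
      rw [add_zero] at h1
      rw [vprod_succ, orb_succ, pow_succ]
      calc vprod (orb a x) n * (2 * |orb a x n|) * Real.sqrt (fixPt a ^ 2 - x ^ 2)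
          = vprod (orb a x) n * Real.sqrt (fixPt a ^ 2 - x ^ 2) * (2 * |orb a x n|) :=
            mul_right_comm _ _ _
        _ ≤ κ ^ n * Real.sqrt (fixPt a ^ 2 - orb a x n ^ 2) * (2 * |orb a x n|) := by gcongr
        _ = κ ^ n * (2 * |orb a x n| * Real.sqrt (fixPt a ^ 2 - orb a x n ^ 2)) := by ring
        _ ≤ κ ^ n * (κ * Real.sqrt (fixPt a ^ 2 - quad a (orb a x n) ^ 2)) := by gcongr
        _ = _ := (mul_assoc _ _ _).symm
  have h2 : Real.sqrt (fixPt a ^ 2 - β ^ 2) ≤ Real.sqrt (fixPt a ^ 2 - x ^ 2) :=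
    Real.sqrt_le_sqrt (h.gap_pos hx).2
  have h3 : Real.sqrt (fixPt a ^ 2 - orb a x n ^ 2) ≤ fixPt a := by
    rw [Real.sqrt_le_left hp.le]; nlinarith [sq_nonneg (orb a x n)]
  have hs := Real.sqrt_pos.2 hg
  have hv := vprod_nonneg (orb a x) n
  rw [div_mul_eq_mul_div, le_div_iff₀ hs]
  calc _ ≤ vprod (orb a x) n * Real.sqrt (fixPt a ^ 2 - x ^ 2) := by gcongr
    _ ≤ _ := key
    _ ≤ κ ^ n * fixPt a := by gcongr
    _ = _ := mul_comm _ _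

end Setting

/-! ### Fibre maps -/

theorem skew_iterate_fst (a : ℝ) (d : ℕ) (φ : UnitAddCircle → ℝ) (α : ℝ) (n : ℕ)
    (z : UnitAddCircle × ℝ) : ((skew a d φ α)^[n] z).1 = d ^ n • z.1 := by
  induction n with
  | zero => simp
  | succ n ih => rw [Function.iterate_succ_apply', skew, ih, smul_smul, pow_succ']

theorem fib_zero (a : ℝ) (d : ℕ) (φ : UnitAddCircle → ℝ) (α : ℝ) (θ : UnitAddCircle) (x : ℝ) :
    fib a d φ α 0 θ x = x := rfl

theorem fib_succ (a : ℝ) (d : ℕ) (φ : UnitAddCircle → ℝ) (α : ℝ) (n : ℕ) (θ : UnitAddCircle)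
    (x : ℝ) : fib a d φ α (n + 1) θ x = quad a (fib a d φ α n θ x) + α * φ (d ^ n • θ) := by
  rw [fib, Function.iterate_succ_apply', skew, skew_iterate_fst]; rfl

theorem fib_add (a : ℝ) (d : ℕ) (φ : UnitAddCircle → ℝ) (α : ℝ) (m n : ℕ) (θ : UnitAddCircle)
    (x : ℝ) : fib a d φ α (m + n) θ x = fib a d φ α n (d ^ m • θ) (fib a d φ α m θ x) := by
  rw [fib, add_comm, Function.iterate_add_apply, fib, fib, ← skew_iterate_fst a d φ α m (θ, x)]

theorem coe_pow_smul (d n : ℕ) (t : ℝ) :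
    d ^ n • (t : UnitAddCircle) = (((d : ℝ) ^ n * t : ℝ) : UnitAddCircle) := by
  rw [← AddCircle.coe_nsmul]; simp

/-- The fibre orbit of `(θ, x)`. -/
def fibOrb (a : ℝ) (d : ℕ) (φ : UnitAddCircle → ℝ) (α : ℝ) (x : ℝ) (θ : UnitAddCircle) (n : ℕ) :
    ℝ := fib a d φ α n θ x

theorem exists_lipschitz {φ : UnitAddCircle → ℝ} (hφ : IsRealAnalytic φ) :
    ∃ K > 0, ∀ t t' : ℝ, |φ (t : UnitAddCircle) - φ (t' : UnitAddCircle)| ≤ K * |t - t'| := by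
  set ψ : ℝ → ℝ := fun t => φ (t : UnitAddCircle) with hψ
  have hd : Differentiable ℝ ψ := fun t => (hφ t (mem_univ t)).differentiableAt
  have hc : Continuous (deriv ψ) := by
    rw [← continuousOn_univ]; exact hφ.deriv.continuousOn
  have hper : ∀ (t : ℝ) (k : ℤ), deriv ψ (t + k) = deriv ψ t := by
    intro t k
    rw [← deriv_comp_add_const]
    congr 1
    funext s
    simp [hψ]
  obtain ⟨C, hC⟩ := (isCompact_Icc (a := (0 : ℝ)) (b := 1)).exists_bound_of_continuousOn
    hc.continuousOn
  refine ⟨max C 1, by positivity, fun t t' => ?_⟩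
  have hb : ∀ s, ‖deriv ψ s‖ ≤ max C 1 := by
    intro s
    have h1 := hC (Int.fract s) ⟨Int.fract_nonneg s, (Int.fract_lt_one s).le⟩
    rw [← hper _ ⌊s⌋, Int.fract_add_floor] at h1
    exact h1.trans (le_max_left _ _)
  have := (convex_univ (𝕜 := ℝ) (E := ℝ)).norm_image_sub_le_of_norm_deriv_le
    (fun x _ => hd x) (fun x _ => hb x) (mem_univ t') (mem_univ t)
  simpa [Real.norm_eq_abs] using this

namespace Setting

variable {a β ξ₀ : ℝ}

theorem isPseudo_fibOrb (h : Setting a β ξ₀) : ∃ α₀ > 0, ∀ α, 0 < α → α < α₀ →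
    ∀ (d : ℕ) (φ : UnitAddCircle → ℝ), (∀ θ, |φ θ| ≤ 1) → ∀ x, |x| ≤ β → ∀ θ,
      IsPseudo a β α (fibOrb a d φ α x θ) := by
  obtain ⟨η, hη, hmar⟩ := h.exists_margin
  refine ⟨η, hη, fun α hα hαη d φ hφ x hx θ => ?_⟩
  have hn : ∀ n : ℕ, |α * φ (d ^ n • θ)| ≤ α := fun n => by
    rw [abs_mul, abs_of_pos hα]
    exact mul_le_of_le_one_right hα.le (hφ _)
  have hb : ∀ n, |fibOrb a d φ α x θ n| ≤ β := by
    intro n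
    induction n with
    | zero => exact hx
    | succ n ih =>
      unfold fibOrb at *
      rw [fib_succ]
      have := abs_add_le (quad a (fib a d φ α n θ x)) (α * φ (d ^ n • θ))
      linarith [hmar _ ih, hn n]
  refine fun n => ⟨hb n, ?_⟩
  unfold fibOrb
  rw [fib_succ, add_sub_cancel_left]
  exact hn n

/-- Images of horizontal curves are nearly horizontal: over a cell of level `n` they oscillate by
at most a constant times `α`. -/
theorem fibOrb_lipschitz (h : Setting a β ξ₀) {d : ℕ} (hd : 2 ≤ d) {φ : UnitAddCircle → ℝ}
    (hφ : IsRealAnalytic φ) (hφ1 : ∀ θ, |φ θ| ≤ 1) :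
    ∃ K > 0, ∃ α₀ > 0, ∀ α, 0 < α → α < α₀ → ∀ x, |x| ≤ β → ∀ (n : ℕ) (t t' : ℝ),
      |fibOrb a d φ α x t n - fibOrb a d φ α x t' n| ≤ K * α * (d ^ n * |t - t'|) := by
  obtain ⟨κ, hκ, hκ2, α₁, hα₁, hk⟩ := h.asn_quad_le
  obtain ⟨L, hL, hbil⟩ := h.asn_bilipschitz
  obtain ⟨Kφ, hKφ, hlip⟩ := exists_lipschitz hφ
  obtain ⟨α₂, hα₂, hps⟩ := h.isPseudo_fibOrb
  have hdr : (2 : ℝ) ≤ d := by exact_mod_cast hd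
  have hκd : 0 < 2 - κ := by linarith
  set K₁ : ℝ := L * Kφ / (2 - κ) with hK₁
  have hK₁0 : 0 < K₁ := by positivity
  refine ⟨2 * K₁, by positivity, min α₁ α₂, by positivity, fun α hα hα' x hx n t t' => ?_⟩
  have hP := hps α hα (hα'.trans_le (min_le_right _ _)) d φ hφ1 x hx
  have key : |asn a (fibOrb a d φ α x t n) - asn a (fibOrb a d φ α x t' n)| ≤
      K₁ * α * (d ^ n * |t - t'|) := by
    induction n with
    | zero =>
      simp only [fibOrb, fib_zero, sub_self, abs_zero, pow_zero, one_mul]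
      positivity
    | succ n ih =>
      have b1 := (hP (t : UnitAddCircle) n).1
      have b2 := (hP (t' : UnitAddCircle) n).1
      have b3 := (hP (t' : UnitAddCircle) (n + 1)).1
      unfold fibOrb at *
      rw [fib_succ] at b3
      rw [fib_succ, fib_succ]
      set u := fib a d φ α n (t : UnitAddCircle) x
      set v := fib a d φ α n (t' : UnitAddCircle) x
      set s := α * φ (d ^ n • (t : UnitAddCircle)) with hs
      set s' := α * φ (d ^ n • (t' : UnitAddCircle)) with hs'
      have hsα : |s| ≤ α₁ := by
        rw [hs, abs_mul, abs_of_pos hα]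
        exact (mul_le_of_le_one_right hα.le (hφ1 _)).trans (hα'.le.trans (min_le_left _ _))
      obtain ⟨k1, k2⟩ := hk s hsα
      have i1 := k2 u v b1 b2
      have i2 := (hbil (quad a v + s) (quad a v + s') (k1 v b2) b3).1
      have i3 : |quad a v + s - (quad a v + s')| ≤ α * (Kφ * (d ^ n * |t - t'|)) := by
        have e : quad a v + s - (quad a v + s') = α * (φ (d ^ n • (t : UnitAddCircle)) -
            φ (d ^ n • (t' : UnitAddCircle))) := by rw [hs, hs']; ring
        rw [e, abs_mul, abs_of_pos hα, coe_pow_smul, coe_pow_smul]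
        gcongr
        refine (hlip _ _).trans (le_of_eq ?_)
        rw [← mul_sub, abs_mul, abs_of_nonneg (by positivity)]
      have i4 := abs_sub_le (asn a (quad a u + s)) (asn a (quad a v + s)) (asn a (quad a v + s'))
      set w : ℝ := α * (d ^ n * |t - t'|) with hw
      have hw0 : 0 ≤ w := by positivity
      have i5 : L * |quad a v + s - (quad a v + s')| ≤ (2 - κ) * K₁ * w := by
        calc _ ≤ L * (α * (Kφ * (d ^ n * |t - t'|))) := by gcongr
          _ = (2 - κ) * K₁ * w := by rw [hK₁, hw]; field_simp
      have i6 : κ * |asn a u - asn a v| ≤ κ * (K₁ * w) := by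
        gcongr
        exact ih.trans (le_of_eq (by rw [hw]; ring))
      calc _ ≤ κ * (K₁ * w) + (2 - κ) * K₁ * w := by linarith
        _ = 2 * (K₁ * w) := by ring
        _ ≤ d * (K₁ * w) := by gcongr
        _ = _ := by rw [hw, pow_succ]; ring
  have := (hbil _ _ (hP (t : UnitAddCircle) n).1 (hP (t' : UnitAddCircle) n).1).2
  linarith

end Setting

/-! ### Rigidity of analytic cohomological equations -/

/-- A continuous periodic solution of `Ψ(t) = P(t) + Λ⁻¹ Ψ(bt)` with `1 < |Λ| < b` and `P` analytic
is analytic as soon as it is Lipschitz at `0` from the right: near `0` it must then coincide with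
the solution in power series, and the equation spreads analyticity to the whole line. -/
theorem analytic_of_cohomological {P Ψ : ℝ → ℝ} {Λ b C : ℝ} (hP : AnalyticOnNhd ℝ P univ)
    (hper : ∀ (t : ℝ) (k : ℤ), Ψ (t + k) = Ψ t) (hΛ1 : 1 < |Λ|) (hΛb : |Λ| < b)
    (heq : ∀ t, Ψ t = P t + Λ⁻¹ * Ψ (b * t))
    (hlip : ∀ s, 0 ≤ s → s < 1 → |Ψ s - Ψ 0| ≤ C * s) : AnalyticOnNhd ℝ Ψ univ := by
  have hb1 : 1 < b := hΛ1.trans hΛb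
  have hb0 : 0 < b := by linarith
  have hΛ0 : Λ ≠ 0 := by rintro rfl; simp at hΛ1; linarith
  obtain ⟨p, R, hp⟩ := hP 0 (mem_univ 0)
  -- the formal solution
  have hfac : ∀ n : ℕ, min (|Λ| - 1) (b - |Λ|) ≤ |Λ - b ^ n| := by
    intro n
    rcases Nat.eq_zero_or_pos n with rfl | hn
    · refine (min_le_left _ _).trans ?_
      have := abs_sub_abs_le_abs_sub Λ (b ^ 0)
      simpa using this
    · refine (min_le_right _ _).trans ?_
      have h1 := abs_sub_abs_le_abs_sub (b ^ n) Λ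
      rw [abs_sub_comm, abs_of_pos (pow_pos hb0 n)] at h1
      have h2 : b ≤ b ^ n := le_self_pow₀ hb1.le (by omega)
      linarith
  have hm0 : 0 < min (|Λ| - 1) (b - |Λ|) := lt_min (by linarith) (by linarith)
  have hne : ∀ n : ℕ, Λ - b ^ n ≠ 0 := fun n => abs_pos.1 (hm0.trans_le (hfac n))
  set m := min (|Λ| - 1) (b - |Λ|) with hm
  set q : FormalMultilinearSeries ℝ ℝ ℝ := fun n => (Λ / (Λ - b ^ n)) • p n with hq
  have hrad : R ≤ q.radius := by
    refine hp.r_le.trans (ENNReal.le_of_forall_nnreal_lt fun r hr => ?_)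
    obtain ⟨C', hC', hbd⟩ := p.norm_mul_pow_le_of_lt_radius hr
    refine q.le_radius_of_bound (|Λ| / m * C') fun n => ?_
    rw [hq]
    simp only [norm_smul, Real.norm_eq_abs, abs_div]
    rw [mul_assoc]
    have := hbd n
    have := hfac n
    gcongr
  have hq' := (q.hasFPowerSeriesOnBall (hp.r_pos.trans_le hrad)).mono hp.r_pos hrad
  set G := q.sum with hG
  -- a radius on which all series converge
  obtain ⟨ρ, hρ0, hρR⟩ : ∃ ρ : NNReal, 0 < ρ ∧ (ρ : ENNReal) < R := by
    obtain ⟨ρ, h1, h2⟩ := ENNReal.lt_iff_exists_nnreal_btwn.1 hp.r_pos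
    exact ⟨ρ, by exact_mod_cast h1, h2⟩
  have hball : ∀ y : ℝ, |y| < ρ → y ∈ Metric.eball (0 : ℝ) R := by
    intro y hy
    rw [Metric.mem_eball, edist_dist, Real.dist_eq, sub_zero]
    refine lt_trans ?_ hρR
    rw [ENNReal.ofReal_lt_coe_iff (abs_nonneg y)]
    exact hy
  have hρ' : (0 : ℝ) < ρ := by exact_mod_cast hρ0
  have hGeq : ∀ s : ℝ, |s| < ρ → G s = Λ * (G (s / b) - P (s / b)) := by
    intro s hs
    have hsb : |s / b| < ρ := by
      rw [abs_div, abs_of_pos hb0]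
      exact (div_le_self (abs_nonneg s) hb1.le).trans_lt hs
    have h1 := hq'.hasSum (hball s hs)
    have h2 := (hq'.hasSum (hball _ hsb)).sub (hp.hasSum (hball _ hsb))
    have h3 := h2.mul_left Λ
    rw [zero_add] at h1
    simp only [zero_add] at h3
    have hterm : ∀ n : ℕ, (q n fun _ => s) =
        Λ * ((q n fun _ => s / b) - p n fun _ => s / b) := by
      intro n
      have e0 : ∀ z : Fin n → ℝ, q n z = (Λ / (Λ - b ^ n)) * p n z := fun z => rfl
      rw [e0, e0]
      have e1 : (p n fun _ => s) = s ^ n * p n 1 := by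
        have := p.apply_eq_pow_smul_coeff (n := n) (z := s); rwa [smul_eq_mul] at this
      have e2 : (p n fun _ => s / b) = (s / b) ^ n * p n 1 := by
        have := p.apply_eq_pow_smul_coeff (n := n) (z := s / b); rwa [smul_eq_mul] at this
      rw [e1, e2, div_pow]
      have := hne n
      field_simp
      ring
    simp only [hterm] at h1
    exact h1.unique h3
  have hGan : AnalyticOnNhd ℝ G (Metric.eball 0 R) := hq'.analyticOnNhd
  have hΨeq : ∀ s, Ψ s = Λ * (Ψ (s / b) - P (s / b)) := by
    intro s
    rw [heq (s / b), mul_div_cancel₀ s hb0.ne']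
    field_simp
    ring
  set u : ℝ → ℝ := fun s => Ψ s - G s with hu
  have hueq : ∀ s : ℝ, |s| < ρ → u s = Λ * u (s / b) := by
    intro s hs
    simp only [hu]
    rw [hΨeq s, hGeq s hs]; ring
  have hu0 : u 0 = 0 := by
    have h1 := hueq 0 (by simpa using hρ')
    rw [zero_div] at h1
    have h2 : (Λ - 1) * u 0 = 0 := by linarith
    rcases mul_eq_zero.1 h2 with h3 | h3
    · have := hne 0; rw [pow_zero] at this; exact absurd h3 this
    · exact h3
  -- `u` is Lipschitz at `0` from the right
  obtain ⟨C₁, s₁, hs₁, hs₁ρ, huC⟩ : ∃ C₁ s₁ : ℝ, 0 < s₁ ∧ s₁ ≤ ρ ∧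
      ∀ s, 0 ≤ s → s < s₁ → |u s| ≤ C₁ * s := by
    have hd := (hGan 0 (hball 0 (by simpa using hρ'))).differentiableAt.isBigO_sub
    obtain ⟨C₂, hC₂⟩ := hd.bound
    rw [Metric.eventually_nhds_iff] at hC₂
    obtain ⟨ε, hε, hC₂⟩ := hC₂
    refine ⟨C + C₂, min (min ε 1) ρ, by positivity, min_le_right _ _, fun s hs hs' => ?_⟩
    have h1 := hlip s hs (hs'.trans_le ((min_le_left _ _).trans (min_le_right _ _)))
    have h2 := hC₂ (y := s) (by
      rw [Real.dist_eq, sub_zero, abs_of_nonneg hs]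
      exact hs'.trans_le ((min_le_left _ _).trans (min_le_left _ _)))
    simp only [sub_zero, Real.norm_eq_abs, abs_of_nonneg hs] at h2
    have e : u s = (Ψ s - Ψ 0) - (G s - G 0) := by
      have : Ψ 0 = G 0 := sub_eq_zero.1 hu0
      simp only [hu]; rw [this]; ring
    rw [e]
    refine (abs_sub _ _).trans ?_
    linarith
  have huz : ∀ s, 0 ≤ s → s < s₁ → u s = 0 := by
    intro s hs hs'
    have hit : ∀ J : ℕ, |u s| ≤ C₁ * s * (|Λ| / b) ^ J := by
      intro J
      have h1 : ∀ J : ℕ, u s = Λ ^ J * u (s / b ^ J) := by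
        intro J
        induction J with
        | zero => simp
        | succ J ih =>
          have hle : s / b ^ J ≤ s := div_le_self hs (one_le_pow₀ hb1.le)
          rw [ih, hueq (s / b ^ J) (by rw [abs_of_nonneg (by positivity)]; linarith), pow_succ,
            div_div, pow_succ]
          ring
      have hle : s / b ^ J ≤ s := div_le_self hs (one_le_pow₀ hb1.le)
      have h2 := huC (s / b ^ J) (by positivity) (by linarith)
      rw [h1 J, abs_mul, abs_pow]
      calc |Λ| ^ J * |u (s / b ^ J)| ≤ |Λ| ^ J * (C₁ * (s / b ^ J)) := by gcongr
        _ = _ := by rw [div_pow]; ring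
    have hlim : Tendsto (fun J : ℕ => C₁ * s * (|Λ| / b) ^ J) atTop (nhds (C₁ * s * 0)) :=
      (tendsto_pow_atTop_nhds_zero_of_lt_one (by positivity)
        ((div_lt_one hb0).2 hΛb)).const_mul _
    rw [mul_zero] at hlim
    exact abs_nonpos_iff.1 (ge_of_tendsto' hlim hit)
  have hloc : ∀ s, 0 < s → s < s₁ → AnalyticAt ℝ Ψ s := by
    intro s hs hs'
    refine (hGan s (hball s (by rw [abs_of_pos hs]; linarith))).congr ?_
    filter_upwards [Ioo_mem_nhds hs hs'] with y hy
    have := huz y hy.1.le hy.2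
    simp only [hu] at this
    linarith
  have hspread : ∀ (J : ℕ) (s : ℝ), 0 < s → s < s₁ * b ^ J → AnalyticAt ℝ Ψ s := by
    intro J
    induction J with
    | zero => intro s hs hs'; exact hloc s hs (by simpa using hs')
    | succ J ih =>
      intro s hs hs'
      have h1 := ih (s / b) (by positivity) (by
        rw [div_lt_iff₀ hb0]; rw [pow_succ] at hs'; linarith)
      have hdiv : AnalyticAt ℝ (fun y : ℝ => y / b) s := analyticAt_id.div_const
      have h2 : AnalyticAt ℝ (fun y => Λ * (Ψ (y / b) - P (y / b))) s :=
        analyticAt_const.mul ((AnalyticAt.comp_of_eq (g := Ψ) h1 hdiv rfl).sub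
          (AnalyticAt.comp_of_eq (g := P) (hP (s / b) (mem_univ _)) hdiv rfl))
      exact h2.congr (Eventually.of_forall fun y => (hΨeq y).symm)
  have hpos : ∀ s, 0 < s → AnalyticAt ℝ Ψ s := by
    intro s hs
    obtain ⟨J, hJ⟩ := ((tendsto_pow_atTop_atTop_of_one_lt hb1).eventually_gt_atTop (s / s₁)).exists
    rw [div_lt_iff₀ hs₁] at hJ
    exact hspread J s hs (by linarith)
  intro t _
  obtain ⟨k, hk⟩ := exists_nat_gt (-t)
  have h1 := hpos (t + k) (by linarith)
  have hadd : AnalyticAt ℝ (fun y : ℝ => y + k) t := analyticAt_id.add analyticAt_const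
  have h2 : AnalyticAt ℝ (fun y => Ψ (y + k)) t := AnalyticAt.comp_of_eq h1 hadd rfl
  refine h2.congr (Eventually.of_forall fun y => ?_)
  have := hper y k
  simpa using this

/-! ### The linear response of the critical orbit -/

/-- The series `∑_i (D_n / D_{n+i}) φ(dⁱt)`. For `n = 0` it is the derivative at `α = 0` of the
normalised perturbation of the critical orbit; its tails are the values at other `n`. -/
def osum (a : ℝ) (d : ℕ) (φ : UnitAddCircle → ℝ) (n : ℕ) (t : ℝ) : ℝ :=
  ∑' i : ℕ, critD a n / critD a (n + i) * φ (((d : ℝ) ^ i * t : ℝ) : UnitAddCircle)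

theorem phi_add_int (φ : UnitAddCircle → ℝ) (t : ℝ) (k : ℤ) :
    φ ((t + k : ℝ) : UnitAddCircle) = φ (t : UnitAddCircle) := by
  simp

theorem osum_add_int (a : ℝ) (d : ℕ) (φ : UnitAddCircle → ℝ) (n : ℕ) (t : ℝ) (k : ℤ) :
    osum a d φ n (t + k) = osum a d φ n t := by
  unfold osum
  congr 1
  funext i
  have : (d : ℝ) ^ i * (t + k) = (d : ℝ) ^ i * t + ((d ^ i * k : ℤ) : ℝ) := by push_cast; ring
  rw [this, phi_add_int φ]

namespace Setting

variable {a β ξ₀ : ℝ}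

/-- The coefficients of the series decay geometrically. -/
theorem exists_coeff_bound (h : Setting a β ξ₀) : ∃ C > 0, ∃ r : ℝ, 0 < r ∧ r < 1 ∧
    ∀ n i : ℕ, |critD a n / critD a (n + i)| ≤ C * r ^ i := by
  obtain ⟨r, hr, c, hc, hgrow⟩ := h.critD_growth
  have hr0 : 0 < r := by linarith
  refine ⟨c⁻¹, by positivity, r⁻¹, by positivity, inv_lt_one_of_one_lt₀ hr, fun n i => ?_⟩
  rw [abs_div, div_le_iff₀ (h.abs_critD_pos _)]
  have := hgrow n i
  calc |critD a n| = c⁻¹ * r⁻¹ ^ i * (c * r ^ i * |critD a n|) := by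
        rw [inv_pow]; field_simp
    _ ≤ _ := by gcongr

theorem osum_term_le (h : Setting a β ξ₀) {φ : UnitAddCircle → ℝ} (hφ1 : ∀ θ, |φ θ| ≤ 1) :
    ∃ C > 0, ∃ r : ℝ, 0 < r ∧ r < 1 ∧ ∀ (d n i : ℕ) (t : ℝ),
      ‖critD a n / critD a (n + i) * φ (((d : ℝ) ^ i * t : ℝ) : UnitAddCircle)‖ ≤ C * r ^ i := by
  obtain ⟨C, hC, r, hr, hr1, hb⟩ := h.exists_coeff_bound
  refine ⟨C, hC, r, hr, hr1, fun d n i t => ?_⟩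
  rw [Real.norm_eq_abs, abs_mul]
  calc _ ≤ C * r ^ i * 1 := by gcongr; exacts [hb n i, hφ1 _]
    _ = _ := mul_one _

theorem osum_summable (h : Setting a β ξ₀) {φ : UnitAddCircle → ℝ} (hφ1 : ∀ θ, |φ θ| ≤ 1)
    (d n : ℕ) (t : ℝ) :
    Summable fun i : ℕ => critD a n / critD a (n + i) *
      φ (((d : ℝ) ^ i * t : ℝ) : UnitAddCircle) := by
  obtain ⟨C, hC, r, hr, hr1, hb⟩ := h.osum_term_le hφ1
  exact Summable.of_norm_bounded ((summable_geometric_of_lt_one hr.le hr1).mul_left C)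
    (hb d n · t)

theorem continuous_osum (h : Setting a β ξ₀) {φ : UnitAddCircle → ℝ} (hφ1 : ∀ θ, |φ θ| ≤ 1)
    (hφ : IsRealAnalytic φ) (d n : ℕ) : Continuous (osum a d φ n) := by
  obtain ⟨C, hC, r, hr, hr1, hb⟩ := h.osum_term_le hφ1
  have hc : Continuous fun t : ℝ => φ (t : UnitAddCircle) := by
    rw [← continuousOn_univ]; exact hφ.continuousOn
  exact continuous_tsum (fun i => continuous_const.mul (hc.comp (continuous_const.mul continuous_id)))
    ((summable_geometric_of_lt_one hr.le hr1).mul_left C) (hb d n · ·)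

theorem exists_osum_bound (h : Setting a β ξ₀) {φ : UnitAddCircle → ℝ} (hφ1 : ∀ θ, |φ θ| ≤ 1)
    (d : ℕ) : ∃ C, ∀ n t, |osum a d φ n t| ≤ C := by
  obtain ⟨C, hC, r, hr, hr1, hb⟩ := h.osum_term_le hφ1
  exact ⟨_, fun n t => tsum_of_norm_bounded
    ((summable_geometric_of_lt_one hr.le hr1).mul_left C).hasSum (hb d n · t)⟩

theorem osum_split (h : Setting a β ξ₀) {φ : UnitAddCircle → ℝ} (hφ1 : ∀ θ, |φ θ| ≤ 1)
    (d n k : ℕ) (t : ℝ) :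
    osum a d φ n t = ∑ i ∈ Finset.range k, critD a n / critD a (n + i) *
      φ (((d : ℝ) ^ i * t : ℝ) : UnitAddCircle) +
      critD a n / critD a (n + k) * osum a d φ (n + k) ((d : ℝ) ^ k * t) := by
  rw [osum, ← (h.osum_summable hφ1 d n t).sum_add_tsum_nat_add k, osum, ← tsum_mul_left]
  congr 2
  funext i
  have := h.critD_ne_zero (n + k)
  rw [← mul_assoc, div_mul_div_cancel₀ this, ← mul_assoc, ← pow_add,
    show n + (i + k) = n + k + i by omega]

/-- The series depends only on the class of `n` modulo the period of the critical orbit. -/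
theorem exists_osum_period (h : Setting a β ξ₀) : ∃ m q : ℕ, 0 < q ∧ ∀ n, m ≤ n →
    ∀ d φ t, osum a d φ (n + q) t = osum a d φ n t := by
  obtain ⟨m, q, hq, hper⟩ := h.exists_period
  refine ⟨m, q, hq, fun n hn d φ t => ?_⟩
  unfold osum
  congr 1
  funext i
  congr 1
  have hD : ∀ n i, critD a (n + i) =
      critD a n * ∏ j ∈ Finset.range i, (-2 * crit a (n + j + 1)) := fun n i => by
    simp [critD, Finset.prod_range_add]
  have h1 := h.critD_ne_zero (n + q)
  have h2 := h.critD_ne_zero n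
  rw [hD (n + q), hD n i, ← div_div, ← div_div, div_self h1, div_self h2]
  congr 1
  refine Finset.prod_congr rfl fun j _ => ?_
  rw [show n + q + j + 1 = n + j + 1 + q by omega, hper _ (by omega)]

/-- The part of the series that comes from large scales is Lipschitz over each cell, uniformly in
the level of the cell, because the vertical expansion is weaker than the horizontal one. -/
theorem osum_head_lipschitz (h : Setting a β ξ₀) {d : ℕ} (hd : 2 ≤ d) {φ : UnitAddCircle → ℝ}
    (hφ : IsRealAnalytic φ) : ∃ C > 0, ∀ (n : ℕ) (u v : ℝ),
      |∑ i ∈ Finset.range n, critD a n / critD a i *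
        φ (((d : ℝ) ^ i * (u / (d : ℝ) ^ n) : ℝ) : UnitAddCircle) -
      ∑ i ∈ Finset.range n, critD a n / critD a i *
        φ (((d : ℝ) ^ i * (v / (d : ℝ) ^ n) : ℝ) : UnitAddCircle)| ≤ C * |u - v| := by
  obtain ⟨κ, hκ, hκ2, Cκ, hCκ, hv⟩ := h.vprod_orb_le
  obtain ⟨K, hK, hlip⟩ := exists_lipschitz hφ
  have hdr : (2 : ℝ) ≤ d := by exact_mod_cast hd
  have hd0 : (0 : ℝ) < d := by linarith
  set ρ : ℝ := κ / d with hρ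
  have hρ0 : 0 < ρ := by positivity
  have hρ1 : ρ < 1 := by rw [hρ, div_lt_one hd0]; linarith
  refine ⟨Cκ * K * (1 - ρ)⁻¹, by
    have : 0 < 1 - ρ := by linarith
    positivity, fun n u v => ?_⟩
  rw [← Finset.sum_sub_distrib]
  refine (Finset.abs_sum_le_sum_abs _ _).trans ?_
  have hterm : ∀ i ∈ Finset.range n, |critD a n / critD a i *
        φ (((d : ℝ) ^ i * (u / (d : ℝ) ^ n) : ℝ) : UnitAddCircle) -
      critD a n / critD a i * φ (((d : ℝ) ^ i * (v / (d : ℝ) ^ n) : ℝ) : UnitAddCircle)| ≤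
        Cκ * K * |u - v| * ρ ^ (n - 1 - i) := by
    intro i hi
    have hi' := Finset.mem_range.1 hi
    obtain ⟨j, rfl⟩ := Nat.exists_eq_add_of_lt hi'
    rw [← mul_sub, abs_mul, abs_div]
    have h1 : |critD a (i + j + 1)| / |critD a i| ≤ Cκ * κ ^ (j + 1) := by
      rw [div_le_iff₀ (h.abs_critD_pos i), add_assoc, abs_critD_add, mul_comm]
      gcongr
      exact hv _ (h.crit_le _) _
    have h2 := hlip ((d : ℝ) ^ i * (u / (d : ℝ) ^ (i + j + 1)))
      ((d : ℝ) ^ i * (v / (d : ℝ) ^ (i + j + 1)))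
    have e : (d : ℝ) ^ i * (u / (d : ℝ) ^ (i + j + 1)) - (d : ℝ) ^ i * (v / (d : ℝ) ^ (i + j + 1)) =
        (u - v) / (d : ℝ) ^ (j + 1) := by
      rw [add_assoc, pow_add]; field_simp
    rw [e, abs_div, abs_of_pos (pow_pos hd0 (j + 1))] at h2
    calc _ ≤ Cκ * κ ^ (j + 1) * (K * (|u - v| / (d : ℝ) ^ (j + 1))) := by gcongr
      _ = Cκ * K * |u - v| * ρ ^ (j + 1) := by rw [hρ, div_pow]; ring
      _ ≤ Cκ * K * |u - v| * ρ ^ (i + j + 1 - 1 - i) := by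
          gcongr ?_ * ?_
          exact pow_le_pow_of_le_one hρ0.le hρ1.le (by omega)
  refine (Finset.sum_le_sum hterm).trans ?_
  rw [← Finset.mul_sum, Finset.sum_range_reflect (fun i => ρ ^ i)]
  have geo : ∑ i ∈ Finset.range n, ρ ^ i ≤ (1 - ρ)⁻¹ := by
    rw [← tsum_geometric_of_lt_one hρ0.le hρ1]
    exact (summable_geometric_of_lt_one hρ0.le hρ1).sum_le_tsum _ fun i _ => by positivity
  calc _ ≤ Cκ * K * |u - v| * (1 - ρ)⁻¹ := by gcongr
    _ = _ := by ring

end Setting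

/-- Near a density point, a set meets all parts of the cells that contain the point. -/
theorem exists_mem_near_of_density {S : Set ℝ} (hS : volume S ≠ 0) {d : ℕ} (hd : 2 ≤ d) :
    ∃ j : ℕ → ℤ, ∀ s ∈ Ioo (0 : ℝ) 1, ∀ ε > 0, ∀ᶠ n : ℕ in atTop,
      ∃ s', |s' - s| < ε ∧ (s' + j n) / (d : ℝ) ^ n ∈ S := by
  have hdr : (2 : ℝ) ≤ d := by exact_mod_cast hd
  have hd0 : (0 : ℝ) < d := by linarith
  have hne : NeZero (volume.restrict S) := ⟨by rwa [Ne, Measure.restrict_eq_zero]⟩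
  obtain ⟨x, hx⟩ := (IsUnifLocDoublingMeasure.ae_tendsto_measure_inter_div volume S 1).exists
  refine ⟨fun n => ⌊(d : ℝ) ^ n * x⌋, fun s hs ε hε => ?_⟩
  set w : ℕ → ℝ := fun n => (⌊(d : ℝ) ^ n * x⌋ + 1 / 2) / (d : ℝ) ^ n with hw
  set δ : ℕ → ℝ := fun n => 1 / 2 / (d : ℝ) ^ n with hδ
  have hδlim : Tendsto δ atTop (nhdsWithin 0 (Ioi 0)) := by
    refine tendsto_nhdsWithin_iff.2 ⟨?_, Eventually.of_forall fun n => by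
      simp only [hδ, mem_Ioi]; positivity⟩
    exact tendsto_const_nhds.div_atTop (tendsto_pow_atTop_atTop_of_one_lt (by linarith))
  have hlim := hx w δ hδlim (Eventually.of_forall fun n => by
    rw [Metric.mem_closedBall, Real.dist_eq, one_mul]
    simp only [hw, hδ]
    have hp : 0 < (d : ℝ) ^ n := by positivity
    have e : x - (⌊(d : ℝ) ^ n * x⌋ + 1 / 2) / (d : ℝ) ^ n =
        (Int.fract ((d : ℝ) ^ n * x) - 1 / 2) / (d : ℝ) ^ n := by
      rw [Int.fract]; field_simp; ring
    rw [e, abs_div, abs_of_pos hp]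
    gcongr
    rw [abs_le]
    constructor <;> linarith [Int.fract_nonneg ((d : ℝ) ^ n * x), Int.fract_lt_one ((d : ℝ) ^ n * x)])
  -- shrink `ε` so that the interval around `s` stays inside the unit interval
  set e : ℝ := min ε (min s (1 - s)) with he
  have he0 : 0 < e := lt_min hε (lt_min hs.1 (by linarith [hs.2]))
  have he1 : e ≤ ε := min_le_left _ _
  have hes : e ≤ s := (min_le_right _ _).trans (min_le_left _ _)
  have hes' : e ≤ 1 - s := (min_le_right _ _).trans (min_le_right _ _)
  have hlt : ENNReal.ofReal (1 - 2 * e) < 1 := by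
    rw [← ENNReal.ofReal_one]; exact (ENNReal.ofReal_lt_ofReal_iff one_pos).2 (by linarith)
  filter_upwards [hlim.eventually (lt_mem_nhds hlt)] with n hn
  by_contra hcon
  push Not at hcon
  have hp : 0 < (d : ℝ) ^ n := by positivity
  set J : ℝ := ((⌊(d : ℝ) ^ n * x⌋ : ℤ) : ℝ) with hJ
  have hcb : Metric.closedBall (w n) (δ n) = Icc (J / (d : ℝ) ^ n) ((J + 1) / (d : ℝ) ^ n) := by
    rw [Real.closedBall_eq_Icc]
    simp only [hw, hδ]
    congr 1 <;> ring
  have hvol : volume (Metric.closedBall (w n) (δ n)) = ENNReal.ofReal (1 / (d : ℝ) ^ n) := by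
    rw [hcb, Real.volume_Icc]; congr 1; ring
  have hsub : S ∩ Metric.closedBall (w n) (δ n) ⊆
      Icc (J / (d : ℝ) ^ n) ((J + s - e) / (d : ℝ) ^ n) ∪
        Icc ((J + s + e) / (d : ℝ) ^ n) ((J + 1) / (d : ℝ) ^ n) := by
    rintro y ⟨hyS, hy⟩
    rw [hcb] at hy
    have hy' : (y * (d : ℝ) ^ n - J + J) / (d : ℝ) ^ n = y := by
      rw [sub_add_cancel]; field_simp
    have hfar : e ≤ |y * (d : ℝ) ^ n - J - s| := by
      by_contra hc
      push Not at hc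
      refine hcon _ (hc.trans_le he1) ?_
      rw [hy']; exact hyS
    rcases le_abs'.1 hfar with h1 | h1
    · left; refine ⟨hy.1, ?_⟩
      rw [le_div_iff₀ hp]; linarith
    · right; refine ⟨?_, hy.2⟩
      rw [div_le_iff₀ hp]; linarith
  have hle : volume (S ∩ Metric.closedBall (w n) (δ n)) ≤
      ENNReal.ofReal ((1 - 2 * e) / (d : ℝ) ^ n) := by
    refine (measure_mono hsub).trans ((measure_union_le _ _).trans ?_)
    rw [Real.volume_Icc, Real.volume_Icc, ← ENNReal.ofReal_add]
    · refine le_of_eq ?_; congr 1; ring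
    · rw [← sub_div]; apply div_nonneg _ hp.le; linarith
    · rw [← sub_div]; apply div_nonneg _ hp.le; linarith
  have : volume (S ∩ Metric.closedBall (w n) (δ n)) / volume (Metric.closedBall (w n) (δ n)) ≤
      ENNReal.ofReal (1 - 2 * e) := by
    rw [hvol]
    refine ENNReal.div_le_of_le_mul (hle.trans (le_of_eq ?_))
    rw [← ENNReal.ofReal_mul (by linarith)]
    congr 1; ring
  exact absurd hn (not_lt.2 this)

namespace Setting

variable {a β ξ₀ : ℝ}

/-- If the response has a level set of positive measure, then blowing up at a density point of
this level set shows that the tails of the series are Lipschitz. -/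
theorem osum_lipschitz_of_level (h : Setting a β ξ₀) {d : ℕ} (hd : 2 ≤ d) {φ : UnitAddCircle → ℝ}
    (hφ1 : ∀ θ, |φ θ| ≤ 1) (hφ : IsRealAnalytic φ) {c : ℝ}
    (hc : volume {t | osum a d φ 0 t = c} ≠ 0) {m q : ℕ} (hq : 0 < q)
    (hper : ∀ n, m ≤ n → ∀ d φ t, osum a d φ (n + q) t = osum a d φ n t) :
    ∃ C, ∀ s, 0 ≤ s → s < 1 → |osum a d φ m s - osum a d φ m 0| ≤ C * s := by
  obtain ⟨C, hC, hlip⟩ := h.osum_head_lipschitz hd hφ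
  obtain ⟨j, hj⟩ := exists_mem_near_of_density hc hd
  have hcont := h.continuous_osum hφ1 hφ d m
  have hdr : (2 : ℝ) ≤ d := by exact_mod_cast hd
  have hd0 : (0 : ℝ) < d := by linarith
  have hperk : ∀ k t, osum a d φ (m + k * q) t = osum a d φ m t := by
    intro k t
    induction k with
    | zero => simp
    | succ k ih => rw [Nat.succ_mul, ← add_assoc, hper _ (by omega), ih]
  have hopen : ∀ s ∈ Ioo (0 : ℝ) 1, ∀ s' ∈ Ioo (0 : ℝ) 1,
      |osum a d φ m s - osum a d φ m s'| ≤ C * |s - s'| := by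
    intro s hs s' hs'
    refine le_of_forall_pos_le_add fun η hη => ?_
    obtain ⟨ε₁, hε₁, hc₁⟩ := Metric.continuousAt_iff.1 (hcont.continuousAt (x := s)) (η / 4)
      (by positivity)
    obtain ⟨ε₂, hε₂, hc₂⟩ := Metric.continuousAt_iff.1 (hcont.continuousAt (x := s')) (η / 4)
      (by positivity)
    set ε := min (min ε₁ ε₂) (η / (4 * C)) with hε
    have hε0 : 0 < ε := by positivity
    have hlarge : Tendsto (fun k : ℕ => m + k * q) atTop atTop := by
      refine tendsto_atTop_mono (fun k => ?_) tendsto_id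
      have := Nat.le_mul_of_pos_right k hq
      simp only [id]; omega
    obtain ⟨k, ⟨t, ht, htS⟩, ⟨t', ht', htS'⟩⟩ :=
      ((hlarge.eventually (hj s hs ε hε0)).and (hlarge.eventually (hj s' hs' ε hε0))).exists
    set n := m + k * q
    have key : ∀ t : ℝ, osum a d φ 0 ((t + j n) / (d : ℝ) ^ n) = c →
        osum a d φ m t = critD a n * c - ∑ i ∈ Finset.range n, critD a n / critD a i *
          φ (((d : ℝ) ^ i * ((t + j n) / (d : ℝ) ^ n) : ℝ) : UnitAddCircle) := by
      intro t ht
      have hDn := h.critD_ne_zero n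
      rw [h.osum_split hφ1 d 0 n, mul_div_cancel₀ _ (by positivity), osum_add_int, critD_zero] at ht
      simp only [zero_add] at ht
      rw [hperk] at ht
      rw [← ht, mul_add, Finset.mul_sum]
      have e1 : critD a n * (1 / critD a n * osum a d φ m t) = osum a d φ m t := by
        field_simp
      have e2 : ∀ i, critD a n * (1 / critD a i *
          φ (((d : ℝ) ^ i * ((t + j n) / (d : ℝ) ^ n) : ℝ) : UnitAddCircle)) =
          critD a n / critD a i *
          φ (((d : ℝ) ^ i * ((t + j n) / (d : ℝ) ^ n) : ℝ) : UnitAddCircle) := fun i => by ring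
      simp only [e2, e1]
      ring
    have k1 := key t htS
    have k2 := key t' htS'
    have k3 := hlip n (t' + j n) (t + j n)
    have k4 : |osum a d φ m t - osum a d φ m t'| ≤ C * |t - t'| := by
      rw [k1, k2]
      convert k3 using 1
      · congr 1; ring
      · rw [abs_sub_comm]; congr 2; ring
    have k5 := hc₁ (show dist t s < ε₁ from
      ht.trans_le ((min_le_left _ _).trans (min_le_left _ _)))
    have k6 := hc₂ (show dist t' s' < ε₂ from
      ht'.trans_le ((min_le_left _ _).trans (min_le_right _ _)))
    rw [Real.dist_eq] at k5 k6
    have k7 : |t - t'| ≤ |s - s'| + 2 * ε := by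
      have e : t - t' = (s - s') + (t - s) - (t' - s') := by ring
      rw [e]
      have h1 := abs_sub ((s - s') + (t - s)) (t' - s')
      have h2 := abs_add_le (s - s') (t - s)
      linarith
    have k8 : C * (2 * ε) ≤ η / 2 := by
      have : ε ≤ η / (4 * C) := min_le_right _ _
      rw [le_div_iff₀ (by positivity)] at this
      linarith
    have k9 : |osum a d φ m s - osum a d φ m s'| ≤
        |osum a d φ m t - osum a d φ m t'| + η / 4 + η / 4 := by
      have e : osum a d φ m s - osum a d φ m s' = (osum a d φ m t - osum a d φ m t') -
          (osum a d φ m t - osum a d φ m s) + (osum a d φ m t' - osum a d φ m s') := by ring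
      rw [e]
      have h1 := abs_add_le ((osum a d φ m t - osum a d φ m t') -
          (osum a d φ m t - osum a d φ m s)) (osum a d φ m t' - osum a d φ m s')
      have h2 := abs_sub (osum a d φ m t - osum a d φ m t') (osum a d φ m t - osum a d φ m s)
      linarith
    have k10 : C * |t - t'| ≤ C * (|s - s'| + 2 * ε) := by gcongr
    linarith
  refine ⟨C, fun s hs hs1 => ?_⟩
  rcases hs.eq_or_lt with rfl | hs0
  · simp
  have hlim : Tendsto (fun y => |osum a d φ m s - osum a d φ m y|) (nhdsWithin 0 (Ioi 0))
      (nhds |osum a d φ m s - osum a d φ m 0|) :=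
    ((continuous_const.sub hcont).abs.tendsto 0).mono_left nhdsWithin_le_nhds
  refine le_of_tendsto hlim ?_
  filter_upwards [Ioo_mem_nhdsGT hs0] with y hy
  refine (hopen s ⟨hs0, hs1⟩ y ⟨hy.1, hy.2.trans hs1⟩).trans ?_
  rw [abs_of_pos (by linarith [hy.2])]
  gcongr
  linarith [hy.1]

/-- If the response is constant, so is `φ`: it has all the periods `d^{-n}`. -/
theorem phi_const_of_osum_const (h : Setting a β ξ₀) {d : ℕ} (hd : 2 ≤ d)
    {φ : UnitAddCircle → ℝ} (hφ1 : ∀ θ, |φ θ| ≤ 1) (hφ : IsRealAnalytic φ) {c : ℝ}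
    (hc : ∀ t, osum a d φ 0 t = c) : ∃ c', ∀ θ, φ θ = c' := by
  have hdr : (2 : ℝ) ≤ d := by exact_mod_cast hd
  have hd0 : (0 : ℝ) < d := by linarith
  have hper : ∀ (n : ℕ) (t : ℝ) (k : ℕ), φ ((t + k / (d : ℝ) ^ n : ℝ) : UnitAddCircle) =
      φ (t : UnitAddCircle) := by
    intro n
    induction n with
    | zero => intro t k; have := phi_add_int φ t k; simpa using this
    | succ n ih =>
      intro t k
      have hosum : ∀ t : ℝ, osum a d φ 1 (d * (t + k / (d : ℝ) ^ (n + 1))) =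
          osum a d φ 1 (d * t) := by
        intro t
        unfold osum
        congr 1
        funext i
        congr 1
        have e : (d : ℝ) ^ i * (d * (t + k / (d : ℝ) ^ (n + 1))) =
            (d : ℝ) ^ i * (d * t) + ((d ^ i * k : ℕ) : ℝ) / (d : ℝ) ^ n := by
          push_cast; rw [pow_succ]; field_simp
        rw [e, ih]
      have hφeq : ∀ t : ℝ, φ (t : UnitAddCircle) =
          c - critD a 0 / critD a (0 + 1) * osum a d φ 1 (d * t) := by
        intro t
        have h1 := h.osum_split hφ1 d 0 1 t
        have h2 := h.critD_ne_zero 0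
        simp only [Finset.range_one, Finset.sum_singleton, pow_zero, one_mul, pow_one,
          div_self h2, zero_add] at h1
        rw [hc] at h1
        rw [zero_add]
        linarith
      rw [hφeq, hosum, ← hφeq]
  obtain ⟨K, hK, hlip⟩ := exists_lipschitz hφ
  refine ⟨φ ((0 : ℝ) : UnitAddCircle), fun θ => ?_⟩
  obtain ⟨t, rfl⟩ := QuotientAddGroup.mk_surjective θ
  have hfr : φ (t : UnitAddCircle) = φ ((Int.fract t : ℝ) : UnitAddCircle) := by
    rw [← phi_add_int φ (Int.fract t) ⌊t⌋, Int.fract_add_floor]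
  rw [hfr]
  set s := Int.fract t
  have hs := Int.fract_nonneg t
  have hbound : ∀ n : ℕ, |φ (s : UnitAddCircle) - φ ((0 : ℝ) : UnitAddCircle)| ≤
      K * (1 / d) ^ n := by
    intro n
    have hp : 0 < (d : ℝ) ^ n := by positivity
    set k := ⌊s * (d : ℝ) ^ n⌋₊
    have h1 := hper n (s - k / (d : ℝ) ^ n) k
    rw [sub_add_cancel] at h1
    rw [h1]
    refine (hlip _ _).trans ?_
    have hk1 : (k : ℝ) ≤ s * (d : ℝ) ^ n := Nat.floor_le (by positivity)
    have hk2 : s * (d : ℝ) ^ n < k + 1 := Nat.lt_floor_add_one _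
    gcongr
    rw [sub_zero, one_div, inv_pow, abs_of_nonneg]
    · rw [← one_div, le_div_iff₀ hp, sub_mul, div_mul_cancel₀ _ hp.ne']; linarith
    · rw [sub_nonneg, div_le_iff₀ hp]; exact hk1
  have hlim : Tendsto (fun n : ℕ => K * (1 / (d : ℝ)) ^ n) atTop (nhds (K * 0)) :=
    (tendsto_pow_atTop_nhds_zero_of_lt_one (by positivity)
      (by rw [div_lt_one hd0]; linarith)).const_mul K
  rw [mul_zero] at hlim
  have := abs_nonpos_iff.1 (ge_of_tendsto' hlim hbound)
  linarith

/-- The response of the critical orbit has no level set of positive measure. -/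
theorem volume_osum_level (h : Setting a β ξ₀) {d : ℕ} (hd : 2 ≤ d) {φ : UnitAddCircle → ℝ}
    (hφ1 : ∀ θ, |φ θ| ≤ 1) (hφ : IsRealAnalytic φ) (hφc : ¬ ∃ c : ℝ, ∀ θ, φ θ = c) (c : ℝ) :
    volume {t | osum a d φ 0 t = c} = 0 := by
  by_contra hpos
  obtain ⟨m, q₀, hq₀, hper₀⟩ := h.exists_osum_period
  obtain ⟨κ, hκ, hκ2, Cκ, hCκ, hv⟩ := h.vprod_orb_le
  obtain ⟨r, hr, c₀, hc₀, hgrow⟩ := h.critD_growth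
  have hdr : (2 : ℝ) ≤ d := by exact_mod_cast hd
  have hd0 : (0 : ℝ) < d := by linarith
  -- pass to a multiple of the period along which the multiplier lies between `1` and `d^q`
  obtain ⟨q, hq, hper, hq1, hq2⟩ : ∃ q, 0 < q ∧
      (∀ n, m ≤ n → ∀ d φ t, osum a d φ (n + q) t = osum a d φ n t) ∧
      1 < c₀ * r ^ q ∧ Cκ * κ ^ q < (d : ℝ) ^ q := by
    have hperk : ∀ k n, m ≤ n → ∀ d φ t, osum a d φ (n + k * q₀) t = osum a d φ n t := by
      intro k n hn d φ t
      induction k with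
      | zero => simp
      | succ k ih => rw [Nat.succ_mul, ← add_assoc, hper₀ _ (by omega), ih]
    have e1 : ∀ᶠ q : ℕ in atTop, c₀⁻¹ < r ^ q :=
      (tendsto_pow_atTop_atTop_of_one_lt hr).eventually_gt_atTop _
    have e2 : ∀ᶠ q : ℕ in atTop, (κ / d) ^ q < Cκ⁻¹ :=
      (tendsto_pow_atTop_nhds_zero_of_lt_one (by positivity)
        (by rw [div_lt_one hd0]; linarith)).eventually (Iio_mem_nhds (by positivity))
    have hlarge : Tendsto (fun k : ℕ => k * q₀) atTop atTop := by
      refine tendsto_atTop_mono (fun k => ?_) tendsto_id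
      have := Nat.le_mul_of_pos_right k hq₀
      simpa using this
    obtain ⟨k, hk1, hk2, hk3⟩ := ((hlarge.eventually e1).and ((hlarge.eventually e2).and
      (hlarge.eventually_gt_atTop 0))).exists
    refine ⟨k * q₀, hk3, hperk k, ?_, ?_⟩
    · rwa [inv_lt_iff_one_lt_mul₀' hc₀] at hk1
    · rw [div_pow, div_lt_iff₀ (by positivity)] at hk2
      calc Cκ * κ ^ (k * q₀) < Cκ * (Cκ⁻¹ * (d : ℝ) ^ (k * q₀)) := by gcongr
        _ = _ := by field_simp
  obtain ⟨C, hC⟩ := h.osum_lipschitz_of_level hd hφ1 hφ hpos hq hper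
  set Λ : ℝ := critD a (m + q) / critD a m with hΛ
  have hDm := h.abs_critD_pos m
  have hΛ1 : 1 < |Λ| := by
    rw [hΛ, abs_div, one_lt_div hDm]
    have := hgrow m q
    nlinarith
  have hΛ2 : |Λ| < (d : ℝ) ^ q := by
    rw [hΛ, abs_div, div_lt_iff₀ hDm, abs_critD_add, mul_comm]
    gcongr
    exact (hv _ (h.crit_le _) q).trans_lt hq2
  have hφan : ∀ (e : ℝ) (t : ℝ), AnalyticAt ℝ (fun t : ℝ => φ ((e * t : ℝ) : UnitAddCircle)) t := by
    intro e t
    have hmul : AnalyticAt ℝ (fun t : ℝ => e * t) t := analyticAt_const.mul analyticAt_id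
    exact AnalyticAt.comp_of_eq (g := fun t : ℝ => φ (t : UnitAddCircle)) (hφ (e * t) (mem_univ _))
      hmul rfl
  have hhead : ∀ n k : ℕ, AnalyticOnNhd ℝ (fun t : ℝ => ∑ i ∈ Finset.range k,
      critD a n / critD a (n + i) * φ (((d : ℝ) ^ i * t : ℝ) : UnitAddCircle)) univ :=
    fun n k t _ => Finset.analyticAt_fun_sum _ fun i _ => analyticAt_const.mul (hφan _ t)
  have hΨ : AnalyticOnNhd ℝ (osum a d φ m) univ := by
    refine analytic_of_cohomological (hhead m q) (osum_add_int a d φ m) hΛ1 hΛ2 (fun t => ?_) hC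
    have h1 := h.osum_split hφ1 d m q t
    rw [hper m le_rfl] at h1
    rw [h1, hΛ, inv_div]
  have hΦ : AnalyticOnNhd ℝ (osum a d φ 0) univ := by
    intro t _
    have hmul : AnalyticAt ℝ (fun t : ℝ => (d : ℝ) ^ m * t) t := analyticAt_const.mul analyticAt_id
    have h1 : AnalyticAt ℝ (fun t => osum a d φ m ((d : ℝ) ^ m * t)) t :=
      AnalyticAt.comp_of_eq (g := osum a d φ m) (hΨ _ (mem_univ _)) hmul rfl
    refine ((hhead 0 m t (mem_univ t)).add ((analyticAt_const
      (v := critD a 0 / critD a (0 + m))).mul h1)).congr (Eventually.of_forall fun y => ?_)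
    have := h.osum_split hφ1 d 0 m y
    rw [this, zero_add]
    rfl
  obtain ⟨z, -, hz⟩ := exists_mem_forall_mem_nhdsWithin_pos_measure hpos
  have hfreq : ∃ᶠ y in nhdsWithin z {z}ᶜ, osum a d φ 0 y = c := by
    intro hev
    rw [eventually_nhdsWithin_iff] at hev
    have h1 := hz _ (inter_mem_nhdsWithin _ hev)
    have h2 : {t | osum a d φ 0 t = c} ∩ {y | y ∈ ({z} : Set ℝ)ᶜ → ¬ osum a d φ 0 y = c} ⊆ {z} := by
      rintro y ⟨hy1, hy2⟩
      by_contra hyz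
      exact hy2 hyz hy1
    have h3 := measure_mono (μ := volume) h2
    rw [Real.volume_singleton] at h3
    exact absurd h1 (not_lt.2 h3)
  have hconst := hΦ.eq_of_frequently_eq (g := fun _ => c) analyticOnNhd_const hfreq
  exact hφc (h.phi_const_of_osum_const hd hφ1 hφ (c := c) fun t => congrFun hconst t)

/-- The distribution of the response on the circle does not concentrate on short intervals. -/
theorem osum_nonconcentration (h : Setting a β ξ₀) {d : ℕ} (hd : 2 ≤ d) {φ : UnitAddCircle → ℝ}
    (hφ1 : ∀ θ, |φ θ| ≤ 1) (hφ : IsRealAnalytic φ) (hφc : ¬ ∃ c : ℝ, ∀ θ, φ θ = c) {ε : ENNReal}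
    (hε : 0 < ε) : ∃ η > 0, ∀ c,
      volume {t | t ∈ Ico (0 : ℝ) 1 ∧ |osum a d φ 0 t - c| < η} ≤ ε := by
  obtain ⟨C, hC⟩ := h.exists_osum_bound hφ1 d
  have hcont := h.continuous_osum hφ1 hφ d 0
  set V : ℝ → ℝ → Set ℝ := fun c η => {t | t ∈ Ico (0 : ℝ) 1 ∧ |osum a d φ 0 t - c| < η} with hV
  have hmeas : ∀ c η, MeasurableSet (V c η) := fun c η =>
    measurableSet_Ico.inter (isOpen_lt (hcont.sub continuous_const).abs continuous_const).measurableSet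
  have hpt : ∀ c, ∃ η > 0, volume (V c η) ≤ ε := by
    intro c
    have hanti : Antitone fun n : ℕ => V c (1 / ((n : ℝ) + 1)) := by
      intro n k hnk t ht
      refine ⟨ht.1, ht.2.trans_le ?_⟩
      apply one_div_le_one_div_of_le (by positivity)
      have : (n : ℝ) ≤ k := by exact_mod_cast hnk
      linarith
    have hlim := tendsto_measure_iInter_atTop (μ := volume)
      (fun n : ℕ => (hmeas c (1 / ((n : ℝ) + 1))).nullMeasurableSet) hanti
      ⟨0, ((measure_mono fun t ht => ht.1).trans_lt (measure_Ico_lt_top (a := (0 : ℝ)) (b := 1))).ne⟩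
    have hzero : volume (⋂ n : ℕ, V c (1 / ((n : ℝ) + 1))) = 0 := by
      refine measure_mono_null (fun t ht => ?_) (h.volume_osum_level hd hφ1 hφ hφc c)
      rw [mem_iInter] at ht
      have h1 : |osum a d φ 0 t - c| ≤ 0 :=
        ge_of_tendsto' tendsto_one_div_add_atTop_nhds_zero_nat fun n => (ht n).2.le
      exact sub_eq_zero.1 (abs_nonpos_iff.1 h1)
    rw [hzero] at hlim
    obtain ⟨n, hn⟩ := (hlim.eventually (Iio_mem_nhds hε)).exists
    exact ⟨1 / ((n : ℝ) + 1), by positivity, (show volume (V c (1 / ((n : ℝ) + 1))) < ε from hn).le⟩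
  choose η hη hηε using hpt
  obtain ⟨δ, hδ, hcov⟩ := lebesgue_number_lemma_of_metric
    (isCompact_Icc (a := -(C + 1)) (b := C + 1)) (fun c => Metric.isOpen_ball (x := c) (ε := η c))
    (fun x _ => mem_iUnion.2 ⟨x, Metric.mem_ball_self (hη x)⟩)
  refine ⟨min δ 1, by positivity, fun c => ?_⟩
  by_cases hcC : c ∈ Icc (-(C + 1)) (C + 1)
  · obtain ⟨c', hc'⟩ := hcov c hcC
    refine (measure_mono fun t ht => ?_).trans (hηε c')
    refine ⟨ht.1, ?_⟩
    have := hc' (show osum a d φ 0 t ∈ Metric.ball c δ from ht.2.trans_le (min_le_left _ _))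
    exact this
  · have : {t | t ∈ Ico (0 : ℝ) 1 ∧ |osum a d φ 0 t - c| < min δ 1} = ∅ := by
      rw [eq_empty_iff_forall_notMem]
      rintro t ⟨-, ht⟩
      refine hcC (abs_le.1 ?_)
      have h1 := hC 0 t
      have h2 := ht.trans_le (min_le_right _ _)
      have h3 := abs_sub_abs_le_abs_sub c (osum a d φ 0 t)
      rw [abs_sub_comm] at h3
      linarith
    rw [this, measure_empty]
    exact bot_le

end Setting

/-! ### Equidistribution of returns after a binding period -/

/-- The difference of two perturbed orbits, written as its propagated initial value plus the
propagated perturbations. -/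
theorem sub_eq_of_perturbed {a α : ℝ} {y y' s s' : ℕ → ℝ}
    (hy : ∀ n, y (n + 1) = quad a (y n) + α * s n)
    (hy' : ∀ n, y' (n + 1) = quad a (y' n) + α * s' n) (P : ℕ → ℝ) (hP0 : P 0 = 1)
    (hP : ∀ n, P (n + 1) = P n * -(y (1 + n) + y' (1 + n))) {n : ℕ} (hne : ∀ i ≤ n, P i ≠ 0) :
    y (1 + n) - y' (1 + n) = P n * (y 1 - y' 1 +
      α * ∑ i ∈ Finset.range n, (s (i + 1) - s' (i + 1)) / P (i + 1)) := by
  induction n with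
  | zero => simp [hP0]
  | succ n ih =>
    have ih := ih fun i hi => hne i (by omega)
    have h1 := hne (n + 1) le_rfl
    rw [Finset.sum_range_succ, ← add_assoc, hy, hy']
    have e : quad a (y (1 + n)) + α * s (1 + n) - (quad a (y' (1 + n)) + α * s' (1 + n)) =
        -(y (1 + n) + y' (1 + n)) * (y (1 + n) - y' (1 + n)) + α * (s (n + 1) - s' (n + 1)) := by
      rw [add_comm n 1]; unfold quad; ring
    have e' : P (n + 1) * (α * ((s (n + 1) - s' (n + 1)) / P (n + 1))) =
        α * (s (n + 1) - s' (n + 1)) := by field_simp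
    rw [e, ih]
    linear_combination -(y 1 - y' 1 + α * ∑ i ∈ Finset.range n,
      (s (i + 1) - s' (i + 1)) / P (i + 1)) * hP n - e'

theorem exists_rpow_lt {s b : ℝ} (hs : 0 < s) (hb : 0 < b) :
    ∃ α₀ > 0, ∀ α : ℝ, 0 < α → α < α₀ → α ^ s < b := by
  have t := (Real.continuousAt_rpow_const 0 s (Or.inr hs.le)).tendsto
  rw [Real.zero_rpow hs.ne'] at t
  obtain ⟨r, hr, hball⟩ := Metric.eventually_nhds_iff.1 (t.eventually (gt_mem_nhds hb))
  refine ⟨r, hr, fun α h0 h1 => hball ?_⟩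
  rw [Real.dist_eq, sub_zero, abs_of_pos h0]; exact h1

/-- The size of the critical region tends to zero with the perturbation. -/
theorem exists_thr_lt {b : ℝ} (hb : 0 < b) : ∃ α₀ > 0, ∀ α, 0 < α → α < α₀ → 2 * thr α < b := by
  obtain ⟨r, hr, hlt⟩ := exists_rpow_lt (s := 0.6) (by norm_num) (half_pos hb)
  refine ⟨r, hr, fun α h0 h1 => ?_⟩
  have := hlt α h0 h1
  unfold thr
  linarith

namespace Setting

variable {a β ξ₀ : ℝ}

/-- Along a perturbed orbit that is bound to the critical one, the derivative stays close to that
of the critical orbit. -/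
theorem abs_prod_div_critD_sub_one (h : Setting a β ξ₀) {α : ℝ} (hα : 0 < α) {z : ℕ → ℝ}
    (hz : ∀ i, z i ∈ shadow a α i) {n : ℕ} (hn : n ≤ bindingTime a ξ₀ α) :
    |(∏ i ∈ Finset.range n, -2 * z i) / critD a n - 1| ≤
      (∑ i ∈ Finset.range n, blen a α i) / ξ₀ := by
  have hxi := h.xi_pos
  have e : (∏ i ∈ Finset.range n, -2 * z i) / critD a n =
      ∏ i ∈ Finset.range n, (1 + (z i - crit a (i + 1)) / crit a (i + 1)) := by
    rw [critD, ← Finset.prod_div_distrib]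
    refine Finset.prod_congr rfl fun i _ => ?_
    have := h.crit_ne_zero i
    field_simp
    ring
  have h1 := Finset.norm_prod_one_add_sub_one_le (Finset.range n)
    fun i => (z i - crit a (i + 1)) / crit a (i + 1)
  rw [← e, Real.norm_eq_abs] at h1
  set S := ∑ i ∈ Finset.range n, ‖(z i - crit a (i + 1)) / crit a (i + 1)‖ with hS
  have hS0 : 0 ≤ S := Finset.sum_nonneg fun _ _ => norm_nonneg _
  have hSle : 2 * S ≤ (∑ i ∈ Finset.range n, blen a α i) / ξ₀ := by
    rw [hS, Finset.mul_sum, Finset.sum_div]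
    refine Finset.sum_le_sum fun i _ => ?_
    rw [Real.norm_eq_abs, abs_div, mul_div_assoc', div_le_div_iff₀ (by
      have := h.le_abs_crit i; linarith) hxi]
    have h2 := abs_sub_le_blen a hα (hz i) (crit_mem_shadow a hα i)
    have h3 := h.le_abs_crit i
    have h4 := blen_nonneg a α i
    nlinarith [abs_nonneg (z i - crit a (i + 1))]
  have hS1 : S ≤ 1 := by
    have : (∑ i ∈ Finset.range n, blen a α i) / ξ₀ ≤ 1 :=
      div_le_one_of_le₀ (h.sum_blen_le hα hn) hxi.le
    linarith
  have h2 := Real.abs_exp_sub_one_le (x := S) (by rwa [abs_of_nonneg hS0])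
  rw [abs_of_nonneg hS0] at h2
  linarith [le_abs_self (Real.exp S - 1)]

/-- The binding time tends to infinity as the perturbation tends to zero. -/
theorem exists_le_bindingTime (h : Setting a β ξ₀) (n : ℕ) :
    ∃ α₀ > 0, ∀ α, 0 < α → α < α₀ → n ≤ bindingTime a ξ₀ α := by
  obtain ⟨r, hr, c, hc, C, hC, hb⟩ := h.binding_bounds
  refine ⟨min 1 (c / 4 ^ n), by positivity, fun α hα hα' => ?_⟩
  by_contra hcon
  push Not at hcon
  obtain ⟨h1, -⟩ := hb α hα (hα'.le.trans (min_le_left _ _))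
  have h2 := hα'.trans_le (min_le_right _ _)
  rw [lt_div_iff₀ (by positivity)] at h2
  have h3 : |critD a (bindingTime a ξ₀ α)| ≤ 4 ^ n :=
    (h.abs_critD_le _).trans (pow_le_pow_right₀ (by norm_num) hcon.le)
  have := mul_le_mul_of_nonneg_left h3 hα.le
  linarith

set_option maxHeartbeats 1000000 in
/-- For points near the critical point, the position at the end of the binding period determines
the linear response of the critical orbit up to a small error. -/
theorem osum_sub_le (h : Setting a β ξ₀) {d : ℕ} {φ : UnitAddCircle → ℝ}
    (hφ1 : ∀ θ, |φ θ| ≤ 1) : ∃ C > 0, ∀ η > 0, ∃ α₀ > 0, ∀ α, 0 < α → α < α₀ →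
      ∀ t t' x x' : ℝ, |x| ≤ 2 * thr α → |x'| ≤ 2 * thr α →
        |osum a d φ 0 t - osum a d φ 0 t'| ≤
          η + C * |fibOrb a d φ α x t (1 + bindingTime a ξ₀ α) -
            fibOrb a d φ α x' t' (1 + bindingTime a ξ₀ α)| := by
  obtain ⟨r, hr, c, hc, C, hC, hb⟩ := h.binding_bounds
  obtain ⟨B, hB⟩ := h.exists_osum_bound hφ1 d
  obtain ⟨α₁, hα₁, hps⟩ := h.isPseudo_fibOrb
  have hB0 : 0 ≤ B := (abs_nonneg _).trans (hB 0 0)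
  have hxi := h.xi_pos
  have hr0 : 0 < r := by linarith
  have hri : r⁻¹ < 1 := inv_lt_one_of_one_lt₀ hr
  refine ⟨Real.exp 1 / c, by positivity, fun η hη => ?_⟩
  set C₁ : ℝ := 2 * (Real.exp 1 * (C / ξ₀)) * C with hC₁
  -- the three error terms: the quadratic one, the sum over the binding period, and the tail
  obtain ⟨n₁, hn₁⟩ : ∃ n₁ : ℕ, ∀ n ≥ n₁, C₁ * (n * r⁻¹ ^ n) + 2 * B / (c * r ^ (1 + n)) < η / 2 := by
    have t1 := (tendsto_self_mul_const_pow_of_lt_one (inv_nonneg.2 hr0.le) hri).const_mul C₁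
    have t2 : Tendsto (fun n : ℕ => 2 * B / c * r⁻¹ * r⁻¹ ^ n) atTop (nhds (2 * B / c * r⁻¹ * 0)) :=
      (tendsto_pow_atTop_nhds_zero_of_lt_one (inv_nonneg.2 hr0.le) hri).const_mul _
    have t3 := t1.add t2
    rw [mul_zero, mul_zero, add_zero] at t3
    obtain ⟨n₁, hn₁⟩ := eventually_atTop.1 (t3.eventually (gt_mem_nhds (half_pos hη)))
    refine ⟨n₁, fun n hn => lt_of_eq_of_lt ?_ (hn₁ n hn)⟩
    rw [inv_pow]
    congr 1
    field_simp
    ring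
  obtain ⟨α₂, hα₂, hN⟩ := h.exists_le_bindingTime n₁
  obtain ⟨α₄, hα₄, hthr⟩ := exists_thr_lt h.beta_pos
  obtain ⟨α₃, hα₃, hsmall⟩ := exists_rpow_lt (s := 0.2) (by norm_num)
    (show 0 < min (η / 2) 1 / 4 by positivity)
  refine ⟨min (min α₁ α₂) (min α₃ (min α₄ 1)), by positivity, fun α hα hα' t t' x x' hx hx' => ?_⟩
  have l1 : α < α₁ := hα'.trans_le ((min_le_left _ _).trans (min_le_left _ _))
  have l2 : α < α₂ := hα'.trans_le ((min_le_left _ _).trans (min_le_right _ _))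
  have l3 : α < α₃ := hα'.trans_le ((min_le_right _ _).trans (min_le_left _ _))
  have l5 := hα'.trans_le ((min_le_right _ _).trans (min_le_right _ _))
  have l4 : α < 1 := l5.trans_le (min_le_right _ _)
  have s1 : 4 * α ^ (0.2 : ℝ) < min (η / 2) 1 := by linarith [hsmall α hα l3]
  have s2 := hthr α hα (l5.trans_le (min_le_left _ _))
  have s3 := s1.trans_le (min_le_left _ _)
  have s4 := s1.trans_le (min_le_right _ _)
  obtain ⟨b1, b2, b3, b4⟩ := hb α hα l4.le
  set N := bindingTime a ξ₀ α with hNdef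
  have hNn := hn₁ N (hN α hα l2)
  have hsq : ∀ x : ℝ, |x| ≤ 2 * thr α → x ^ 2 ≤ α * (4 * α ^ (0.2 : ℝ)) := by
    intro x hx
    have : |x| ^ 2 ≤ (2 * thr α) ^ 2 := by gcongr
    rw [sq_abs, mul_pow, thr_sq hα] at this
    linarith
  have hsh : ∀ x : ℝ, |x| ≤ 2 * thr α → ∀ t : ℝ, ∀ i,
      fibOrb a d φ α x t (1 + i) ∈ shadow a α i := by
    intro x hx t i
    refine pseudo_mem_shadow hα (hps α hα l1 d φ hφ1 x (hx.trans s2.le) t) le_rfl ?_ i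
    have := hsq x hx
    have e : fibOrb a d φ α x t 0 = x := rfl
    rw [e]
    have : α * (4 * α ^ (0.2 : ℝ)) ≤ α * 1 := by gcongr
    linarith
  set y := fibOrb a d φ α x t with hy
  set y' := fibOrb a d φ α x' t' with hy'
  set z : ℕ → ℝ := fun i => (y (1 + i) + y' (1 + i)) / 2 with hz
  have hzs : ∀ i, z i ∈ shadow a α i := fun i =>
    midpoint_mem_shadow a hα (hsh x hx t i) (hsh x' hx' t' i)
  set P : ℕ → ℝ := fun n => ∏ i ∈ Finset.range n, -2 * z i with hP
  have hPabs : ∀ n ≤ N, Real.exp (-1) * |critD a n| ≤ |P n| := by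
    intro n hn
    refine (h.vprod_shadow hα hzs hn).trans (le_of_eq ?_)
    rw [vprod, hP, Finset.abs_prod]
    refine Finset.prod_congr rfl fun i _ => ?_
    rw [abs_mul]; norm_num
  have hPpos : ∀ n ≤ N, 0 < |P n| := fun n hn =>
    lt_of_lt_of_le (mul_pos (Real.exp_pos _) (h.abs_critD_pos n)) (hPabs n hn)
  have hPne : ∀ n ≤ N, P n ≠ 0 := fun n hn => abs_pos.1 (hPpos n hn)
  set s : ℕ → ℝ := fun n => φ (((d : ℝ) ^ n * t : ℝ) : UnitAddCircle) with hs
  set s' : ℕ → ℝ := fun n => φ (((d : ℝ) ^ n * t' : ℝ) : UnitAddCircle) with hs'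
  have rec1 : ∀ n, y (n + 1) = quad a (y n) + α * s n := fun n => by
    rw [hy, hs]; unfold fibOrb; rw [fib_succ, coe_pow_smul]
  have rec2 : ∀ n, y' (n + 1) = quad a (y' n) + α * s' n := fun n => by
    rw [hy', hs']; unfold fibOrb; rw [fib_succ, coe_pow_smul]
  have hdiff := sub_eq_of_perturbed rec1 rec2 P (by simp [hP]) (fun n => by
    rw [hP]; simp only [Finset.prod_range_succ]; rw [hz]; simp only; ring) hPne
  have hss : ∀ n, |s n - s' n| ≤ 2 := fun n => by
    have h1 := abs_sub (s n) (s' n)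
    have h2 := hφ1 (((d : ℝ) ^ n * t : ℝ) : UnitAddCircle)
    have h3 := hφ1 (((d : ℝ) ^ n * t' : ℝ) : UnitAddCircle)
    linarith
  have hD0 : critD a 0 = 1 := critD_zero a
  have hosum := h.osum_split hφ1 d 0 (N + 1) t
  have hosum' := h.osum_split hφ1 d 0 (N + 1) t'
  rw [Finset.sum_range_succ'] at hosum hosum'
  simp only [zero_add, hD0, div_one, one_mul] at hosum hosum'
  have e0 : φ (((d : ℝ) ^ 0 * t : ℝ) : UnitAddCircle) = s 0 := rfl
  have e0' : φ (((d : ℝ) ^ 0 * t' : ℝ) : UnitAddCircle) = s' 0 := rfl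
  rw [e0] at hosum
  rw [e0'] at hosum'
  have hy1 : y 1 - y' 1 = α * (s 0 - s' 0) + (x' ^ 2 - x ^ 2) := by
    have := rec1 0
    have := rec2 0
    have i1 : y 0 = x := rfl
    have i2 : y' 0 = x' := rfl
    rw [zero_add] at *
    rw [rec1 0, rec2 0, i1, i2]; unfold quad; ring
  -- the response minus the normalised difference at the end of the binding period
  have key : osum a d φ 0 t - osum a d φ 0 t' = (y (1 + N) - y' (1 + N)) / (α * P N) +
      (x ^ 2 - x' ^ 2) / α +
      ∑ i ∈ Finset.range N, (s (i + 1) - s' (i + 1)) * (1 / critD a (i + 1) - 1 / P (i + 1)) +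
      1 / critD a (N + 1) * (osum a d φ (N + 1) ((d : ℝ) ^ (N + 1) * t) -
        osum a d φ (N + 1) ((d : ℝ) ^ (N + 1) * t')) := by
    have q1 : (y (1 + N) - y' (1 + N)) / (α * P N) = (s 0 - s' 0) + (x' ^ 2 - x ^ 2) / α +
        ∑ i ∈ Finset.range N, (s (i + 1) - s' (i + 1)) / P (i + 1) := by
      rw [hdiff, hy1, mul_comm α (P N), mul_div_mul_left _ _ (hPne N le_rfl)]
      field_simp
    have q2 : ∑ i ∈ Finset.range N, (s (i + 1) - s' (i + 1)) *
        (1 / critD a (i + 1) - 1 / P (i + 1)) =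
        ∑ i ∈ Finset.range N, 1 / critD a (i + 1) * s (i + 1) -
        ∑ i ∈ Finset.range N, 1 / critD a (i + 1) * s' (i + 1) -
        ∑ i ∈ Finset.range N, (s (i + 1) - s' (i + 1)) / P (i + 1) := by
      rw [← Finset.sum_sub_distrib, ← Finset.sum_sub_distrib]
      refine Finset.sum_congr rfl fun i _ => by ring
    rw [q1, q2, hosum, hosum']
    simp only [hs, hs']
    ring
  have k1 : |(y (1 + N) - y' (1 + N)) / (α * P N)| ≤
      Real.exp 1 / c * |y (1 + N) - y' (1 + N)| := by
    rw [abs_div, abs_mul, abs_of_pos hα, div_mul_eq_mul_div,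
      div_le_div_iff₀ (mul_pos hα (hPpos N le_rfl)) hc]
    have := mul_le_mul_of_nonneg_left (hPabs N le_rfl) hα.le
    have e : c ≤ Real.exp 1 * (α * |P N|) := by
      calc c ≤ α * |critD a N| := b1
        _ = Real.exp 1 * (α * (Real.exp (-1) * |critD a N|)) := by
            rw [Real.exp_neg]; field_simp
        _ ≤ _ := by gcongr
    calc _ ≤ |y (1 + N) - y' (1 + N)| * (Real.exp 1 * (α * |P N|)) := by gcongr
      _ = _ := by ring
  have k2 : |(x ^ 2 - x' ^ 2) / α| ≤ η / 2 := by
    rw [abs_div, abs_of_pos hα, div_le_iff₀ hα, abs_le]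
    have := hsq x hx
    have := hsq x' hx'
    have : α * (4 * α ^ (0.2 : ℝ)) ≤ α * (η / 2) := by gcongr
    constructor <;> nlinarith [sq_nonneg x, sq_nonneg x']
  have k3 : |∑ i ∈ Finset.range N, (s (i + 1) - s' (i + 1)) *
      (1 / critD a (i + 1) - 1 / P (i + 1))| ≤ C₁ * (N * r⁻¹ ^ N) := by
    have hαr : α ≤ C * r⁻¹ ^ N := by
      rw [inv_pow, ← div_eq_mul_inv, le_div_iff₀ (by positivity)]; exact b2
    calc _ ≤ ∑ i ∈ Finset.range N, 2 * (Real.exp 1 * (C / ξ₀) * α) := by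
          refine (Finset.abs_sum_le_sum_abs _ _).trans (Finset.sum_le_sum fun i hi => ?_)
          have hi : i + 1 ≤ N := Finset.mem_range.1 hi
          have g1 := h.abs_prod_div_critD_sub_one hα hzs hi
          have g2 := b4 (i + 1) hi
          have hDne := h.critD_ne_zero (i + 1)
          have hDp := h.abs_critD_pos (i + 1)
          have e : 1 / critD a (i + 1) - 1 / P (i + 1) = (P (i + 1) / critD a (i + 1) - 1) /
              P (i + 1) := by
            have := hPne _ hi
            field_simp
          rw [abs_mul, e, abs_div]
          gcongr
          · exact hss _
          · rw [div_le_iff₀ (hPpos _ hi)]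
            refine g1.trans ?_
            rw [div_le_iff₀ hxi]
            refine g2.trans ?_
            calc C * (α * |critD a (i + 1)|) = Real.exp 1 * (C / ξ₀) * α *
                  (Real.exp (-1) * |critD a (i + 1)|) * ξ₀ := by
                  rw [Real.exp_neg]; field_simp
              _ ≤ _ := by gcongr; exact hPabs _ hi
      _ = 2 * (Real.exp 1 * (C / ξ₀)) * N * α := by
          rw [Finset.sum_const, Finset.card_range, nsmul_eq_mul]; ring
      _ ≤ 2 * (Real.exp 1 * (C / ξ₀)) * N * (C * r⁻¹ ^ N) := by gcongr
      _ = _ := by rw [hC₁]; ring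
  have k4 : |1 / critD a (N + 1) * (osum a d φ (N + 1) ((d : ℝ) ^ (N + 1) * t) -
      osum a d φ (N + 1) ((d : ℝ) ^ (N + 1) * t'))| ≤ 2 * B / (c * r ^ (1 + N)) := by
    rw [abs_mul, abs_div, abs_one, one_div_mul_eq_div, add_comm 1 N]
    have h1 := abs_sub (osum a d φ (N + 1) ((d : ℝ) ^ (N + 1) * t))
      (osum a d φ (N + 1) ((d : ℝ) ^ (N + 1) * t'))
    gcongr
    · linarith [hB (N + 1) ((d : ℝ) ^ (N + 1) * t), hB (N + 1) ((d : ℝ) ^ (N + 1) * t')]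
    · exact b3 _
  rw [key]
  refine (abs_add_le _ _).trans ?_
  refine (add_le_add_left (abs_add_le _ _) _).trans ?_
  refine (add_le_add_left (add_le_add_left (abs_add_le _ _) _) _).trans ?_
  linarith

end Setting

theorem finite_orb_preimage (a : ℝ) (n : ℕ) (w : ℝ) : {x | orb a x n = w}.Finite := by
  induction n with
  | zero => simp [orb_zero]
  | succ n ih =>
    have e : {x | orb a x (n + 1) = w} = quad a ⁻¹' {x | orb a x n = w} := by
      ext x
      rw [mem_preimage, mem_ofPred_eq, mem_ofPred_eq, add_comm, orb_add]
      rfl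
    rw [e]
    refine ih.preimage' fun b _ => ?_
    refine (Set.toFinite {Real.sqrt (a - b), -Real.sqrt (a - b)}).subset fun x hx => ?_
    have hx : a - x ^ 2 = b := hx
    have e : a - b = x ^ 2 := by linarith
    rw [e, Real.sqrt_sq_eq_abs]
    rcases abs_choice x with h | h
    · left; exact h.symm
    · right; rw [h, neg_neg]; rfl

namespace Setting

variable {a β ξ₀ : ℝ}

/-- A point whose orbit comes near the critical point within time `T` is near one of finitely many
preimages of the critical point; their number depends only on `T`. -/
theorem near_preimage (h : Setting a β ξ₀) (T : ℕ) : ∃ Z : Finset ℝ, ∀ δ > 0, ∃ α₀ > 0,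
    ∀ α x, 0 < α → α < α₀ → IsPseudo a β α x → ∀ n ≤ T, |x n| ≤ 2 * thr α →
      ∃ z ∈ Z, |x 0 - z| ≤ δ := by
  have hfin : (⋃ n ∈ Finset.range (T + 1), {x | orb a x n = 0}).Finite :=
    (Finset.range (T + 1)).finite_toSet.biUnion fun n _ => finite_orb_preimage a n 0
  refine ⟨hfin.toFinset, fun δ hδ => ?_⟩
  set Z := hfin.toFinset with hZ
  have hmem : ∀ n ≤ T, ∀ z, orb a z n = 0 → z ∈ Z := by
    intro n hn z hz
    rw [hZ, Set.Finite.mem_toFinset]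
    exact mem_biUnion (Finset.mem_range.2 (Nat.lt_succ_of_le hn)) hz
  set K : Set ℝ := Icc (-β) β ∩ ⋂ z ∈ Z, {x | δ ≤ |x - z|} with hK
  have hKc : IsCompact K := isCompact_Icc.inter_right
    (isClosed_biInter fun z _ => isClosed_le continuous_const (by fun_prop))
  have hpt : ∀ n ≤ T, ∃ ε > 0, ∀ x ∈ K, ε ≤ |orb a x n| := by
    intro n hn
    rcases K.eq_empty_or_nonempty with he | hne
    · exact ⟨1, one_pos, by simp [he]⟩
    · obtain ⟨x, hx, hmin⟩ := hKc.exists_isMinOn hne (continuous_orb a n).abs.continuousOn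
      refine ⟨|orb a x n|, abs_pos.2 fun h0 => ?_, fun y hy => hmin hy⟩
      have := (mem_iInter₂.1 hx.2) x (hmem n hn x h0)
      simp only [sub_self, abs_zero, mem_ofPred_eq] at this
      linarith
  have hunif : ∀ T' ≤ T, ∃ ε > 0, ∀ n ≤ T', ∀ x ∈ K, ε ≤ |orb a x n| := by
    intro T'
    induction T' with
    | zero =>
      intro _
      obtain ⟨ε, hε, hx⟩ := hpt 0 (by omega)
      exact ⟨ε, hε, fun n hn => by obtain rfl : n = 0 := by omega
                                   exact hx⟩
    | succ k ih =>
      intro hk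
      obtain ⟨ε, hε, hx⟩ := ih (by omega)
      obtain ⟨ε', hε', hx'⟩ := hpt (k + 1) hk
      refine ⟨min ε ε', by positivity, fun n hn x hxK => ?_⟩
      rcases Nat.le_succ_iff.1 hn with hn | rfl
      · exact (min_le_left _ _).trans (hx n hn x hxK)
      · exact (min_le_right _ _).trans (hx' x hxK)
  obtain ⟨ε, hε, hεK⟩ := hunif T le_rfl
  obtain ⟨α₁, hα₁, hclose⟩ := h.pseudo_close_uniform T (show 0 < ε / 2 by positivity)
  obtain ⟨α₂, hα₂, hsmall⟩ := exists_thr_lt (show 0 < ε / 2 by positivity)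
  refine ⟨min α₁ α₂, by positivity, fun α x hα hα' hx n hn hxn => ?_⟩
  have h1 := (hclose α x hα.le (hα'.trans_le (min_le_left _ _)) hx n hn).1
  have h2 := hsmall α hα (hα'.trans_le (min_le_right _ _))
  by_contra hcon
  push Not at hcon
  have hxK : x 0 ∈ K := ⟨abs_le.1 (hx 0).1, mem_iInter₂.2 fun z hz => (hcon z hz).le⟩
  have h3 := hεK n hn _ hxK
  have h4 := abs_sub_abs_le_abs_sub (orb a (x 0) n) (x n)
  rw [abs_sub_comm] at h4
  linarith

/-- After the binding period, only a small proportion of the points of a curve near the critical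
point return to the critical region within a given time. -/
theorem volume_return_le (h : Setting a β ξ₀) {d : ℕ} (hd : 2 ≤ d) {φ : UnitAddCircle → ℝ}
    (hφ1 : ∀ θ, |φ θ| ≤ 1) (hφ : IsRealAnalytic φ) (hφc : ¬ ∃ c : ℝ, ∀ θ, φ θ = c) (T : ℕ)
    {ε : ENNReal} (hε : 0 < ε) : ∃ α₀ > 0, ∀ α, 0 < α → α < α₀ →
      ∀ Y : ℝ → ℝ, (∀ t ∈ Ico (0 : ℝ) 1, |Y t| ≤ 2 * thr α) →
        volume {t | t ∈ Ico (0 : ℝ) 1 ∧ ∃ s ≤ T,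
          |fibOrb a d φ α (Y t) t (1 + bindingTime a ξ₀ α + s)| ≤ 2 * thr α} ≤ ε := by
  obtain ⟨Z, hZ⟩ := h.near_preimage T
  obtain ⟨C, hC, hcmp⟩ := h.osum_sub_le (d := d) hφ1
  set ε' : ENNReal := ε / (Z.card + 1) with hε'
  have hε'0 : 0 < ε' := ENNReal.div_pos hε.ne' (by finiteness)
  obtain ⟨η, hη, hvol⟩ := h.osum_nonconcentration hd hφ1 hφ hφc hε'0
  obtain ⟨α₁, hα₁, h1⟩ := hcmp (η / 4) (by positivity)
  obtain ⟨α₂, hα₂, h2⟩ := hZ (η / (8 * C)) (by positivity)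
  obtain ⟨α₃, hα₃, hps⟩ := h.isPseudo_fibOrb
  obtain ⟨α₄, hα₄, hsmall⟩ := exists_thr_lt h.beta_pos
  refine ⟨min (min α₁ α₂) (min α₃ α₄), by positivity, fun α hα hα' Y hY => ?_⟩
  have l1 : α < α₁ := hα'.trans_le ((min_le_left _ _).trans (min_le_left _ _))
  have l2 : α < α₂ := hα'.trans_le ((min_le_left _ _).trans (min_le_right _ _))
  have l3 : α < α₃ := hα'.trans_le ((min_le_right _ _).trans (min_le_left _ _))
  have l4 : α < α₄ := hα'.trans_le ((min_le_right _ _).trans (min_le_right _ _))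
  set N := bindingTime a ξ₀ α
  set A : ℝ → Set ℝ := fun z => {t | t ∈ Ico (0 : ℝ) 1 ∧
    |fibOrb a d φ α (Y t) t (1 + N) - z| ≤ η / (8 * C)} with hA
  have hAv : ∀ z, volume (A z) ≤ ε' := by
    intro z
    rcases (A z).eq_empty_or_nonempty with he | ⟨t', ht'⟩
    · rw [he, measure_empty]; exact bot_le
    refine (measure_mono fun t ht => ?_).trans (hvol (osum a d φ 0 t'))
    refine ⟨ht.1, ?_⟩
    have g1 := h1 α hα l1 t t' (Y t) (Y t') (hY t ht.1) (hY t' ht'.1)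
    have g2 : |fibOrb a d φ α (Y t) t (1 + N) - fibOrb a d φ α (Y t') t' (1 + N)| ≤
        η / (8 * C) + η / (8 * C) := by
      have := abs_sub_le (fibOrb a d φ α (Y t) t (1 + N)) z (fibOrb a d φ α (Y t') t' (1 + N))
      have e := ht'.2
      rw [abs_sub_comm] at e
      linarith [ht.2]
    have g3 : C * (η / (8 * C) + η / (8 * C)) = η / 4 := by field_simp; norm_num
    have g4 := mul_le_mul_of_nonneg_left g2 hC.le
    linarith
  have hsub : {t | t ∈ Ico (0 : ℝ) 1 ∧ ∃ s ≤ T,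
      |fibOrb a d φ α (Y t) t (1 + N + s)| ≤ 2 * thr α} ⊆ ⋃ z ∈ Z, A z := by
    rintro t ⟨ht, s, hs, hts⟩
    have hP := hps α hα l3 d φ hφ1 (Y t) ((hY t ht).trans (hsmall α hα l4).le) t
    obtain ⟨z, hz, hz'⟩ := h2 α _ hα l2 (hP.shift (1 + N)) s hs hts
    exact mem_biUnion hz ⟨ht, hz'⟩
  calc _ ≤ volume (⋃ z ∈ Z, A z) := measure_mono hsub
    _ ≤ ∑ z ∈ Z, volume (A z) := measure_biUnion_finset_le _ _
    _ ≤ ∑ z ∈ Z, ε' := Finset.sum_le_sum fun z _ => hAv z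
    _ = Z.card * ε' := by rw [Finset.sum_const, nsmul_eq_mul]
    _ ≤ (Z.card + 1) * ε' := by gcongr; exact le_self_add
    _ = ε := by
        rw [hε', ENNReal.mul_div_cancel (by simp) (by finiteness)]

end Setting

/-! ### Counting returns along cells -/

/-- The index of the cell of level `n` that contains `θ`. -/
def cellIdx (d n : ℕ) (θ : ℝ) : ℤ := ⌊(d : ℝ) ^ n * θ⌋

/-- The cell of level `n` and index `k`; all integer indices are allowed, so the cells of a given
level partition the whole line. -/
def icell (d n : ℕ) (k : ℤ) : Set ℝ := {θ | cellIdx d n θ = k}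

theorem cellIdx_of_add {d : ℕ} (hd : 2 ≤ d) (n m : ℕ) {θ θ' : ℝ}
    (h : cellIdx d (n + m) θ = cellIdx d (n + m) θ') : cellIdx d n θ = cellIdx d n θ' := by
  have hd0 : (0 : ℝ) < (d : ℝ) ^ m := by positivity
  have key : ∀ x y : ℝ, ⌊(d : ℝ) ^ m * x⌋ = ⌊(d : ℝ) ^ m * y⌋ → ⌊x⌋ ≤ ⌊y⌋ := by
    intro x y hxy
    rw [Int.le_floor]
    have h1 : (d : ℤ) ^ m * ⌊x⌋ ≤ ⌊(d : ℝ) ^ m * x⌋ := by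
      rw [Int.le_floor]; push_cast
      gcongr; exact Int.floor_le x
    rw [hxy, Int.le_floor] at h1
    push_cast at h1
    exact le_of_mul_le_mul_left h1 hd0
  unfold cellIdx at *
  rw [pow_add, mul_comm ((d : ℝ) ^ n), mul_assoc, mul_assoc] at h
  exact le_antisymm (key _ _ h) (key _ _ h.symm)

theorem measurable_cellIdx (d n : ℕ) : Measurable (cellIdx d n) :=
  Int.measurable_floor.comp (measurable_const.mul measurable_id)

theorem measurableSet_icell (d n : ℕ) (k : ℤ) : MeasurableSet (icell d n k) :=
  measurable_cellIdx d n (measurableSet_singleton k)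

/-- A set that is a union of cells of level `n`. -/
def IsCellUnion (d n : ℕ) (S : Set ℝ) : Prop :=
  ∀ θ θ', cellIdx d n θ = cellIdx d n θ' → θ ∈ S → θ' ∈ S

theorem isCellUnion_icell (d n : ℕ) (k : ℤ) : IsCellUnion d n (icell d n k) :=
  fun _ _ h hθ => h.symm.trans hθ

theorem IsCellUnion.add {d n : ℕ} {S : Set ℝ} (hS : IsCellUnion d n S) (hd : 2 ≤ d) (m : ℕ) :
    IsCellUnion d (n + m) S := fun θ θ' h => hS θ θ' (cellIdx_of_add hd n m h)

theorem IsCellUnion.eq_biUnion {d n : ℕ} {S : Set ℝ} (hS : IsCellUnion d n S) :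
    S = ⋃ k ∈ cellIdx d n '' S, icell d n k := by
  ext θ
  simp only [mem_iUnion, icell, mem_ofPred_eq, exists_prop]
  constructor
  · intro h; exact ⟨_, mem_image_of_mem _ h, rfl⟩
  · rintro ⟨k, ⟨θ', h', rfl⟩, h⟩; exact hS θ' θ h.symm h'

theorem IsCellUnion.measurableSet {d n : ℕ} {S : Set ℝ} (hS : IsCellUnion d n S) :
    MeasurableSet S := by
  rw [hS.eq_biUnion]
  exact MeasurableSet.biUnion (to_countable _) fun k _ => measurableSet_icell d n k

/-- An upper bound for the mean over each cell is one for the mean over unions of cells. -/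
theorem IsCellUnion.lintegral_le {d n : ℕ} {S : Set ℝ} (hS : IsCellUnion d n S) {f : ℝ → ENNReal}
    {c : ENNReal} (hf : ∀ k, ∫⁻ θ in icell d n k, f θ ≤ c * volume (icell d n k)) :
    ∫⁻ θ in S, f θ ≤ c * volume S := by
  have hdis : (cellIdx d n '' S).PairwiseDisjoint (icell d n) := by
    intro k _ l _ hkl
    rw [Function.onFun, Set.disjoint_left]
    intro θ h1 h2
    exact hkl (h1.symm.trans h2)
  have hm : ∀ k ∈ cellIdx d n '' S, MeasurableSet (icell d n k) :=
    fun k _ => measurableSet_icell d n k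
  rw [hS.eq_biUnion, lintegral_biUnion (to_countable _) hm hdis,
    measure_biUnion (to_countable _) hdis hm, ← ENNReal.tsum_mul_left]
  exact ENNReal.tsum_le_tsum fun k => hf k

open Classical in
/-- The number of `i < m` with `θ ∈ R_{n+i}`. -/
def hits (R : ℕ → Set ℝ) (n m : ℕ) (θ : ℝ) : ℕ :=
  ∑ i ∈ Finset.range m, if θ ∈ R (n + i) then 1 else 0

theorem hits_add (R : ℕ → Set ℝ) (n m m' : ℕ) (θ : ℝ) :
    hits R n (m + m') θ = hits R n m θ + hits R (n + m) m' θ := by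
  unfold hits
  rw [Finset.sum_range_add]
  congr 1
  exact Finset.sum_congr rfl fun i _ => by rw [add_assoc]

theorem measurable_hits {R : ℕ → Set ℝ} (hR : ∀ i, MeasurableSet (R i)) (n m : ℕ) :
    Measurable (hits R n m) := by
  unfold hits
  exact Finset.measurable_sum _ fun i _ =>
    Measurable.ite (hR _) measurable_const measurable_const

theorem hits_one_of_notMem {R : ℕ → Set ℝ} {n : ℕ} {θ : ℝ} (h : θ ∉ R n) : hits R n 1 θ = 0 := by
  simp [hits, h]

theorem hits_one_le (R : ℕ → Set ℝ) (n : ℕ) (θ : ℝ) : hits R n 1 θ ≤ 1 := by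
  simp only [hits, Finset.sum_range_one]
  split_ifs <;> simp

theorem hits_eq_zero {R : ℕ → Set ℝ} {n m : ℕ} {θ : ℝ} (h : ∀ i < m, θ ∉ R (n + i)) :
    hits R n m θ = 0 :=
  Finset.sum_eq_zero fun i hi => if_neg (h i (Finset.mem_range.1 hi))

theorem hits_mono (R : ℕ → Set ℝ) (n : ℕ) {m m' : ℕ} (h : m ≤ m') (θ : ℝ) :
    hits R n m θ ≤ hits R n m' θ := by
  obtain ⟨k, rfl⟩ := Nat.exists_eq_add_of_le h
  rw [hits_add]; exact Nat.le_add_right _ _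

/-- If hits are more than `N` steps apart then `N + 1` consecutive times contain at most one. -/
theorem hits_le_one {R : ℕ → Set ℝ} {N : ℕ}
    (sep : ∀ n θ, θ ∈ R n → ∀ i, 1 ≤ i → i ≤ N → θ ∉ R (n + i)) (n : ℕ) {m : ℕ} (hm : m ≤ N + 1)
    (θ : ℝ) : hits R n m θ ≤ 1 := by
  induction m generalizing n with
  | zero => simp [hits]
  | succ m ih =>
    rw [add_comm m 1, hits_add]
    by_cases h : θ ∈ R n
    · have : hits R (n + 1) m θ = 0 := hits_eq_zero fun i hi => by
        rw [add_assoc]; exact sep n θ h (1 + i) (by omega) (by omega)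
      have := hits_one_le R n θ
      omega
    · rw [hits_one_of_notMem h, zero_add]
      exact ih (n + 1) (by omega)

theorem hits_le_two {R : ℕ → Set ℝ} {N : ℕ}
    (sep : ∀ n θ, θ ∈ R n → ∀ i, 1 ≤ i → i ≤ N → θ ∉ R (n + i)) (n : ℕ) {m : ℕ}
    (hm : m ≤ 2 * N + 2) (θ : ℝ) : hits R n m θ ≤ 2 := by
  refine (hits_mono R n hm θ).trans ?_
  rw [show 2 * N + 2 = (N + 1) + (N + 1) by ring, hits_add]
  have h1 := hits_le_one sep n le_rfl θ
  have h2 := hits_le_one sep (n + (N + 1)) le_rfl θ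
  omega

/-- Exponential moments of the number of hits. Hits are assumed to be more than `N` steps apart
on each point, and after a hit by a cell the proportion of its subcells that are hit again between
times `N + 1` and `N + 1 + 2T` is at most `2^{-2T-1}`; then hits occur on average not much more
often than every `N + 1 + T` steps. -/
theorem lintegral_hits_le {d : ℕ} (hd : 2 ≤ d) {R : ℕ → Set ℝ} {N T : ℕ} (hT : 2 * T ≤ N)
    {ε : ENNReal} (hε : ε * 2 ^ (2 * T) ≤ 2⁻¹)
    (sep : ∀ n k, (icell d n k ∩ R n).Nonempty → ∀ θ ∈ icell d n k, ∀ i, 1 ≤ i → i ≤ N →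
      θ ∉ R (n + i))
    (bad : ∀ n k, (icell d n k ∩ R n).Nonempty →
      volume {θ | θ ∈ icell d n k ∧ ∃ s ≤ 2 * T, ∃ θ',
        cellIdx d (n + (N + 2 + 2 * T)) θ' = cellIdx d (n + (N + 2 + 2 * T)) θ ∧
        θ' ∈ R (n + (N + 1 + s))} ≤ ε * volume (icell d n k)) (m : ℕ) :
    ∀ n k, ∫⁻ θ in icell d n k, 2 ^ ((N + 1 + T) * hits R n m θ) ≤
      2 ^ (2 * (N + 1 + T)) * 2 ^ m * volume (icell d n k) := by
  have sep' : ∀ n θ, θ ∈ R n → ∀ i, 1 ≤ i → i ≤ N → θ ∉ R (n + i) := fun n θ h =>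
    sep n (cellIdx d n θ) ⟨θ, rfl, h⟩ θ rfl
  set H := N + 1 + T with hH
  set w := N + 2 + 2 * T with hw
  have h2 : (1 : ENNReal) ≤ 2 := by norm_num
  have h2t : (2 : ENNReal) ≠ ⊤ := by norm_num
  have h20 : (2 : ENNReal) ≠ 0 := by norm_num
  induction m using Nat.strong_induction_on with
  | _ m ih =>
  intro n k
  by_cases hm : m ≤ 2 * N + 2
  · calc ∫⁻ θ in icell d n k, (2 : ENNReal) ^ (H * hits R n m θ)
        ≤ ∫⁻ θ in icell d n k, (2 : ENNReal) ^ (2 * H) := by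
          refine lintegral_mono fun θ => pow_le_pow_right₀ h2 ?_
          rw [mul_comm 2]
          exact Nat.mul_le_mul_left _ (hits_le_two sep' n hm θ)
      _ = 2 ^ (2 * H) * 1 * volume (icell d n k) := by rw [setLIntegral_const, mul_one]
      _ ≤ _ := by gcongr; exact one_le_pow₀ h2
  push Not at hm
  -- a union of cells of level `n + p` on which there are at most `q` hits before time `p`
  have step : ∀ p q, 1 ≤ p → p ≤ m → ∀ S : Set ℝ, IsCellUnion d (n + p) S →
      (∀ θ ∈ S, hits R n p θ ≤ q) → ∫⁻ θ in S, (2 : ENNReal) ^ (H * hits R n m θ) ≤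
        2 ^ (H * q) * (2 ^ (2 * H) * 2 ^ (m - p) * volume S) := by
    intro p q hp hpm S hS hq
    calc ∫⁻ θ in S, (2 : ENNReal) ^ (H * hits R n m θ)
        ≤ ∫⁻ θ in S, 2 ^ (H * q) * (2 : ENNReal) ^ (H * hits R (n + p) (m - p) θ) := by
          refine setLIntegral_mono' hS.measurableSet fun θ hθ => ?_
          rw [← pow_add, ← mul_add]
          refine pow_le_pow_right₀ h2 (Nat.mul_le_mul_left _ ?_)
          nth_rewrite 1 [← Nat.add_sub_cancel' hpm]
          rw [hits_add]
          exact Nat.add_le_add_right (hq θ hθ) _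
      _ = 2 ^ (H * q) * ∫⁻ θ in S, (2 : ENNReal) ^ (H * hits R (n + p) (m - p) θ) :=
          lintegral_const_mul' _ _ (ENNReal.pow_ne_top h2t)
      _ ≤ _ := by
          gcongr
          exact hS.lintegral_le (ih (m - p) (by omega) (n + p))
  by_cases hret : (icell d n k ∩ R n).Nonempty
  · set S : Set ℝ := {θ | θ ∈ icell d n k ∧ ∃ s ≤ 2 * T, ∃ θ',
      cellIdx d (n + w) θ' = cellIdx d (n + w) θ ∧ θ' ∈ R (n + (N + 1 + s))} with hS
    have hSu : IsCellUnion d (n + w) S := by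
      rintro θ₁ θ₂ h12 ⟨h1, s, hs, θ', h', hR'⟩
      exact ⟨(isCellUnion_icell d n k).add hd w θ₁ θ₂ h12 h1, s, hs, θ', h'.trans h12, hR'⟩
    have hGu : IsCellUnion d (n + w) (icell d n k \ S) := by
      rintro θ₁ θ₂ h12 ⟨h1, hn⟩
      exact ⟨(isCellUnion_icell d n k).add hd w θ₁ θ₂ h12 h1,
        fun h2 => hn (hSu θ₂ θ₁ h12.symm h2)⟩
    have hSsub : S ⊆ icell d n k := fun θ h => h.1
    have hgood : ∀ θ ∈ icell d n k \ S, hits R n w θ ≤ 1 := by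
      rintro θ ⟨h1, hn⟩
      rw [hw, show N + 2 + 2 * T = 1 + (N + 1 + 2 * T) by ring, hits_add,
        hits_eq_zero (m := N + 1 + 2 * T), add_zero]
      · exact hits_one_le R n θ
      intro i hi
      rw [add_assoc]
      by_cases hiN : 1 + i ≤ N
      · exact sep n k hret θ h1 (1 + i) (by omega) hiN
      · intro hθ
        refine hn ⟨h1, i - N, by omega, θ, rfl, ?_⟩
        rwa [show N + 1 + (i - N) = 1 + i by omega]
    have hbadU : IsCellUnion d (n + (2 * N + 2)) S := by
      have := hSu.add hd (2 * N + 2 - w)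
      rwa [show n + w + (2 * N + 2 - w) = n + (2 * N + 2) by omega] at this
    have i1 := step w 1 (by omega) (by omega) _ hGu hgood
    have i2 := step (2 * N + 2) 2 (by omega) hm.le _ hbadU
      fun θ _ => hits_le_two sep' n le_rfl θ
    have hvS : volume S ≤ ε * volume (icell d n k) := bad n k hret
    have hvG : volume (icell d n k \ S) ≤ volume (icell d n k) := measure_mono sdiff_subset
    set V := volume (icell d n k)
    set c : ENNReal := 2 ^ (2 * H) with hc
    -- the exponents are such that each of the two parts contributes at most one half
    have e1 : (2 : ENNReal) ^ (H * 1) * 2 ^ (m - w) ≤ 2⁻¹ * 2 ^ m := by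
      rw [← pow_add, ← ENNReal.div_eq_inv_mul, ENNReal.le_div_iff_mul_le (Or.inl h20) (Or.inl h2t),
        ← pow_succ]
      exact pow_le_pow_right₀ h2 (by omega)
    have e2 : (2 : ENNReal) ^ (H * 2) * 2 ^ (m - (2 * N + 2)) = 2 ^ (2 * T) * 2 ^ m := by
      rw [← pow_add, ← pow_add]
      congr 1
      omega
    calc ∫⁻ θ in icell d n k, (2 : ENNReal) ^ (H * hits R n m θ)
        = ∫⁻ θ in (icell d n k \ S) ∪ S, (2 : ENNReal) ^ (H * hits R n m θ) := by
          rw [sdiff_union_of_subset hSsub]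
      _ ≤ 2 ^ (H * 1) * (c * 2 ^ (m - w) * V) +
          2 ^ (H * 2) * (c * 2 ^ (m - (2 * N + 2)) * (ε * V)) := by
          refine (lintegral_union_le _ _ _).trans (add_le_add (i1.trans ?_) (i2.trans ?_)) <;> gcongr
      _ = (2 ^ (H * 1) * 2 ^ (m - w)) * (c * V) +
          ε * (2 ^ (H * 2) * 2 ^ (m - (2 * N + 2))) * (c * V) := by ring
      _ ≤ (2⁻¹ * 2 ^ m) * (c * V) + (2⁻¹ * 2 ^ m) * (c * V) := by
          rw [e2, ← mul_assoc ε]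
          gcongr
      _ = (2⁻¹ + 2⁻¹) * (c * 2 ^ m * V) := by ring
      _ = c * 2 ^ m * V := by rw [ENNReal.inv_two_add_inv_two, one_mul]
  · have i1 := step 1 0 le_rfl (by omega) (icell d n k) ((isCellUnion_icell d n k).add hd 1)
      fun θ hθ => (hits_one_of_notMem fun hR => hret ⟨θ, hθ, hR⟩).le
    refine i1.trans ?_
    rw [mul_zero, pow_zero, one_mul]
    gcongr
    exact m.sub_le 1

/-- If the exponential moments with exponent `H` grow at most like `2^m`, then almost surely the
number of hits before time `m` is eventually at most `(1 + 1/N) m / H`. -/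
theorem ae_hits_le {R : ℕ → Set ℝ} (hR : ∀ i, MeasurableSet (R i)) {n N H : ℕ} (hN : 1 ≤ N)
    {A : Set ℝ} {C : ENNReal} (hC : C ≠ ⊤)
    (hA : ∀ m, ∫⁻ θ in A, 2 ^ (H * hits R n m θ) ≤ C * 2 ^ m) :
    ∀ᵐ θ ∂volume.restrict A, ∀ᶠ m : ℕ in atTop,
      (H : ℝ) * hits R n m θ ≤ (1 + 1 / N) * m := by
  set ρ : ENNReal := 2 ^ (1 / (N : ℝ)) with hρ
  have hN0 : (0 : ℝ) < N := by exact_mod_cast hN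
  have hρ1 : 1 < ρ := ENNReal.one_lt_rpow (by norm_num) (by positivity)
  have hρt : ρ ≠ ⊤ := ENNReal.rpow_ne_top_of_nonneg (by positivity) (by norm_num)
  have hρ0 : ρ ≠ 0 := (zero_lt_one.trans hρ1).ne'
  have hpow : ∀ m : ℕ, ρ ^ m * 2 ^ m = (2 : ENNReal) ^ ((1 + 1 / (N : ℝ)) * m) := by
    intro m
    rw [hρ, ← ENNReal.rpow_natCast, ← ENNReal.rpow_mul, ← ENNReal.rpow_natCast,
      ← ENNReal.rpow_add _ _ (by norm_num) (by norm_num)]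
    congr 1; ring
  have hmeas : ∀ m, Measurable fun θ => (2 : ENNReal) ^ (H * hits R n m θ) := fun m =>
    (Measurable.of_discrete (f := fun k : ℕ => (2 : ENNReal) ^ (H * k))).comp
      (measurable_hits hR n m)
  set E : ℕ → Set ℝ := fun m => {θ | ρ ^ m * 2 ^ m ≤ 2 ^ (H * hits R n m θ)} with hE
  have hEv : ∀ m, volume.restrict A (E m) ≤ C * ρ⁻¹ ^ m := by
    intro m
    have h1 := (mul_meas_ge_le_lintegral (μ := volume.restrict A) (hmeas m) (ρ ^ m * 2 ^ m)).trans
      (hA m)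
    have hp0 : ρ ^ m ≠ 0 := pow_ne_zero _ hρ0
    have hpt : ρ ^ m ≠ ⊤ := ENNReal.pow_ne_top hρt
    have h20 : (2 : ENNReal) ^ m ≠ 0 := pow_ne_zero _ (by norm_num)
    have h2t : (2 : ENNReal) ^ m ≠ ⊤ := ENNReal.pow_ne_top (by norm_num)
    rw [mul_right_comm, ENNReal.mul_le_mul_iff_left h20 h2t] at h1
    rw [← ENNReal.inv_pow, ← div_eq_mul_inv, ENNReal.le_div_iff_mul_le (Or.inl hp0) (Or.inl hpt),
      mul_comm]
    exact h1
  have hsum : ∑' m, volume.restrict A (E m) ≠ ⊤ := by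
    refine ne_top_of_le_ne_top ?_ (ENNReal.tsum_le_tsum hEv)
    rw [ENNReal.tsum_mul_left, ENNReal.tsum_geometric]
    refine ENNReal.mul_ne_top hC (ENNReal.inv_ne_top.2 ?_)
    exact (tsub_pos_of_lt (ENNReal.inv_lt_one.2 hρ1)).ne'
  filter_upwards [ae_eventually_notMem hsum] with θ hθ
  filter_upwards [hθ] with m hm
  by_contra hcon
  push Not at hcon
  refine hm ?_
  rw [hE, mem_ofPred_eq, hpow, ← ENNReal.rpow_natCast]
  refine ENNReal.rpow_le_rpow_of_exponent_le (by norm_num) ?_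
  push_cast
  exact hcon.le

/-! ### Frequency of returns -/

theorem continuous_fibOrb {φ : UnitAddCircle → ℝ} (hφ : IsRealAnalytic φ) (a : ℝ) (d : ℕ)
    (α x : ℝ) (n : ℕ) : Continuous fun t : ℝ => fibOrb a d φ α x t n := by
  have hc : Continuous fun t : ℝ => φ (t : UnitAddCircle) := by
    rw [← continuousOn_univ]; exact hφ.continuousOn
  induction n with
  | zero => exact continuous_const
  | succ n ih =>
    have e : (fun t : ℝ => fibOrb a d φ α x t (n + 1)) = fun t : ℝ =>
        quad a (fibOrb a d φ α x t n) + α * φ (((d : ℝ) ^ n * t : ℝ) : UnitAddCircle) := by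
      funext t
      unfold fibOrb
      rw [fib_succ, coe_pow_smul]
    rw [e]
    exact ((continuous_quad a).comp ih).add
      (continuous_const.mul (hc.comp (continuous_const.mul continuous_id)))

theorem mem_icell_iff (d n : ℕ) (k : ℤ) (θ : ℝ) :
    θ ∈ icell d n k ↔ (d : ℝ) ^ n * θ - k ∈ Ico (0 : ℝ) 1 := by
  rw [icell, mem_ofPred_eq, cellIdx, Int.floor_eq_iff, mem_Ico]
  constructor <;> rintro ⟨h1, h2⟩ <;> constructor <;> linarith

theorem volume_affine_preimage {d : ℕ} (hd : 2 ≤ d) (n : ℕ) (k : ℤ) (B : Set ℝ) :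
    volume ((fun θ : ℝ => (d : ℝ) ^ n * θ - k) ⁻¹' B) =
      ENNReal.ofReal (((d : ℝ) ^ n)⁻¹) * volume B := by
  have hd0 : (0 : ℝ) < (d : ℝ) ^ n := by positivity
  have e : (fun θ : ℝ => (d : ℝ) ^ n * θ - k) ⁻¹' B =
      (fun θ : ℝ => (d : ℝ) ^ n * θ) ⁻¹' ((fun u : ℝ => u + -(k : ℝ)) ⁻¹' B) := by
    ext θ; simp [sub_eq_add_neg]
  rw [e, Real.volume_preimage_mul_left hd0.ne', measure_preimage_add_right,
    abs_of_pos (by positivity)]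

theorem volume_icell {d : ℕ} (hd : 2 ≤ d) (n : ℕ) (k : ℤ) :
    volume (icell d n k) = ENNReal.ofReal (((d : ℝ) ^ n)⁻¹) := by
  have e : icell d n k = (fun θ : ℝ => (d : ℝ) ^ n * θ - k) ⁻¹' Ico 0 1 := by
    ext θ; exact mem_icell_iff d n k θ
  rw [e, volume_affine_preimage hd]
  simp

theorem abs_sub_le_of_cellIdx_eq {d n : ℕ} {θ θ' : ℝ} (h : cellIdx d n θ = cellIdx d n θ') :
    (d : ℝ) ^ n * |θ - θ'| ≤ 1 := by
  have := Int.abs_sub_lt_one_of_floor_eq_floor h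
  rw [← mul_sub, abs_mul, abs_of_nonneg (by positivity)] at this
  exact this.le

/-- The fibre dynamics over a cell of level `n`, rescaled to the unit interval. -/
theorem fibOrb_add_eq (a : ℝ) {d : ℕ} (φ : UnitAddCircle → ℝ) (α x : ℝ) (n i : ℕ) (k : ℤ) (θ : ℝ) :
    fibOrb a d φ α x θ (n + i) =
      fibOrb a d φ α (fibOrb a d φ α x θ n) (((d : ℝ) ^ n * θ - k : ℝ) : UnitAddCircle) i := by
  unfold fibOrb
  rw [fib_add, coe_pow_smul, sub_eq_add_neg, ← Int.cast_neg]
  exact (phi_add_int (fun ϑ => fib a d φ α i ϑ (fib a d φ α n θ x)) _ (-k)).symm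

namespace Setting

variable {a β ξ₀ : ℝ}

/-- The counting estimate applies to the returns of the fibre orbits of a point `x`: almost
surely, returns occur at most about once every `N(α) + 1 + T` steps. -/
theorem ae_returns_le (h : Setting a β ξ₀) {d : ℕ} (hd : 2 ≤ d) {φ : UnitAddCircle → ℝ}
    (hφ1 : ∀ θ, |φ θ| ≤ 1) (hφ : IsRealAnalytic φ) (hφc : ¬ ∃ c : ℝ, ∀ θ, φ θ = c) (T : ℕ) :
    ∃ α₀ > 0, ∀ α, 0 < α → α < α₀ → ∀ x, |x| ≤ β → ∀ (n : ℕ) (k : ℤ),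
      ∀ᵐ θ : ℝ ∂volume.restrict (icell d n k), ∀ᶠ m : ℕ in atTop,
        ((bindingTime a ξ₀ α + 1 + T : ℕ) : ℝ) *
          returns α (fun i => fibOrb a d φ α x θ (n + i)) m ≤
          (1 + 1 / (bindingTime a ξ₀ α : ℝ)) * m := by
  set ε : ENNReal := (2 ^ (2 * T + 1))⁻¹ with hε
  have hε0 : 0 < ε := ENNReal.inv_pos.2 (ENNReal.pow_ne_top (by norm_num))
  have hεT : ε * 2 ^ (2 * T) ≤ 2⁻¹ := by
    rw [hε, pow_succ, ENNReal.mul_inv (Or.inr (by norm_num)) (Or.inr (by norm_num)),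
      mul_right_comm, ENNReal.inv_mul_cancel (pow_ne_zero _ (by norm_num))
        (ENNReal.pow_ne_top (by norm_num)), one_mul]
  obtain ⟨α₁, hα₁, hvol⟩ := h.volume_return_le hd hφ1 hφ hφc (2 * T) hε0
  obtain ⟨K, hK, α₂, hα₂, hlip⟩ := h.fibOrb_lipschitz hd hφ hφ1
  obtain ⟨α₃, hα₃, hps⟩ := h.isPseudo_fibOrb
  obtain ⟨α₄, hα₄, hNT⟩ := h.exists_le_bindingTime (2 * T + 1)
  obtain ⟨α₅, hα₅, hs5⟩ := exists_rpow_lt (s := 0.4) (by norm_num) (inv_pos.2 hK)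
  obtain ⟨α₆, hα₆, hs6⟩ := exists_rpow_lt (s := 0.2) (b := 1 / 4) (by norm_num) (by norm_num)
  obtain ⟨α₇, hα₇, hs7⟩ := exists_thr_lt h.xi_pos
  refine ⟨min (min (min α₁ α₂) (min α₃ α₄)) (min α₅ (min α₆ α₇)), by positivity,
    fun α hα hα' x hx n k => ?_⟩
  simp only [lt_min_iff] at hα'
  obtain ⟨⟨⟨l1, l2⟩, l3, l4⟩, l5, l6, l7⟩ := hα'
  have hKα : K * α ≤ thr α := by
    have e : α = α ^ (0.4 : ℝ) * thr α := by
      rw [thr, ← Real.rpow_add hα]; norm_num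
    have h1 := (hs5 α hα l5).le
    have h2 := thr_pos hα
    calc K * α = K * (α ^ (0.4 : ℝ) * thr α) := by rw [← e]
      _ ≤ K * (K⁻¹ * thr α) := by gcongr
      _ = thr α := by field_simp
  set N := bindingTime a ξ₀ α with hN
  have hNT := hNT α hα l4
  set R : ℕ → Set ℝ := fun i => {θ | |fibOrb a d φ α x θ i| ≤ thr α} with hR
  have hRm : ∀ i, MeasurableSet (R i) := fun i =>
    (isClosed_le (continuous_fibOrb hφ a d α x i).abs continuous_const).measurableSet
  -- images of cells are nearly horizontal, so that a return of one point nearly is one of all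
  have hosc : ∀ (i p : ℕ) (θ θ' : ℝ), i ≤ p → cellIdx d p θ' = cellIdx d p θ → θ' ∈ R i →
      |fibOrb a d φ α x θ i| ≤ 2 * thr α := by
    intro i p θ θ' hip hidx hθ'
    have h1 := hlip α hα l2 x hx i θ θ'
    have h2 := abs_sub_le_of_cellIdx_eq hidx.symm
    have h3 : (d : ℝ) ^ i * |θ - θ'| ≤ 1 := by
      refine le_trans ?_ h2
      gcongr
      exact_mod_cast (by omega : 1 ≤ d)
    have h4 : K * α * ((d : ℝ) ^ i * |θ - θ'|) ≤ K * α * 1 := by gcongr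
    have h5 : |fibOrb a d φ α x θ' i| ≤ thr α := hθ'
    have h6 := abs_sub_abs_le_abs_sub (fibOrb a d φ α x θ i) (fibOrb a d φ α x θ' i)
    linarith
  have hnear : ∀ n k, (icell d n k ∩ R n).Nonempty → ∀ θ ∈ icell d n k,
      |fibOrb a d φ α x θ n| ≤ 2 * thr α := by
    rintro n k ⟨θ', h1, h2⟩ θ hθ
    exact hosc n n θ θ' le_rfl (h1.trans hθ.symm) h2
  have hsep : ∀ n k, (icell d n k ∩ R n).Nonempty → ∀ θ ∈ icell d n k, ∀ i, 1 ≤ i → i ≤ N →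
      θ ∉ R (n + i) := by
    intro n k hne θ hθ i hi hiN hRi
    have hP := (hps α hα l3 d φ hφ1 x hx θ).shift n
    have h1 := hnear n k hne θ hθ
    have h2 := pseudo_mem_shadow hα hP le_rfl (by
      have h3 : |fibOrb a d φ α x θ n| ^ 2 ≤ (2 * thr α) ^ 2 := by gcongr
      rw [sq_abs, mul_pow, thr_sq hα] at h3
      have h4 : α * α ^ (0.2 : ℝ) ≤ α * (1 / 4) := by gcongr; exact (hs6 α hα l6).le
      rw [add_zero]
      linarith) (i - 1)
    rw [Nat.add_sub_cancel' hi] at h2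
    have h3 := h.le_abs_of_mem_shadow hα (show i - 1 < bindingTime a ξ₀ α by omega) h2
    have h4 : |fibOrb a d φ α x θ (n + i)| ≤ thr α := hRi
    have h5 := hs7 α hα l7
    have h6 := thr_pos hα
    linarith
  have hbad : ∀ n k, (icell d n k ∩ R n).Nonempty →
      volume {θ | θ ∈ icell d n k ∧ ∃ s ≤ 2 * T, ∃ θ',
        cellIdx d (n + (N + 2 + 2 * T)) θ' = cellIdx d (n + (N + 2 + 2 * T)) θ ∧
        θ' ∈ R (n + (N + 1 + s))} ≤ ε * volume (icell d n k) := by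
    intro n k hne
    have hd0 : (0 : ℝ) < (d : ℝ) ^ n := by positivity
    set Y : ℝ → ℝ := fun t => fibOrb a d φ α x (((t + k) / (d : ℝ) ^ n : ℝ) : UnitAddCircle) n
      with hY
    have hYθ : ∀ θ : ℝ, Y ((d : ℝ) ^ n * θ - k) = fibOrb a d φ α x θ n := fun θ => by
      rw [hY]; simp only; rw [sub_add_cancel, mul_div_cancel_left₀ _ hd0.ne']
    have hYle : ∀ t ∈ Ico (0 : ℝ) 1, |Y t| ≤ 2 * thr α := by
      intro t ht
      refine hnear n k hne _ ?_
      rw [mem_icell_iff, mul_div_cancel₀ _ hd0.ne', add_sub_cancel_right]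
      exact ht
    have hv := hvol α hα l1 Y hYle
    rw [volume_icell hd, mul_comm ε]
    refine le_trans (measure_mono ?_) ((volume_affine_preimage hd n k _).trans_le
      (mul_le_mul_right hv _))
    rintro θ ⟨h1, s, hs, θ', h2, h3⟩
    refine ⟨(mem_icell_iff d n k θ).1 h1, s, hs, ?_⟩
    rw [hYθ, ← fibOrb_add_eq, add_comm 1]
    exact hosc _ _ θ θ' (by omega) h2 h3
  have hcount := lintegral_hits_le hd (show 2 * T ≤ N by omega) hεT hsep hbad
  have hC : (2 : ENNReal) ^ (2 * (N + 1 + T)) * volume (icell d n k) ≠ ⊤ := by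
    rw [volume_icell hd]
    exact ENNReal.mul_ne_top (ENNReal.pow_ne_top (by norm_num)) ENNReal.ofReal_ne_top
  have hae := ae_hits_le hRm (show 1 ≤ N by omega) hC fun m => (hcount m n k).trans_eq (by ring)
  filter_upwards [hae] with θ hθ
  filter_upwards [hθ] with m hm
  have e : returns α (fun i => fibOrb a d φ α x θ (n + i)) m = hits R n m θ := by
    unfold returns hits
    refine Finset.sum_congr rfl fun i _ => ?_
    simp only [hR, mem_ofPred_eq]
  rw [e]
  exact hm

/-- If returns are rare enough then the truncated derivative grows at the rate `M / N`. -/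
theorem _root_.VianaMap.eventually_le_of_rare {lam C c : ℝ} (hlam : 1 < lam) (hC : 0 < C)
    (hc : 0 < c) {N M T C' : ℕ} (hC' : C ≤ lam ^ C') (hN : 1 ≤ N)
    (hgap : ((N : ℝ) + 1 + C') * (N + 1) < ((N + 1 + T : ℕ) : ℝ) * (N - M)) {u : ℕ → ℝ} {k : ℕ → ℕ}
    (hu0 : ∀ m, 0 < u m) (hu : ∀ m, c * lam ^ m ≤ u m * (C * lam ^ (N + 1)) ^ k m)
    (hk : ∀ᶠ m : ℕ in atTop, ((N + 1 + T : ℕ) : ℝ) * k m ≤ (1 + 1 / (N : ℝ)) * m) :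
    ∀ᶠ m : ℕ in atTop, lam ^ ((m : ℝ) * M / N) ≤ u m := by
  have hN0 : (0 : ℝ) < N := by exact_mod_cast hN
  have hl0 : 0 < lam := by linarith
  set H : ℝ := ((N + 1 + T : ℕ) : ℝ) with hH
  have hH0 : 0 < H := by rw [hH]; positivity
  set γ : ℝ := 1 - ((N : ℝ) + 1 + C') * (1 + 1 / N) / H - M / N with hγ
  have hγ0 : 0 < γ := by
    have e : γ = (H * (N - M) - ((N : ℝ) + 1 + C') * (N + 1)) / (H * N) := by
      rw [hγ]; field_simp; ring
    rw [e]
    exact div_pos (by linarith) (by positivity)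
  have hlarge : ∀ᶠ m : ℕ in atTop, c⁻¹ ≤ lam ^ (γ * m) := by
    have h1 : Tendsto (fun m : ℕ => (lam ^ γ) ^ m) atTop atTop :=
      tendsto_pow_atTop_atTop_of_one_lt (Real.one_lt_rpow hlam hγ0)
    filter_upwards [h1.eventually_ge_atTop c⁻¹] with m hm
    rwa [Real.rpow_mul hl0.le, Real.rpow_natCast]
  filter_upwards [hlarge, hk] with m hm hkm
  have h1 : (C * lam ^ (N + 1)) ^ k m ≤ lam ^ (((N : ℝ) + 1 + C') * k m) := by
    rw [Real.rpow_mul hl0.le, Real.rpow_natCast]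
    gcongr
    calc C * lam ^ (N + 1) ≤ lam ^ C' * lam ^ (N + 1) := by gcongr
      _ = lam ^ ((N : ℝ) + 1 + C') := by
          rw [← pow_add, ← Real.rpow_natCast]; congr 1; push_cast; ring
  have h2 : ((N : ℝ) + 1 + C') * k m ≤ m - γ * m - m * M / N := by
    have : (k m : ℝ) ≤ (1 + 1 / (N : ℝ)) * m / H := by
      rw [le_div_iff₀ hH0, mul_comm]; exact hkm
    calc ((N : ℝ) + 1 + C') * k m ≤ ((N : ℝ) + 1 + C') * ((1 + 1 / (N : ℝ)) * m / H) := by gcongr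
      _ = _ := by rw [hγ]; ring
  have h3 : (C * lam ^ (N + 1)) ^ k m ≤ lam ^ ((m : ℝ) - γ * m - m * M / N) :=
    h1.trans (Real.rpow_le_rpow_of_exponent_le hlam.le h2)
  have h4 := (hu m).trans (mul_le_mul_of_nonneg_left h3 (hu0 m).le)
  rw [Real.rpow_sub hl0, Real.rpow_sub hl0, Real.rpow_natCast, mul_div_assoc', mul_div_assoc',
    le_div_iff₀ (by positivity), le_div_iff₀ (by positivity)] at h4
  have h5 : 1 ≤ c * lam ^ (γ * m) := by
    rw [inv_le_iff_one_le_mul₀ hc] at hm; linarith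
  have h6 : (0 : ℝ) < lam ^ m := by positivity
  have h7 : (0 : ℝ) < lam ^ ((m : ℝ) * M / N) := by positivity
  refine le_of_mul_le_mul_right ?_ h6
  calc lam ^ ((m : ℝ) * M / N) * lam ^ m
      ≤ (c * lam ^ (γ * m)) * (lam ^ ((m : ℝ) * M / N) * lam ^ m) :=
        le_mul_of_one_le_left (by positivity) h5
    _ = c * lam ^ m * lam ^ ((m : ℝ) * M / N) * lam ^ (γ * m) := by ring
    _ ≤ u m * lam ^ m := h4

/-- The growth estimate along almost every fibre orbit that starts on an image of a horizontal
curve. -/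
theorem ae_tprod_ge (h : Setting a β ξ₀) {d : ℕ} (hd : 2 ≤ d) {φ : UnitAddCircle → ℝ}
    (hφ1 : ∀ θ, |φ θ| ≤ 1) (hφ : IsRealAnalytic φ) (hφc : ¬ ∃ c : ℝ, ∀ θ, φ θ = c) :
    ∃ lam > 1, ∀ M : ℕ, ∃ α₀ > 0, ∀ α, 0 < α → α < α₀ → ∀ x, |x| ≤ β → ∀ (n : ℕ) (k : ℤ),
      ∀ᵐ θ : ℝ ∂volume.restrict (icell d n k), ∀ᶠ m : ℕ in atTop,
        lam ^ ((m : ℝ) * M / (bindingTime a ξ₀ α : ℝ)) ≤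
          tprod α (fun i => fibOrb a d φ α x θ (n + i)) m := by
  obtain ⟨lam, hlam, C, hC, c, hc, α₁, hα₁, hgrow⟩ := h.tprod_growth
  refine ⟨lam, hlam, fun M => ?_⟩
  obtain ⟨C', hC'⟩ := pow_unbounded_of_one_lt C hlam
  obtain ⟨α₂, hα₂, hret⟩ := h.ae_returns_le hd hφ1 hφ hφc (C' + M + 4)
  obtain ⟨α₃, hα₃, hps⟩ := h.isPseudo_fibOrb
  obtain ⟨α₄, hα₄, hN⟩ := h.exists_le_bindingTime (1 + M * (C' + M + 5) + C')
  refine ⟨min (min α₁ α₂) (min α₃ α₄), by positivity, fun α hα hα' x hx n k => ?_⟩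
  simp only [lt_min_iff] at hα'
  obtain ⟨⟨l1, l2⟩, l3, l4⟩ := hα'
  have hN := hN α hα l4
  set N := bindingTime a ξ₀ α with hNdef
  have hNr : (1 : ℝ) + M * (C' + M + 5) + C' ≤ N := by exact_mod_cast hN
  filter_upwards [hret α hα l2 x hx n k] with θ hθ
  refine eventually_le_of_rare hlam (by linarith) (mul_pos hc hα) hC'.le (by omega) ?_
    (tprod_pos hα _) (hgrow α _ hα l1 ((hps α hα l3 d φ hφ1 x hx θ).shift n)) hθ
  push_cast
  have : (0 : ℝ) ≤ C' := by positivity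
  have : (0 : ℝ) ≤ M := by positivity
  nlinarith

end Setting

/-- Rescaling a cell to the unit interval preserves null sets. -/
theorem ae_of_ae_icell {d : ℕ} (hd : 2 ≤ d) {n : ℕ} {k : ℤ} {p : ℝ → Prop}
    (hp : ∀ᵐ θ : ℝ ∂volume.restrict (icell d n k), p θ) :
    ∀ᵐ t : ℝ ∂volume.restrict (Ico (0 : ℝ) 1), p ((t + k) / (d : ℝ) ^ n) := by
  have hd0 : (0 : ℝ) < (d : ℝ) ^ n := by positivity
  rw [ae_restrict_iff' (measurableSet_icell d n k), ae_iff] at hp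
  rw [ae_restrict_iff' measurableSet_Ico, ae_iff]
  have h1 := volume_affine_preimage hd n k {t | ¬(t ∈ Ico (0 : ℝ) 1 → p ((t + k) / (d : ℝ) ^ n))}
  have e : (fun θ : ℝ => (d : ℝ) ^ n * θ - k) ⁻¹'
      {t | ¬(t ∈ Ico (0 : ℝ) 1 → p ((t + k) / (d : ℝ) ^ n))} =
      {θ | ¬(θ ∈ icell d n k → p θ)} := by
    ext θ
    rw [mem_preimage, mem_ofPred_eq, mem_ofPred_eq, mem_icell_iff, sub_add_cancel,
      mul_div_cancel_left₀ _ hd0.ne']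
  rw [e, hp] at h1
  rcases mul_eq_zero.1 h1.symm with h2 | h2
  · rw [ENNReal.ofReal_eq_zero] at h2
    exact absurd h2 (not_le.2 (by positivity))
  · exact h2

end VianaMap

end

theorem mainTheorem5 (a : ℝ) (ha : a ∈ Ioo (1 : ℝ) 2)
    (hpre : VianaMap.IsStrictlyPreperiodic (VianaMap.quad a) 0)
    (d : ℕ) (hd : 2 ≤ d)
    (φ : UnitAddCircle → ℝ) (hφ : VianaMap.IsRealAnalytic φ) (hφc : ¬ ∃ c : ℝ, ∀ θ, φ θ = c)
    (hφ1 : ∀ θ, |φ θ| ≤ 1)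
    (β : ℝ) (hβ1 : 1 < β) (hβp : β < |(-1 - Real.sqrt (1 + 4 * a)) / 2|)
    (hβB : VianaMap.quad a '' Icc (-β) β ⊆ interior (Icc (-β) β))
    (ξ₀ : ℝ) (hξ : 0 < ξ₀)
    (hξc : ∀ i : ℕ, 1 ≤ i → (VianaMap.quad a)^[i] 0 ∉ Ioo (-(2 * ξ₀)) (2 * ξ₀))
    (n₀ : ℕ) :
    ∃ lam₁ : ℝ, 1 < lam₁ ∧ ∀ M : ℕ, 1 ≤ M → ∃ α₀ : ℝ, 0 < α₀ ∧ ∀ α : ℝ, 0 < α → α < α₀ →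
      ∀ X : ℝ → ℝ, VianaMap.IsAdmissible a d φ α β n₀ X →
        MapsTo X (Ico 0 1) (VianaMap.critNhd α) →
        ∀ᵐ θ : ℝ ∂(volume.restrict (Ico (0 : ℝ) 1)), ∀ᶠ n : ℕ in atTop,
          lam₁ ^ ((n : ℝ) * (M : ℝ) / (VianaMap.bindingTime a ξ₀ α : ℝ)) ≤
            |VianaMap.truncDeriv a d φ α n (θ : UnitAddCircle) (X θ)| := by
  have hfix : |(-1 - Real.sqrt (1 + 4 * a)) / 2| = VianaMap.fixPt a := by
    rw [VianaMap.fixPt, show (-1 - Real.sqrt (1 + 4 * a)) / 2 = -((1 + Real.sqrt (1 + 4 * a)) / 2)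
      by ring, abs_neg, abs_of_nonneg (by positivity)]
  have h : VianaMap.Setting a β ξ₀ :=
    ⟨ha.1, ha.2, hpre, hβ1, hfix ▸ hβp, hβB, hξ, hξc⟩
  obtain ⟨lam, hlam, hM⟩ := h.ae_tprod_ge hd hφ1 hφ hφc
  refine ⟨lam, hlam, fun M _ => ?_⟩
  obtain ⟨α₀, hα₀, hα⟩ := hM M
  refine ⟨α₀, hα₀, fun α h0 h1 X hX _ => ?_⟩
  obtain ⟨-, n, -, j, -, x₀, hx₀, hXn⟩ := hX
  have hd0 : (0 : ℝ) < (d : ℝ) ^ n := by positivity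
  filter_upwards [VianaMap.ae_of_ae_icell hd (hα α h0 h1 x₀ (abs_le.2 hx₀) n j),
    ae_restrict_mem measurableSet_Ico] with t ht htI
  filter_upwards [ht] with m hm
  -- the point of the cell that is mapped to `t`
  set θ : ℝ := (t + (j : ℤ)) / (d : ℝ) ^ n with hθ
  have hθt : (d : ℝ) ^ n * θ = t + (j : ℤ) := by rw [hθ]; field_simp
  have hXt : X t = VianaMap.fibOrb a d φ α x₀ θ n := by
    have hmem : θ ∈ VianaMap.cell d n j := by
      rw [hθ, VianaMap.cell, mem_Ico, Int.cast_natCast]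
      exact ⟨by gcongr; linarith [htI.1], by gcongr ?_ / _; linarith [htI.2]⟩
    have := hXn θ hmem
    rwa [hθt, Int.fract_add_intCast, Int.fract_eq_self.2 htI] at this
  refine (hm.trans_eq ?_).trans (le_abs_self _)
  unfold VianaMap.tprod VianaMap.truncDeriv
  refine Finset.prod_congr rfl fun i _ => ?_
  beta_reduce
  rw [VianaMap.fibOrb_add_eq a φ α x₀ n i j θ, hθt, add_sub_cancel_right, ← hXt]
  rfl
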